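/- **Setting.** Let $d\ge 1$, $\kappa\ge 2d+1$ and $b\in(0,1)$. The scenery $\xi=(\xi_z)_{z\in\mathbb Z^d}$ is i.i.d. uniform on $\kappa$ colours. Independently, a branching random walk starts with one particle at the origin; at each step every particle is replaced by two particles with probability $b$ and is left intact with probability $1-b$, and every resulting particle then jumps to a uniformly chosen nearest neighbour, everything being independent. The observations $\chi_T$ up to time $T$ are the genealogical tree up to generation $T$, each particle being coloured by the colour of $\xi$ at its position (positions are not observed). A string appears in the observations up to time $T$ if it is read at consecutive times along a line of descent ending no later than $T$. Write $\mathcal K_x(s)=x+[-s,s]^d$ (in $\mathbb Z^d$), $\mathcal K(s)=\mathcal K_0(s)$, and say that colourings of $A,B\subset\mathbb Z^d$ are equivalent ($\sim$) if a Euclidean isometry of $A$ onto $B$ carries one to the other. Put $\ell_n=\lfloor(\ln n)^2\rfloor$ and $m=\lfloor n^{1/4}\rfloor$. **Algorithm $\Lambda^n$** (input $\chi_{n^4}$, output a colouring of $\mathcal K(4n)$). 1. A string $w_2$ of size $\ell_n$ is a *short word* if there are strings $w_1,w_3$ of size $\ell_n$ such that $w_1w_2w_3$ appears up to time $n^2$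 and $w_2$ is the only string $w$ of size $\ell_n$ for which $w_1ww_3$ appears up to time $n^4$. 2. Short words are glued together, one after the other and at either end, whenever they coincide with what has been assembled on $\ell_n-1$ consecutive letters. The strings of size $8n+1$ so obtained are the *long words*. 3. The first two phases are run with parameter $m$ instead of $n$. A long word $w_0$ of level $m$ and a long word $w_L$ of level $n$ containing $w_0$ with coinciding middle letters are chosen. 4. A long word $w$ is *estimated to be a neighbour* of a long word $v$ if there are strings $v_a,v_b,v_c,w_b$, of size $\ell_n$ except that $v_b$ has size $\ell_n-2$, such that $v_av_bv_c$ is contained in $v$, $v_aw_bv_c$ appears up to time $n^4$, $w_b$ is contained in $w$, and the middle letter of $v_b$ has the same position in $v$ as the middle letter of $w_b$ in $w$. Long words are placed on all the lines of $\mathcal K(4n)$ parallel to some coordinate axis, with $w_L$ on the line through the origin, so that the words on any two lines at distance $1$ are estimated to be neighbours of each other and no string of size $\ell_n$ occurs in the words of two different lines. The resulting colouring is the output (any one of the possible outcomes, or an arbitrary colouring if there is none). **Theorem.** There are a constant $C>0$ and an integer $N$, depending only on $d,\kappa,b$, such that for all $n\ge N$ and whichever choices the algorithm $\Lambda^n$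 makes, $$P\Big[\exists x\in\mathcal K(\sqrt n):\ \Lambda^n(\chi_{n^4})\sim\xi_{\mathcal K_x(4n)}\Big]\ \ge\ 1-\exp\big(-C(\ln n)^2\big).$$ -/

import Mathlib

open MeasureTheory ProbabilityTheory

namespace BRWScenery

/-! ### Sites, boxes, isometries -/

/-- Sites of the lattice `ℤ^d`. -/
abbrev Site (d : ℕ) := Fin d → ℤ

/-- The box `𝒦_x(s) = x + [-s, s]^d` in `ℤ^d`, for a real size `s`. -/
def box {d : ℕ} (x : Site d) (s : ℝ) : Set (Site d) :=
  {z | ∀ i, |((z i - x i : ℤ) : ℝ)| ≤ s}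

/-- The square of the Euclidean distance on `ℤ^d`. -/
def sqDist {d : ℕ} (x y : Site d) : ℤ := ∑ i, (x i - y i) ^ 2

/-- Two colourings of subsets `A`, `B` of `ℤ^d` are equivalent when a (Euclidean) isometry of `A`
onto `B` carries one to the other. -/
def Equivalent {d κ : ℕ} {A B : Set (Site d)} (f : A → Fin κ) (g : B → Fin κ) : Prop :=
  ∃ φ : A ≃ B, (∀ x y : A, sqDist (φ x : Site d) (φ y) = sqDist (x : Site d) y) ∧
    ∀ x : A, g (φ x) = f x

/-! ### The branching random walk and the scenery

A potential particle is a finite binary word, most recent letter first: the particle `v` of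
generation `v.length` has the potential children `false :: v` (always born) and `true :: v` (born
when `v` splits in two), so that the ancestors of `v` are its tails and `[]` is the root. -/

/-- Potential particles. -/
abbrev Particle := List Bool

/-- The randomness of the branching random walk: for each potential particle, whether it splits,
and the jump (a coordinate axis and a sign) by which it leaves the position of its parent. -/
abbrev Evolution (d : ℕ) := Particle → Bool × (Fin d × Bool)

/-- Sceneries: colourings of `ℤ^d` with `κ` colours. -/
abbrev Scenery (d κ : ℕ) := Site d → Fin κ

/-- The unit vector with the given axis and sign (`true` is `+`). -/
def unitVec {d : ℕ} (e : Fin d × Bool) : Site d :=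
  Pi.single e.1 (if e.2 then 1 else -1)

/-- The particle is born in the given evolution, i.e. is a vertex of the genealogical tree. -/
def IsBorn {d : ℕ} (η : Evolution d) : Particle → Prop
  | [] => True
  | c :: v => IsBorn η v ∧ (c = true → (η v).1 = true)

/-- The position of a particle. The root is at the origin. -/
def position {d : ℕ} (η : Evolution d) : Particle → Site d
  | [] => 0
  | c :: v => position η v + unitVec (η (c :: v)).2

/-- The law `P₁` of the branching random walk: independently for all particles, a particle splits
in two with probability `b`, and jumps to a uniformly chosen nearest neighbour. -/
noncomputable def walkLaw (d : ℕ) (b : unitInterval) : Measure (Evolution d) :=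
  Measure.infinitePi fun _ : Particle =>
    (bernoulliMeasure true false b).prod (uniformOn (Set.univ : Set (Fin d × Bool)))

/-- The law `P₂` of the scenery: i.i.d. uniform colours. -/
noncomputable def sceneryLaw (d κ : ℕ) : Measure (Scenery d κ) :=
  Measure.infinitePi fun _ : Site d => uniformOn (Set.univ : Set (Fin κ))

/-- The joint law `P = P₁ ⊗ P₂`. -/
noncomputable def jointLaw (d κ : ℕ) (b : unitInterval) : Measure (Evolution d × Scenery d κ) :=
  (walkLaw d b).prod (sceneryLaw d κ)

/-! ### Observations -/

/-- Observations: (partial) colourings of the binary tree; `none` marks the particles which are not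
born or not recorded. -/
abbrev Observations (κ : ℕ) := Particle → Option (Fin κ)

open Classical in
/-- The observations `χ_T` up to time `T`: the genealogical tree up to generation `T`, each of its
particles being coloured with the colour of the scenery at its position. Positions are not
recorded. -/
noncomputable def observations {d κ : ℕ} (T : ℕ) (η : Evolution d) (ξ : Scenery d κ) :
    Observations κ :=
  fun v => if v.length ≤ T ∧ IsBorn η v then some (ξ (position η v)) else none

/-- Strings of colours. -/
abbrev Str (κ : ℕ) := List (Fin κ)

/-- The records along the line of descent from the root to `u`, in chronological order. -/
def lineRecord {κ : ℕ} (o : Observations κ) (u : Particle) : List (Option (Fin κ)) :=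
  u.tails.reverse.map o

/-- The string `w` appears in the observations up to time `T`: it is seen at consecutive times along
a line of descent ending no later than `T`. -/
def Appears {κ : ℕ} (o : Observations κ) (T : ℕ) (w : Str κ) : Prop :=
  ∃ u : Particle, u.length ≤ T ∧ w.map some <:+: lineRecord o u

/-- The string `w` is contained in the string `v`, starting at the position `p` of `v` (positions
are counted from `0`). -/
def OccursAt {κ : ℕ} (w v : Str κ) (p : ℕ) : Prop :=
  ∃ s t : Str κ, v = s ++ w ++ t ∧ s.length = p

/-! ### The algorithm -/

/-- The size `(ln n)²` of the short words (integer part). -/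
noncomputable def shortSize (n : ℕ) : ℕ := ⌊Real.log n ^ 2⌋₊

/-- The number `8n + 1` of sites of a line of the box `𝒦(4n)`: the size of the long words. -/
def longSize (n : ℕ) : ℕ := 8 * n + 1

/-- The parameter `n^{1/4}` (integer part) used to find the seed word. -/
noncomputable def seedParam (n : ℕ) : ℕ := ⌊(n : ℝ) ^ (1 / 4 : ℝ)⌋₊

/-- First phase: the set of short words. -/
def ShortWords {κ : ℕ} (n : ℕ) (o : Observations κ) : Set (Str κ) :=
  {w₂ | w₂.length = shortSize n ∧
    ∃ w₁ w₃ : Str κ, w₁.length = shortSize n ∧ w₃.length = shortSize n ∧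
      Appears o (n ^ 2) (w₁ ++ w₂ ++ w₃) ∧
      ∀ w : Str κ, w.length = shortSize n → Appears o (n ^ 4) (w₁ ++ w ++ w₃) → w = w₂}

/-- Strings assembled from the strings in `S` (all of one size `l`), which are glued one after the
other, at either end, when they coincide with what has been assembled on `l - 1` letters. -/
inductive Assembled {κ : ℕ} (S : Set (Str κ)) : Str κ → Prop
  | base {s : Str κ} : s ∈ S → Assembled S s
  | right {v s : Str κ} {c : Fin κ} :
      Assembled S (v ++ s) → s ++ [c] ∈ S → Assembled S (v ++ s ++ [c])
  | left {s v : Str κ} {c : Fin κ} :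
      Assembled S (s ++ v) → c :: s ∈ S → Assembled S (c :: s ++ v)

/-- Second phase: the set of long words. -/
def LongWords {κ : ℕ} (n : ℕ) (o : Observations κ) : Set (Str κ) :=
  {w | Assembled (ShortWords n o) w ∧ w.length = longSize n}

/-- Third phase: `w` is a long word which contains, centred, a long word `w₀` obtained from the
first two phases with parameter `n^{1/4}`. (The middle letters of `w` and `w₀` have the positions
`4n` and `4 n^{1/4}`.) -/
def IsSeeded {κ : ℕ} (n : ℕ) (o : Observations κ) (w : Str κ) : Prop :=
  w ∈ LongWords n o ∧ ∃ w₀ ∈ LongWords (seedParam n) o,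
    ∃ p : ℕ, OccursAt w₀ w p ∧ p + 4 * seedParam n = 4 * n

/-- Fourth phase, criterion for being neighbours: `v` contains `v_a v_b v_c`, while `v_a w_b v_c` is
observed up to time `n⁴`, `w` contains `w_b`, and the middle letter of `v_b` has the same position
in `v` as the middle letter of `w_b` in `w` (so `w_b`, which is two letters longer, starts one
position earlier). -/
def Neighbours {κ : ℕ} (n : ℕ) (o : Observations κ) (v w : Str κ) : Prop :=
  ∃ va vb vc wb : Str κ,
    va.length = shortSize n ∧ vb.length + 2 = shortSize n ∧
    vc.length = shortSize n ∧ wb.length = shortSize n ∧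
    Appears o (n ^ 4) (va ++ wb ++ vc) ∧
    ∃ p q : ℕ, OccursAt (va ++ vb ++ vc) v p ∧ OccursAt wb w q ∧ p + va.length = q + 1

/-- The sites of the box `𝒦(4n)`. -/
abbrev OutBox (d n : ℕ) := ↥(box (0 : Site d) (4 * (n : ℝ)))

/-- The `k`-th site of the line of `𝒦(4n)` through `z` parallel to the axis `j`: its `j`-th
coordinate is `k - 4n`, the others are those of `z`. -/
def lineSite {d n : ℕ} (j : Fin d) (z : OutBox d n) (k : Fin (longSize n)) : OutBox d n :=
  ⟨Function.update z.1 j ((k : ℤ) - 4 * (n : ℤ)), by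
    intro i
    by_cases h : i = j
    · subst h
      have hk : (k : ℕ) < 8 * n + 1 := k.2
      have h1 : ((k : ℕ) : ℝ) ≤ 8 * (n : ℝ) := by exact_mod_cast Nat.lt_succ_iff.mp hk
      have h0 : (0 : ℝ) ≤ ((k : ℕ) : ℝ) := Nat.cast_nonneg _
      simp only [Function.update_self, Pi.zero_apply, sub_zero]
      push_cast
      rw [abs_le]
      constructor <;> linarith
    · simpa [Function.update_of_ne h] using z.2 i⟩

/-- The string written by the colouring `c` of `𝒦(4n)` on the line through `z` parallel to the axis
`j`, read in the positive direction. -/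
def lineWord {d κ n : ℕ} (c : OutBox d n → Fin κ) (j : Fin d) (z : OutBox d n) : Str κ :=
  List.ofFn fun k => c (lineSite j z k)

/-- The origin, as a site of `𝒦(4n)`. -/
def origin (d n : ℕ) : OutBox d n := ⟨0, by intro i; simp⟩

/-- `c` is a possible outcome of the algorithm with parameter `n` on the observations `o`: long words
are placed parallel to each other, on all the lines of the box `𝒦(4n)` parallel to some axis, with a
word selected in the third phase centred at the origin, with words which are estimated to be
neighbours on any two lines at distance one, and such that no short string occurs on two different
lines. -/
def IsOutcome {d κ : ℕ} (n : ℕ) (o : Observations κ) (c : OutBox d n → Fin κ) : Prop :=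
  ∃ j : Fin d,
    (∀ z, lineWord c j z ∈ LongWords n o) ∧
    IsSeeded n o (lineWord c j (origin d n)) ∧
    (∀ z z' : OutBox d n, z.1 j = z'.1 j → sqDist z.1 z'.1 = 1 →
      Neighbours n o (lineWord c j z) (lineWord c j z')) ∧
    ∀ z z' : OutBox d n, (∃ i, i ≠ j ∧ z.1 i ≠ z'.1 i) →
      ∀ s : Str κ, s.length = shortSize n →
        s <:+: lineWord c j z → ¬ s <:+: lineWord c j z'

/-- The map `Λ` carries out the algorithm with parameter `n`: it returns one of the possible outcomes,
whichever choices it makes, if there is one, and an arbitrary colouring otherwise. -/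
def CarriesOut {d κ : ℕ} (n : ℕ) (Λ : Observations κ → OutBox d n → Fin κ) : Prop :=
  ∀ o : Observations κ, (∃ c : OutBox d n → Fin κ, IsOutcome n o c) → IsOutcome n o (Λ o)

end BRWScenery

open BRWScenery

/-! A deterministic argument shows that the algorithm succeeds whenever the scenery is `Separated`
and the observations are `Explored`, both at level `n` and at level `m = seedParam n`. Write `L =
shortSize n`.

Deterministic part. A path between two visits to a straight line with no delay must follow the line,
so `rigid` forces straight words to be short words (`mem_shortWords_of_ray`) and makes equal
straight words come from the same ray (`ray_unique`). Conversely, the jumps under a short word may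
be rearranged without moving the end points; by uniqueness all rearrangements read the same letters,
and `bent` excludes this unless all jumps agree (`straight_of_mem_shortWords`). Hence long words are
straight, and estimated neighbours lie on parallel rays at distance at most one
(`parallel_of_neighbours`). An outcome thus defines a map from the output box to the lattice that
moves neighbours by at most one step; since no short string is shared by two lines, it is injective
at distance two. Such a map is a signed permutation of the axes up to translation
(`exists_signed_permutation`), and the seed keeps its centre within `m ^ 2 ≤ √n` of the origin. The
true scenery is itself an outcome (`isOutcome_scenery`), so the algorithm never falls back on its
default.

Scenery. For a path avoiding a ray at equal times, the colour coincidences can be ordered so that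
each involves a fresh site, unless path and ray exchange sites. There are at most `(2d)^k` choices
of jumps against a probability `κ^(-k)`, and `2d < κ`. An exchange costs independence but forces the
path to run backwards along the ray, which removes more entropy than it loses (`count_le_rate`,
`measure_not_rigid_le`).

Walk. The probability of reaching a site and then making prescribed jumps satisfies `FrontIneq`. A
cosine bump grows geometrically to height `1/2` under this recursion and can then be moved one site
at a time, so the front has positive speed; above `1/2` failures contract by `1 - b/2` per
generation (`exists_front_time`). A union bound gives `exists_cover_time`. All errors are a
polynomial, or `(2d)^(3L)`, times something small enough to leave `exp(-c (log n)²)`. Passing to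
level `m` only changes the constant. -/

namespace BRWScenery

/-! ### Lattice geometry -/

/-- Jumps: an axis and a sign. -/
abbrev Jump (d : ℕ) := Fin d × Bool

/-- The `ℓ¹` norm on `ℤ^d`. -/
def l1 {d : ℕ} (x : Site d) : ℤ := ∑ i, |x i|

/-- The box `[-N, N]^d`. -/
def cube (d N : ℕ) : Set (Site d) := {z | ∀ i, |z i| ≤ (N : ℤ)}

/-- The lattice path from `x` with steps `s`. -/
def trail {d : ℕ} (x : Site d) (s : ℕ → Jump d) (t : ℕ) : Site d :=
  x + ∑ i ∈ Finset.range t, unitVec (s i)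

/-- The straight path from `x` in the direction `e`. -/
def ray {d : ℕ} (x : Site d) (e : Jump d) (t : ℕ) : Site d := x + (t : ℤ) • unitVec e

/-- The word of length `k` read by the scenery along a path. -/
def readAlong {d κ : ℕ} (ξ : Scenery d κ) (R : ℕ → Site d) (k : ℕ) : Str κ :=
  (List.range k).map fun t => ξ (R t)

variable {d κ : ℕ}

theorem l1_nonneg (x : Site d) : 0 ≤ l1 x := Finset.sum_nonneg fun _ _ => abs_nonneg _

theorem l1_add_le (x y : Site d) : l1 (x + y) ≤ l1 x + l1 y := by
  unfold l1
  rw [← Finset.sum_add_distrib]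
  exact Finset.sum_le_sum fun i _ => abs_add_le _ _

theorem l1_neg (x : Site d) : l1 (-x) = l1 x := by simp [l1]

theorem l1_sub_comm (x y : Site d) : l1 (x - y) = l1 (y - x) := by
  rw [← l1_neg, neg_sub]

theorem l1_sub_le (x y : Site d) : l1 (x - y) ≤ l1 x + l1 y := by
  rw [sub_eq_add_neg, ← l1_neg y]; exact l1_add_le _ _

theorem l1_zero : l1 (0 : Site d) = 0 := by simp [l1]

theorem l1_eq_zero {x : Site d} : l1 x = 0 ↔ x = 0 := by
  constructor
  · intro h
    funext i
    have := (Finset.sum_eq_zero_iff_of_nonneg (fun i _ => abs_nonneg (x i))).1 h i (Finset.mem_univ _)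
    simpa using this
  · rintro rfl; exact l1_zero

theorem abs_le_l1 (x : Site d) (i : Fin d) : |x i| ≤ l1 x :=
  Finset.single_le_sum (f := fun i => |x i|) (fun _ _ => abs_nonneg _) (Finset.mem_univ i)

/-- The sign of a jump. -/
def sgn {d : ℕ} (e : Jump d) : ℤ := if e.2 then 1 else -1

theorem sgn_sq (e : Jump d) : sgn e * sgn e = 1 := by unfold sgn; split <;> simp

theorem abs_sgn (e : Jump d) : |sgn e| = 1 := by unfold sgn; split <;> simp

theorem unitVec_eq (e : Jump d) : unitVec e = Pi.single e.1 (sgn e) := rfl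

theorem unitVec_same (e : Jump d) : unitVec e e.1 = sgn e := by simp [unitVec_eq]

theorem unitVec_ne (e : Jump d) {i : Fin d} (h : i ≠ e.1) : unitVec e i = 0 := by
  simp [unitVec_eq, h]

theorem sgn_inj {e f : Jump d} (h1 : e.1 = f.1) (h2 : sgn e = sgn f) : e = f := by
  obtain ⟨a, b⟩ := e; obtain ⟨c, g⟩ := f
  simp only at h1
  subst h1
  cases b <;> cases g <;> simp_all [sgn]

theorem unitVec_injective : Function.Injective (unitVec : Jump d → Site d) := by
  intro e f h
  have h1 : e.1 = f.1 := by
    by_contra hne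
    have := congrFun h e.1
    rw [unitVec_same, unitVec_ne f hne] at this
    have h2 := abs_sgn e
    simp [this] at h2
  refine sgn_inj h1 ?_
  have := congrFun h e.1
  rw [unitVec_same, h1, unitVec_same] at this
  exact this

theorem l1_smul (a : ℤ) (x : Site d) : l1 (a • x) = |a| * l1 x := by
  simp [l1, Finset.mul_sum, abs_mul]

theorem l1_unitVec (e : Jump d) : l1 (unitVec e) = 1 := by
  unfold l1
  rw [Finset.sum_eq_single e.1]
  · rw [unitVec_same, abs_sgn]
  · intro i _ hi; rw [unitVec_ne e hi]; rfl
  · simp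

theorem l1_unitVec_sub {e f : Jump d} (h : e ≠ f) : l1 (unitVec e - unitVec f) = 2 := by
  by_cases h1 : e.1 = f.1
  · have h2 : unitVec e - unitVec f = (2 * sgn e) • (Pi.single e.1 1 : Site d) := by
      have : sgn f = - sgn e := by
        have h3 : sgn e ≠ sgn f := fun h3 => h (sgn_inj h1 h3)
        unfold sgn at *
        split at h3 <;> split at h3 <;> simp_all
      rw [unitVec_eq, unitVec_eq, this, ← h1]
      funext i
      by_cases hi : i = e.1
      · subst hi; simp; ring
      · simp [hi]
    rw [h2, l1_smul, abs_mul, abs_sgn]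
    have : l1 (Pi.single e.1 1 : Site d) = 1 := by
      simpa [unitVec_eq, sgn] using l1_unitVec (e.1, true)
    rw [this]; rfl
  · unfold l1
    rw [← Finset.add_sum_erase _ _ (Finset.mem_univ e.1),
      ← Finset.add_sum_erase _ _ (Finset.mem_erase.2 ⟨Ne.symm h1, Finset.mem_univ f.1⟩),
      Finset.sum_eq_zero]
    · simp only [Pi.sub_apply]
      rw [unitVec_same, unitVec_same, unitVec_ne f h1, unitVec_ne e (Ne.symm h1)]
      simp [abs_sgn]
    · intro i hi
      simp only [Finset.mem_erase] at hi
      simp only [Pi.sub_apply]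
      rw [unitVec_ne e hi.2.1, unitVec_ne f hi.1]; simp

/-- A vector which is close to both ends of a geodesic along an axis is small. -/
theorem l1_le_of_between {u : Site d} {e : Jump d} {α β c : ℤ}
    (h1 : l1 (u + α • unitVec e) ≤ α + c) (h2 : l1 (β • unitVec e - u) ≤ β + c) : l1 u ≤ c := by
  -- Off the axis of `e` both bounds contain the same sum. Along it, `u` lengthens one of the two
  -- distances by `|u e.1|`, and that bound alone gives the claim.
  have key : ∀ v : Site d, l1 v = |v e.1| + ∑ i ∈ Finset.univ.erase e.1, |v i| := fun v =>
    (Finset.add_sum_erase _ _ (Finset.mem_univ e.1)).symm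
  rw [key] at h1 h2 ⊢
  have e1 : ∑ i ∈ Finset.univ.erase e.1, |(u + α • unitVec e) i| =
      ∑ i ∈ Finset.univ.erase e.1, |u i| := Finset.sum_congr rfl fun i hi => by
    simp [unitVec_ne e (Finset.ne_of_mem_erase hi)]
  have e2 : ∑ i ∈ Finset.univ.erase e.1, |(β • unitVec e - u) i| =
      ∑ i ∈ Finset.univ.erase e.1, |u i| := Finset.sum_congr rfl fun i hi => by
    simp [unitVec_ne e (Finset.ne_of_mem_erase hi)]
  rw [e1] at h1
  rw [e2] at h2
  simp only [Pi.add_apply, Pi.sub_apply, Pi.smul_apply, unitVec_same, smul_eq_mul] at h1 h2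
  have hs : sgn e = 1 ∨ sgn e = -1 := by unfold sgn; split <;> simp
  rcases hs with hs | hs <;> rw [hs] at h1 h2
  · have a1 := le_abs_self (u e.1 + α * 1)
    have a2 := le_abs_self (β * 1 - u e.1)
    rcases abs_cases (u e.1) with h | h <;> linarith
  · have a1 := neg_abs_le (u e.1 + α * -1)
    have a2 := neg_abs_le (β * -1 - u e.1)
    rcases abs_cases (u e.1) with h | h <;> linarith

theorem trail_zero (x : Site d) (s : ℕ → Jump d) : trail x s 0 = x := by simp [trail]

theorem trail_succ (x : Site d) (s : ℕ → Jump d) (t : ℕ) :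
    trail x s (t + 1) = trail x s t + unitVec (s t) := by
  simp [trail, Finset.sum_range_succ, add_assoc]

theorem trail_add (x : Site d) (s : ℕ → Jump d) (a b : ℕ) :
    trail x s (a + b) = trail (trail x s a) (fun i => s (a + i)) b := by
  simp [trail, Finset.sum_range_add, add_assoc]

theorem trail_const (x : Site d) (e : Jump d) (t : ℕ) : trail x (fun _ => e) t = ray x e t := by
  simp [trail, ray]

theorem trail_congr {x : Site d} {s s' : ℕ → Jump d} {t : ℕ} (h : ∀ i < t, s i = s' i) :
    trail x s t = trail x s' t := by
  unfold trail
  rw [Finset.sum_congr rfl fun i hi => by rw [h i (Finset.mem_range.1 hi)]]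

theorem l1_trail_sub_le (x : Site d) (s : ℕ → Jump d) (a b : ℕ) :
    l1 (trail x s (a + b) - trail x s a) ≤ b := by
  induction b with
  | zero => simp [l1_zero]
  | succ b ih =>
    rw [← add_assoc, trail_succ, add_sub_right_comm]
    refine (l1_add_le _ _).trans ?_
    rw [l1_unitVec]; push_cast; linarith

theorem l1_trail_sub_le' (x : Site d) (s : ℕ → Jump d) {a b : ℕ} (h : a ≤ b) :
    l1 (trail x s b - trail x s a) ≤ (b : ℤ) - a := by
  obtain ⟨c, rfl⟩ := Nat.exists_eq_add_of_le h
  have := l1_trail_sub_le x s a c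
  push_cast; linarith

theorem ray_zero (x : Site d) (e : Jump d) : ray x e 0 = x := by simp [ray]

theorem ray_succ (x : Site d) (e : Jump d) (t : ℕ) : ray x e (t + 1) = ray x e t + unitVec e := by
  simp [ray, add_smul, add_assoc]

theorem ray_add (x : Site d) (e : Jump d) (a b : ℕ) : ray x e (a + b) = ray (ray x e a) e b := by
  simp [ray, add_smul, add_assoc]

theorem ray_sub (x : Site d) (e : Jump d) (a b : ℕ) :
    ray x e b - ray x e a = ((b : ℤ) - a) • unitVec e := by
  simp [ray, sub_smul]

theorem ray_injective (x : Site d) (e : Jump d) : Function.Injective (ray x e) := by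
  intro a b h
  have h1 := ray_sub x e a b
  rw [h, sub_self] at h1
  have h2 := congrArg l1 h1
  rw [l1_smul, l1_unitVec, l1_zero] at h2
  have := abs_eq_zero.1 (by linarith : |(b : ℤ) - a| = 0)
  omega

theorem mem_cube_of_l1 {x y : Site d} {M N : ℕ} (hx : x ∈ cube d M) (h : M + l1 (y - x) ≤ N) :
    y ∈ cube d N := by
  intro i
  have h1 := hx i
  have h2 := abs_le_l1 (y - x) i
  have h3 : |y i| ≤ |x i| + |y i - x i| := by
    have := abs_add_le (x i) (y i - x i); simpa using this
  simp only [Pi.sub_apply] at h2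
  linarith

theorem cube_mono {M N : ℕ} (h : M ≤ N) : cube d M ⊆ cube d N := fun x hx i =>
  (hx i).trans (by exact_mod_cast h)

theorem ray_mem_cube {x : Site d} {M N t : ℕ} (hx : x ∈ cube d M) (e : Jump d) (h : M + t ≤ N) :
    ray x e t ∈ cube d N := by
  refine mem_cube_of_l1 hx ?_
  have : l1 (ray x e t - x) = t := by
    rw [ray, add_sub_cancel_left, l1_smul, l1_unitVec]; simp
  rw [this]; exact_mod_cast h

/-! ### Words read along paths -/

@[simp] theorem length_readAlong (ξ : Scenery d κ) (R : ℕ → Site d) (k : ℕ) :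
    (readAlong ξ R k).length = k := by simp [readAlong]

theorem getElem_readAlong (ξ : Scenery d κ) (R : ℕ → Site d) (k t : ℕ)
    (h : t < (readAlong ξ R k).length) : (readAlong ξ R k)[t] = ξ (R t) := by simp [readAlong]

theorem readAlong_eq_iff {ξ : Scenery d κ} {R R' : ℕ → Site d} {k : ℕ} :
    readAlong ξ R k = readAlong ξ R' k ↔ ∀ t < k, ξ (R t) = ξ (R' t) := by
  simp [readAlong]

theorem readAlong_add (ξ : Scenery d κ) (R : ℕ → Site d) (a b : ℕ) :
    readAlong ξ R (a + b) = readAlong ξ R a ++ readAlong ξ (fun t => R (a + t)) b := by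
  simp [readAlong, List.range_add, Function.comp_def]

theorem readAlong_split {ξ : Scenery d κ} {R : ℕ → Site d} {k : ℕ} {v w : Str κ}
    (h : v ++ w = readAlong ξ R k) :
    v = readAlong ξ R v.length ∧ w = readAlong ξ (fun t => R (v.length + t)) w.length := by
  have hk : k = v.length + w.length := by
    have := congrArg List.length h; simpa using this.symm
  rw [hk, readAlong_add] at h
  exact List.append_inj h (by simp)

theorem occursAt_readAlong {ξ : Scenery d κ} {R : ℕ → Site d} {k p : ℕ} {w : Str κ}
    (h : OccursAt w (readAlong ξ R k) p) :
    w = readAlong ξ (fun t => R (p + t)) w.length ∧ p + w.length ≤ k := by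
  obtain ⟨s, t, h, rfl⟩ := h
  have hk := congrArg List.length h
  simp only [length_readAlong, List.length_append] at hk
  have := readAlong_split h.symm
  exact ⟨(readAlong_split this.1).2, by omega⟩

theorem readAlong_occursAt (ξ : Scenery d κ) (R : ℕ → Site d) {k p l : ℕ} (h : p + l ≤ k) :
    OccursAt (readAlong ξ (fun t => R (p + t)) l) (readAlong ξ R k) p := by
  obtain ⟨c, rfl⟩ := Nat.exists_eq_add_of_le h
  refine ⟨readAlong ξ R p, readAlong ξ (fun t => R (p + l + t)) c, ?_, by simp⟩
  rw [readAlong_add, readAlong_add]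

theorem isInfix_iff_occursAt {v w : Str κ} : w <:+: v ↔ ∃ p, OccursAt w v p := by
  constructor
  · rintro ⟨s, t, h⟩; exact ⟨s.length, s, t, h.symm, rfl⟩
  · rintro ⟨p, s, t, h, -⟩; exact ⟨s, t, h.symm⟩

theorem readAlong_succ' (ξ : Scenery d κ) (R : ℕ → Site d) (k : ℕ) :
    readAlong ξ R (k + 1) = ξ (R 0) :: readAlong ξ (fun t => R (t + 1)) k := by
  simp [readAlong, List.range_succ_eq_map, Function.comp_def]

theorem readAlong_succ (ξ : Scenery d κ) (R : ℕ → Site d) (k : ℕ) :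
    readAlong ξ R (k + 1) = readAlong ξ R k ++ [ξ (R k)] := by
  simp [readAlong, List.range_succ]

end BRWScenery

namespace BRWScenery

variable {d κ : ℕ}

/-! ### The two properties of typical sceneries and of typical walks -/

/-- A scenery in which straight words are recognised, and in which a path with a bend can be told
from its rearrangements. -/
structure Separated (n : ℕ) (ξ : Scenery d κ) : Prop where
  rigid : ∀ x ∈ cube d (n ^ 2), ∀ e : Jump d, ∀ y ∈ cube d (n ^ 4), ∀ s : ℕ → Jump d,
    (∀ t < shortSize n / 3, ξ (trail y s t) = ξ (ray x e t)) →
      ∃ t < shortSize n / 3, trail y s t = ray x e t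
  bent : ∀ x ∈ cube d (n ^ 2), ∀ e f : Jump d, e ≠ f →
    ∃ t < shortSize n / (2 * d), ξ (ray x e (t + 1)) ≠ ξ (ray (x + unitVec f) e t)

/-- Observations of a scenery which stem from nearest-neighbour paths, all the relevant ones of which
have been followed. -/
structure Explored (n : ℕ) (ξ : Scenery d κ) (o : Observations κ) : Prop where
  near_path : ∀ w : Str κ, Appears o (n ^ 2) w → ∃ (x : Site d) (s : ℕ → Jump d),
    (∀ t < w.length, trail x s t ∈ cube d (n ^ 2)) ∧ w = readAlong ξ (trail x s) w.length
  far_path : ∀ w : Str κ, Appears o (n ^ 4) w → ∃ (x : Site d) (s : ℕ → Jump d),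
    (∀ t < w.length, trail x s t ∈ cube d (n ^ 4)) ∧ w = readAlong ξ (trail x s) w.length
  near_cover : ∀ x ∈ cube d (5 * n), ∀ s : ℕ → Jump d,
    Appears o (n ^ 2) (readAlong ξ (trail x s) (3 * shortSize n))
  far_cover : ∀ x ∈ cube d (n ^ 2), ∀ s : ℕ → Jump d,
    Appears o (n ^ 4) (readAlong ξ (trail x s) (3 * shortSize n))

/-- The parameter is large enough for the deterministic arguments. -/
structure LargeParam (n : ℕ) : Prop where
  six_le : 6 ≤ shortSize n
  le : 3 * shortSize n ≤ n

theorem LargeParam.sq_le {n : ℕ} (h : LargeParam n) : 6 * n ≤ n ^ 2 := by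
  have := h.six_le
  have := h.le
  nlinarith

/-! ### Short words are straight -/

theorem trail_getD (x : Site d) (M : List (Jump d)) (a : Jump d) :
    trail x (fun i => M.getD i a) M.length = x + (M.map unitVec).sum := by
  induction M generalizing x with
  | nil => simp [trail]
  | cons c M ih =>
    rw [List.length_cons, add_comm, trail_add]
    have : (fun i => (c :: M).getD (1 + i) a) = fun i => M.getD i a := by
      funext i; rw [add_comm]; simp
    rw [this, ih]
    simp [trail, add_assoc]

theorem trail_getD_replicate (x : Site d) (p : ℕ) (e a : Jump d) (N : List (Jump d)) {t : ℕ}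
    (h : t ≤ p) : trail x (fun i => (List.replicate p e ++ N).getD i a) t = ray x e t := by
  rw [← trail_const]
  refine trail_congr fun i hi => ?_
  have : i < p := by omega
  rw [List.getD_append _ _ _ _ (by simpa using this), List.getD_eq_getElem _ _ (by simpa using this),
    List.getElem_replicate]

/-- Pigeonhole among the `2d` possible jumps; applied to the `L + 1` jumps around a short word. -/
theorem exists_le_count (M : List (Jump d)) {l : ℕ} (h : l < M.length) :
    ∃ e : Jump d, l / (2 * d) ≤ M.count e := by
  by_contra! hlt
  have h1 : ∑ e : Jump d, (M : Multiset (Jump d)).count e = M.length := by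
    rw [Multiset.sum_count_eq_card (fun a _ => Finset.mem_univ a)]; simp
  have h2 : ∑ e : Jump d, (M : Multiset (Jump d)).count e ≤ ∑ e : Jump d, l / (2 * d) :=
    Finset.sum_le_sum fun e _ => by
      rw [Multiset.coe_count]; convert (hlt e).le
  rw [h1] at h2
  simp only [Finset.sum_const, Finset.card_univ, Fintype.card_prod, Fintype.card_fin,
    Fintype.card_bool, smul_eq_mul] at h2
  have h3 := Nat.mul_div_le l (2 * d)
  rw [mul_comm d 2] at h2
  omega

/-- The middle part of a path observed early can be replaced by any path with the same ends. -/
theorem read_reroute {n : ℕ} {ξ : Scenery d κ} {o : Observations κ} (hE : Explored n ξ o)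
    (hn : LargeParam n) {x : Site d} {s : ℕ → Jump d} {w₁ w₂ w₃ : Str κ}
    (hx : x ∈ cube d (n ^ 2))
    (h1 : w₁.length = shortSize n) (h2 : w₂.length = shortSize n) (h3 : w₃.length = shortSize n)
    (hw : w₁ ++ w₂ ++ w₃ = readAlong ξ (trail x s) (3 * shortSize n))
    (huniq : ∀ w : Str κ, w.length = shortSize n → Appears o (n ^ 4) (w₁ ++ w ++ w₃) → w = w₂)
    (r : ℕ → Jump d)
    (hr : trail (trail x s (shortSize n - 1)) r (shortSize n + 1) = trail x s (2 * shortSize n)) :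
    readAlong ξ (fun t => trail (trail x s (shortSize n - 1)) r (t + 1)) (shortSize n) = w₂ := by
  have h6 := hn.six_le
  set L := shortSize n with hL
  -- The replaced jumps number `L + 1`: they lead from the last letter of `w₁` to the first letter
  -- of `w₃`, and only the `L` letters strictly between can change.
  set s' : ℕ → Jump d := fun i => if i < L - 1 then s i else if i < 2 * L then r (i - (L - 1)) else s i
    with hs'
  have ha : ∀ t ≤ L - 1, trail x s' t = trail x s t := fun t ht =>
    trail_congr fun i hi => by simp [hs', show i < L - 1 by omega]
  have hb : ∀ t ≤ L + 1, trail x s' (L - 1 + t) = trail (trail x s (L - 1)) r t := by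
    intro t ht
    rw [trail_add, ha _ le_rfl]
    refine trail_congr fun i hi => ?_
    simp only [hs']
    rw [if_neg (by omega), if_pos (by omega)]
    congr 1; omega
  have hc : ∀ t, trail x s' (2 * L + t) = trail x s (2 * L + t) := by
    intro t
    rw [trail_add, trail_add x s]
    have h4 := hb (L + 1) le_rfl
    rw [show L - 1 + (L + 1) = 2 * L by omega] at h4
    rw [h4, hr]
    refine trail_congr fun i hi => ?_
    simp only [hs']
    rw [if_neg (by omega), if_neg (by omega)]
  have e1 := readAlong_split hw
  have e2 := readAlong_split e1.1
  refine huniq _ (by simp) ?_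
  have := hE.far_cover x hx s'
  convert this using 1
  rw [show 3 * shortSize n = L + L + L by omega, readAlong_add, readAlong_add]
  congr 1
  · congr 1
    · rw [e2.1, h1, readAlong_eq_iff]
      intro t ht
      rw [ha t (by omega)]
    · rw [readAlong_eq_iff]
      intro t ht
      rw [← hb (t + 1) (by omega)]
      congr 2; omega
  · rw [e1.2, h3, readAlong_eq_iff]
    intro t ht
    rw [List.length_append, h1, h2, ← two_mul, hc]

/-- Rearranging the jumps under `w` preserves both end points, hence `w₁` and `w₃`; `far_cover`
shows that the rearranged path is observed too, and uniqueness forces it to read `w` again. A most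
frequent jump `e` and a different jump `f` would then give two orders that `bent` tells apart. -/
theorem straight_of_mem_shortWords {n : ℕ} {ξ : Scenery d κ} {o : Observations κ}
    (hS : Separated n ξ) (hE : Explored n ξ o) (hn : LargeParam n) {w : Str κ}
    (hw : w ∈ ShortWords n o) :
    ∃ (x : Site d) (e : Jump d), (∀ t < shortSize n, ray x e t ∈ cube d (n ^ 2)) ∧
      w = readAlong ξ (ray x e) (shortSize n) := by
  have h6 := hn.six_le
  obtain ⟨h2, w₁, w₃, h1, h3, happ, huniq⟩ := hw
  obtain ⟨x, s, hcube, hread⟩ := hE.near_path _ happ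
  have hlen : (w₁ ++ w ++ w₃).length = 3 * shortSize n := by simp [h1, h2, h3]; omega
  rw [hlen] at hcube hread
  have hx : x ∈ cube d (n ^ 2) := by
    have := hcube 0 (by omega); rwa [trail_zero] at this
  have key := read_reroute hE hn hx h1 h2 h3 hread huniq
  set L := shortSize n with hL
  set y := trail x s (L - 1) with hy
  have hyc : y ∈ cube d (n ^ 2) := hcube _ (by omega)
  set M : List (Jump d) := (List.range (L + 1)).map fun i => s (L - 1 + i) with hM
  have hMlen : M.length = L + 1 := by simp [hM]
  obtain ⟨e, he⟩ := exists_le_count M (l := L) (by omega)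
  have hend : trail x s (2 * L) = y + (M.map unitVec).sum := by
    rw [show 2 * L = L - 1 + (L + 1) by omega, trail_add, ← hy, ← trail_getD _ _ e, hMlen]
    refine trail_congr fun i hi => ?_
    simp [hM, hi]
  have key2 : ∀ M' : List (Jump d), M'.Perm M →
      readAlong ξ (fun t => trail y (fun i => M'.getD i e) (t + 1)) L = w := by
    intro M' hM'
    refine key _ ?_
    rw [hend, ← hMlen, ← hM'.length_eq, trail_getD, (hM'.map unitVec).sum_eq]
  by_cases hall : ∀ f ∈ M, f = e
  · refine ⟨y + unitVec e, e, ?_, ?_⟩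
    · intro t ht
      have : ray (y + unitVec e) e t = trail x s (L - 1 + (t + 1)) := by
        rw [trail_add, ← hy, add_comm t 1, trail_add]
        have e1 : trail y (fun i => s (L - 1 + i)) 1 = y + unitVec e := by
          rw [trail_succ, trail_zero]
          rw [hall (s (L - 1 + 0))]
          simp only [hM, List.mem_map, List.mem_range]
          exact ⟨0, by omega, rfl⟩
        rw [e1, ← trail_const]
        refine trail_congr fun i hi => (hall _ ?_).symm
        simp only [hM, List.mem_map, List.mem_range]
        exact ⟨1 + i, by omega, rfl⟩
      rw [this]
      exact hcube _ (by omega)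
    · rw [← key2 M (List.Perm.refl _), readAlong_eq_iff]
      intro t ht
      congr 1
      have hMr : M = List.replicate (L + 1) e := List.eq_replicate_iff.2 ⟨hMlen, hall⟩
      have := trail_getD_replicate y (L + 1) e e [] (t := t + 1) (by omega)
      rw [List.append_nil, ← hMr] at this
      rw [this, add_comm t 1, ray_add, ray_succ, ray_zero]
  · exfalso
    push Not at hall
    obtain ⟨f, hfM, hfe⟩ := hall
    set p := L / (2 * d) with hp
    have hsub : (f :: List.replicate p e).Subperm M := by
      rw [List.subperm_ext_iff]
      intro a ha
      by_cases hae : a = e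
      · subst hae
        rw [List.count_cons_of_ne hfe, List.count_replicate_self]
        exact he
      · have haf : a = f := by
          rcases List.mem_cons.1 ha with h | h
          · exact h
          · exact absurd (List.eq_of_mem_replicate h) hae
        subst haf
        rw [List.count_cons_self, List.count_replicate]
        have : (e == a) = false := by simpa using Ne.symm hae
        simp only [this]
        have := List.count_pos_iff.2 hfM
        simpa using this
    obtain ⟨l, hl, hlM⟩ := hsub
    obtain ⟨rest, hrest⟩ := hlM.exists_perm_append
    -- The two orders to compare are `f eᵖ …` and `eᵖ f …`. Both read `w`, although `bent` makes
    -- them differ within the first `p` comparisons.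
    have hM1 : ((f :: List.replicate p e) ++ rest).Perm M := ((hl.symm.append_right rest)).trans hrest.symm
    have hM2 : (List.replicate p e ++ (f :: rest)).Perm M := List.perm_middle.trans hM1
    obtain ⟨t, ht, hne⟩ := hS.bent y hyc e f (Ne.symm hfe)
    have htp : t < p := ht
    have htL : t < L := lt_of_lt_of_le ht (Nat.div_le_self _ _)
    have h5 := (key2 _ hM2).trans (key2 _ hM1).symm
    rw [readAlong_eq_iff] at h5
    have h6 := h5 t htL
    rw [trail_getD_replicate _ _ _ _ _ htp] at h6
    refine hne (h6.trans ?_)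
    congr 1
    rw [add_comm t 1, trail_add, ← trail_getD_replicate (y + unitVec f) p e e rest htp.le]
    have e1 : trail y (fun i => (f :: List.replicate p e ++ rest).getD i e) 1 = y + unitVec f := by
      simp [trail]
    rw [e1]
    refine trail_congr fun i _ => ?_
    rw [add_comm 1 i]; simp
end BRWScenery

namespace BRWScenery

variable {d κ : ℕ}

/-! ### Recognition of straight words -/

/-- Tails of paths and rays are again paths and rays, so the window of comparison may start
anywhere, and at different indices on the two. -/
theorem Separated.rigid_at {n : ℕ} {ξ : Scenery d κ} (hS : Separated n ξ) {x y : Site d}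
    {e : Jump d} {s : ℕ → Jump d} {a b : ℕ} (hx : ray x e b ∈ cube d (n ^ 2))
    (hy : trail y s a ∈ cube d (n ^ 4))
    (h : ∀ t < shortSize n / 3, ξ (trail y s (a + t)) = ξ (ray x e (b + t))) :
    ∃ t < shortSize n / 3, trail y s (a + t) = ray x e (b + t) := by
  simp only [trail_add, ray_add] at h ⊢
  exact hS.rigid _ hx _ _ hy _ h

theorem ray_eq_of_two {x y : Site d} {e f : Jump d} {i j : ℕ} (hij : i < j)
    (hi : ray x e i = ray y f i) (hj : ray x e j = ray y f j) : e = f ∧ x = y := by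
  have h1 := ray_sub x e i j
  rw [hi, hj, ray_sub] at h1
  have h2 : ((j : ℤ) - i) ≠ 0 := by omega
  have h3 := unitVec_injective (smul_right_injective _ h2 h1)
  subst h3
  exact ⟨rfl, by simpa [ray] using hi⟩

/-- Two equal straight words are read along the same ray. -/
theorem ray_unique {n : ℕ} {ξ : Scenery d κ} (hS : Separated n ξ) (hn : LargeParam n)
    {x y : Site d} {e f : Jump d} {l : ℕ} (hl : shortSize n - 1 ≤ l)
    (hx : ∀ t < l, ray x e t ∈ cube d (n ^ 2)) (hy : ∀ t < l, ray y f t ∈ cube d (n ^ 2))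
    (h : readAlong ξ (ray x e) l = readAlong ξ (ray y f) l) : e = f ∧ x = y := by
  have h6 := hn.six_le
  rw [readAlong_eq_iff] at h
  have hle : cube d (n ^ 2) ⊆ cube d (n ^ 4) := cube_mono (by
    rcases Nat.eq_zero_or_pos n with h | h
    · simp [h]
    · exact Nat.pow_le_pow_right h (by norm_num))
  have key : ∀ a, a + shortSize n / 3 ≤ l → ∃ t < shortSize n / 3, ray x e (a + t) = ray y f (a + t) := by
    intro a ha
    have := hS.rigid_at (x := y) (y := x) (e := f) (s := fun _ => e) (a := a) (b := a)
      (hy a (by omega)) (by rw [trail_const]; exact hle (hx a (by omega)))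
      (fun t ht => by rw [trail_const]; exact h _ (by omega))
    simpa only [trail_const] using this
  -- The windows at the two ends are disjoint, even for the `L - 1` letters of an overlap, so they
  -- provide two distinct meeting times.
  obtain ⟨i, hi, hi'⟩ := key 0 (by omega)
  obtain ⟨j, hj, hj'⟩ := key (l - shortSize n / 3) (by omega)
  exact ray_eq_of_two (by omega) hi' hj'

/-- A path which meets a ray twice, with no delay, follows the ray in between. -/
theorem trail_eq_ray_between {x y : Site d} {e : Jump d} {s : ℕ → Jump d} {i t j : ℕ}
    (hit : i ≤ t) (htj : t ≤ j) (hi : trail y s i = ray x e i) (hj : trail y s j = ray x e j) :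
    trail y s t = ray x e t := by
  have h1 := l1_trail_sub_le' y s hit
  have h2 := l1_trail_sub_le' y s htj
  rw [hi] at h1
  rw [hj] at h2
  have key : l1 (trail y s t - ray x e t) ≤ 0 := by
    refine l1_le_of_between (e := e) (α := (t : ℤ) - i) (β := (j : ℤ) - t) ?_ ?_
    · rw [add_zero, ← ray_sub x e i t]
      simpa using h1
    · rw [add_zero, ← ray_sub x e t j]
      convert h2 using 2
      abel
  exact sub_eq_zero.1 (l1_eq_zero.1 (le_antisymm key (l1_nonneg _)))

theorem readAlong_three (ξ : Scenery d κ) (R : ℕ → Site d) (l : ℕ) :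
    readAlong ξ R (3 * l) = readAlong ξ R l ++ readAlong ξ (fun t => R (l + t)) l ++
      readAlong ξ (fun t => R (2 * l + t)) l := by
  rw [show 3 * l = l + l + l by omega, readAlong_add, readAlong_add, two_mul]

/-- The words read on straight segments near the origin are short words. -/
theorem mem_shortWords_of_ray {n : ℕ} {ξ : Scenery d κ} {o : Observations κ}
    (hS : Separated n ξ) (hE : Explored n ξ o) (hn : LargeParam n) {x : Site d} {e : Jump d}
    (hx : x ∈ cube d (5 * n)) :
    readAlong ξ (fun t => ray x e (shortSize n + t)) (shortSize n) ∈ ShortWords n o := by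
  have h6 := hn.six_le
  have h3 := hn.le
  have hsq := hn.sq_le
  set L := shortSize n with hL
  have hray : ∀ t ≤ 3 * L, ray x e t ∈ cube d (n ^ 2) := fun t ht =>
    ray_mem_cube hx e (by omega)
  refine ⟨by simp [hL], readAlong ξ (ray x e) L, readAlong ξ (fun t => ray x e (2 * L + t)) L,
    by simp [hL], by simp [hL], ?_, ?_⟩
  · have := hE.near_cover x hx (fun _ => e)
    have h4 : trail x (fun _ => e) = ray x e := funext (trail_const x e)
    rw [h4, readAlong_three] at this
    exact this
  · intro w hw happ
    obtain ⟨y, s, hc, hread⟩ := hE.far_path _ happ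
    have hlen : (readAlong ξ (ray x e) L ++ w ++ readAlong ξ (fun t => ray x e (2 * L + t)) L).length
        = 3 * L := by simp; omega
    rw [hlen] at hread hc
    rw [readAlong_three] at hread
    have e1 := List.append_inj hread (by simp [hw, hL])
    have e2 := List.append_inj e1.1 (by simp)
    have a1 := e2.1
    have a2 := e2.2
    have a3 := e1.2
    rw [readAlong_eq_iff] at a1 a3
    -- Any path reading `w₁ w w₃` is on the ray once during `w₁` and once during `w₃`, with no
    -- delay; it follows the ray in between, so `w` is determined.
    obtain ⟨i, hi, hi'⟩ := hS.rigid_at (x := x) (y := y) (e := e) (s := s) (a := 0) (b := 0)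
      (hray 0 (by omega)) (hc 0 (by omega)) (fun t ht => by
        rw [zero_add]; exact (a1 t (by omega)).symm)
    obtain ⟨j, hj, hj'⟩ := hS.rigid_at (x := x) (y := y) (e := e) (s := s) (a := 2 * L) (b := 2 * L)
      (hray _ (by omega)) (hc _ (by omega)) (fun t ht => (a3 t (by omega)).symm)
    rw [a2, readAlong_eq_iff]
    intro t ht
    rw [trail_eq_ray_between (i := 0 + i) (j := 2 * L + j) (by omega) (by omega) hi' hj']

/-! ### Long words -/

theorem length_of_mem_shortWords {n : ℕ} {o : Observations κ} {w : Str κ}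
    (h : w ∈ ShortWords n o) : w.length = shortSize n := h.1

/-- Assembled words are straight. -/
theorem straight_of_assembled {n : ℕ} {ξ : Scenery d κ} {o : Observations κ}
    (hS : Separated n ξ) (hE : Explored n ξ o) (hn : LargeParam n) {w : Str κ}
    (hw : Assembled (ShortWords n o) w) :
    ∃ (x : Site d) (e : Jump d), (∀ t < w.length, ray x e t ∈ cube d (n ^ 2)) ∧
      w = readAlong ξ (ray x e) w.length := by
  have h6 := hn.six_le
  induction hw with
  | base h =>
    rw [length_of_mem_shortWords h]
    exact straight_of_mem_shortWords hS hE hn h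
  | @right v s c _ h ih =>
    obtain ⟨x, e, hc, hr⟩ := ih
    obtain ⟨y, f, hc', hr'⟩ := straight_of_mem_shortWords hS hE hn h
    have hs : s.length + 1 = shortSize n := by simpa using length_of_mem_shortWords h
    have hr1 := (readAlong_split hr).2
    have hr2 := (readAlong_split hr').1
    simp only [ray_add] at hr1
    -- The `L - 1` overlapping letters already identify the ray, so the glued letter continues it.
    obtain ⟨rfl, rfl⟩ := ray_unique hS hn (x := ray x e v.length) (y := y) (e := e) (f := f)
      (l := s.length) (by omega)
      (fun t ht => by
        rw [← ray_add]; exact hc _ (by simpa using ht))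
      (fun t ht => hc' t (by omega)) (hr1.symm.trans hr2)
    refine ⟨x, e, ?_, ?_⟩
    · intro t ht
      simp only [List.length_append, List.length_singleton] at ht hc
      rcases Nat.lt_or_ge t (v.length + s.length) with h1 | h1
      · exact hc t h1
      · have h2 : t = v.length + s.length := by omega
        rw [h2, ray_add]
        exact hc' _ (by omega)
    · rw [List.length_append (bs := [c]), List.length_singleton, readAlong_succ, ← hr]
      congr 1
      have h1 := (readAlong_split hr').2
      simp only [List.length_singleton] at h1
      rw [h1, readAlong_succ, List.length_append, ray_add x]
      simp [readAlong]
  | @left s v c _ h ih =>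
    obtain ⟨x, e, hc, hr⟩ := ih
    obtain ⟨y, f, hc', hr'⟩ := straight_of_mem_shortWords hS hE hn h
    have hs : s.length + 1 = shortSize n := by simpa using length_of_mem_shortWords h
    have hr1 := (readAlong_split hr).1
    have hr2 := (readAlong_split (v := [c]) (w := s) hr').2
    simp only [ray_add, List.length_singleton] at hr2
    obtain ⟨rfl, hxy⟩ := ray_unique hS hn (x := x) (y := ray y f 1) (e := e) (f := f)
      (l := s.length) (by omega)
      (fun t ht => hc _ (by rw [List.length_append]; omega))
      (fun t ht => by rw [← ray_add]; exact hc' _ (by omega)) (hr1.symm.trans hr2)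
    refine ⟨y, e, ?_, ?_⟩
    · intro t ht
      rcases t with _ | t
      · exact hc' 0 (by omega)
      · rw [add_comm, ray_add, ← hxy]
        exact hc t (by simpa using ht)
    · rw [List.cons_append, List.length_cons, readAlong_succ']
      simp only [add_comm _ 1, ray_add y, ← hxy]
      rw [← hr]
      congr 1
      have h1 := (readAlong_split (v := [c]) (w := s) hr').1
      simpa [readAlong] using h1

theorem straight_of_mem_longWords {n : ℕ} {ξ : Scenery d κ} {o : Observations κ}
    (hS : Separated n ξ) (hE : Explored n ξ o) (hn : LargeParam n) {w : Str κ}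
    (hw : w ∈ LongWords n o) :
    ∃ (x : Site d) (e : Jump d), (∀ t < longSize n, ray x e t ∈ cube d (n ^ 2)) ∧
      w = readAlong ξ (ray x e) (longSize n) := by
  have := straight_of_assembled hS hE hn hw.1
  rwa [hw.2] at this

/-- Gluing on the right is enough: successive windows of length `l` overlap in `l - 1` letters. -/
theorem assembled_readAlong {S : Set (Str κ)} {ξ : Scenery d κ} {R : ℕ → Site d} {l : ℕ} (hl : 1 ≤ l)
    (m : ℕ) (h : ∀ a, a ≤ m → readAlong ξ (fun t => R (a + t)) l ∈ S) :
    Assembled S (readAlong ξ R (l + m)) := by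
  induction m with
  | zero => exact .base (by simpa using h 0 le_rfl)
  | succ m ih =>
    have h1 := ih fun a ha => h a (by omega)
    have h2 := h (m + 1) le_rfl
    obtain ⟨l, rfl⟩ := Nat.exists_eq_add_of_le' hl
    rw [readAlong_succ] at h2
    rw [show l + 1 + m = m + 1 + l by omega, readAlong_add] at h1
    have h3 := Assembled.right h1 h2
    rw [← readAlong_add, show m + 1 + l = l + 1 + m by omega, ← readAlong_succ] at h3
    exact h3

/-- The words read on the lines near the origin are long words. -/
theorem mem_longWords_of_ray {n : ℕ} {ξ : Scenery d κ} {o : Observations κ}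
    (hS : Separated n ξ) (hE : Explored n ξ o) (hn : LargeParam n) {x : Site d} {e : Jump d}
    (hx : ∀ t < longSize n, ray x e t ∈ cube d (4 * n)) :
    readAlong ξ (ray x e) (longSize n) ∈ LongWords n o := by
  have h6 := hn.six_le
  have h3 := hn.le
  refine ⟨?_, by simp⟩
  have := assembled_readAlong (S := ShortWords n o) (ξ := ξ) (R := ray x e) (l := shortSize n)
    (by omega) (longSize n - shortSize n) ?_
  · rwa [Nat.add_sub_cancel' (by unfold longSize; omega)] at this
  · intro a ha
    -- A short word needs `L` letters before and after it, so the ray is started `L` sites earlier;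
    -- this is why `near_cover` reaches to `5n` and not just to `4n`.
    have hmem : ray x e a + (-(shortSize n : ℤ)) • unitVec e ∈ cube d (5 * n) := by
      refine mem_cube_of_l1 (hx a (by unfold longSize at *; omega)) ?_
      rw [add_sub_cancel_left, l1_smul, l1_unitVec, abs_neg]
      simp; omega
    convert mem_shortWords_of_ray hS hE hn (e := e) hmem using 2
    funext t
    simp only [ray]
    push_cast
    module

/-! ### Seeds and neighbours -/

/-- A seed word of level `m` was seen by time `m ^ 2`, hence near the origin. It has at least `L -
1` letters, so recognition at level `n` identifies its ray with the one under the longer word, and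
the centres coincide. -/
theorem centre_mem_of_isSeeded {n : ℕ} {ξ : Scenery d κ} {o : Observations κ}
    (hS : Separated n ξ) (hn : LargeParam n)
    (hS' : Separated (seedParam n) ξ) (hE' : Explored (seedParam n) ξ o)
    (hn' : LargeParam (seedParam n)) (hln : shortSize n ≤ seedParam n) (hmn : seedParam n ≤ n)
    {x : Site d} {e : Jump d}
    (hx : ∀ t < longSize n, ray x e t ∈ cube d (n ^ 2))
    (hw : IsSeeded n o (readAlong ξ (ray x e) (longSize n))) :
    ray x e (4 * n) ∈ cube d (seedParam n ^ 2) := by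
  obtain ⟨-, w₀, hw₀, p, hp, hpn⟩ := hw
  obtain ⟨y, f, hy, rfl⟩ := straight_of_mem_longWords hS' hE' hn' hw₀
  obtain ⟨h1, h2⟩ := occursAt_readAlong hp
  rw [length_readAlong] at h1 h2
  simp only [ray_add] at h1
  obtain ⟨rfl, rfl⟩ := ray_unique hS hn (by unfold longSize; omega)
    (fun t ht => cube_mono (Nat.pow_le_pow_left hmn 2) (hy t ht))
    (fun t ht => by rw [← ray_add]; exact hx _ (by omega)) h1
  rw [← hpn, ray_add]
  exact hy _ (by unfold longSize; omega)

/-- A path reading `va wb vc` leaves and regains the first ray with a total delay of two, so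
meanwhile it stays within distance one of it. While reading `wb` it also meets the second ray, near
the beginning and near the end. Two rays in different directions could not remain this close for so
long. -/
theorem parallel_of_neighbours {n : ℕ} {ξ : Scenery d κ} {o : Observations κ}
    (hS : Separated n ξ) (hE : Explored n ξ o) (hn : LargeParam n) {x y : Site d} {e f : Jump d}
    (hx : ∀ t < longSize n, ray x e t ∈ cube d (n ^ 2))
    (hy : ∀ t < longSize n, ray y f t ∈ cube d (n ^ 2))
    (h : Neighbours n o (readAlong ξ (ray x e) (longSize n)) (readAlong ξ (ray y f) (longSize n))) :
    e = f ∧ l1 (y - x) ≤ 1 := by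
  have h6 := hn.six_le
  obtain ⟨va, vb, vc, wb, ha, hb, hc, hwb, happ, p, q, hp, hq, hpq⟩ := h
  obtain ⟨z, s, hz, hr⟩ := hE.far_path _ happ
  have hlen : (va ++ wb ++ vc).length = 3 * shortSize n := by simp; omega
  rw [hlen] at hz hr
  obtain ⟨hp1, hp2⟩ := occursAt_readAlong hp
  obtain ⟨hq1, hq2⟩ := occursAt_readAlong hq
  have hp3 := readAlong_split hp1
  have hp4 := readAlong_split hp3.1
  have hr3 := readAlong_split hr
  have hr4 := readAlong_split hr3.1
  simp only [List.length_append, ha, hc, hwb] at hp1 hp2 hp3 hp4 hq1 hq2 hr3 hr4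
  have Ea := hp4.1.symm.trans hr4.1
  have Eb := hq1.symm.trans hr4.2
  have Ec := hp3.2.symm.trans hr3.2
  rw [readAlong_eq_iff] at Ea Eb Ec
  set L := shortSize n with hL
  obtain ⟨i, hi, hi'⟩ := hS.rigid_at (x := x) (y := z) (e := e) (s := s) (a := 0) (b := p)
    (hx _ (by omega)) (hz _ (by omega)) (fun t ht => by rw [zero_add]; exact (Ea t (by omega)).symm)
  -- The index on the ray is `2 * L - 2` because `vb` has two letters fewer than `wb`.
  obtain ⟨j, hj, hj'⟩ := hS.rigid_at (x := x) (y := z) (e := e) (s := s) (a := 2 * L)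
    (b := p + (2 * L - 2))
    (hx _ (by omega)) (hz _ (by omega)) (fun t ht => by
      have := (Ec t (by omega)).symm
      rw [← two_mul] at this
      rw [this]; congr 2; omega)
  -- The delay of two is split evenly: relative to the index `p + t - 1`, the path has one spare
  -- step on either side.
  have mid : ∀ t, L ≤ t → t < 2 * L → l1 (trail z s t - ray x e (p + t - 1)) ≤ 1 := by
    intro t ht1 ht2
    refine l1_le_of_between (e := e) (α := (t : ℤ) - i - 1) (β := 2 * L + j - t - 1) ?_ ?_
    · have h1 := l1_trail_sub_le' z s (show 0 + i ≤ t by omega)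
      rw [hi'] at h1
      have h2 := ray_sub x e (p + i) (p + t - 1)
      rw [show (((p + t - 1 : ℕ) : ℤ) - ((p + i : ℕ) : ℤ)) = (t : ℤ) - i - 1 by omega] at h2
      rw [← h2]
      calc _ = l1 (trail z s t - ray x e (p + i)) := by congr 1; abel
        _ ≤ _ := h1
        _ = _ := by push_cast; ring
    · have h1 := l1_trail_sub_le' z s (show t ≤ 2 * L + j by omega)
      rw [hj'] at h1
      have h2 := ray_sub x e (p + t - 1) (p + (2 * L - 2) + j)
      rw [show (((p + (2 * L - 2) + j : ℕ) : ℤ) - ((p + t - 1 : ℕ) : ℤ)) = 2 * L + j - t - 1 by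
        omega] at h2
      rw [← h2]
      calc _ = l1 (ray x e (p + (2 * L - 2) + j) - trail z s t) := by congr 1; abel
        _ ≤ _ := h1
        _ = _ := by push_cast; ring
  have meet : ∀ a, a + L / 3 ≤ L → ∃ t < L / 3,
      l1 (ray y f (q + (a + t)) - ray x e (q + (a + t))) ≤ 1 := by
    intro a ha
    obtain ⟨t, ht, ht'⟩ := hS.rigid_at (x := y) (y := z) (e := f) (s := s) (a := L + a) (b := q + a)
      (hy _ (by omega)) (hz _ (by omega)) (fun t ht => by
        have := (Eb (a + t) (by omega)).symm
        rw [← add_assoc, ← add_assoc] at this; exact this)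
    refine ⟨t, ht, ?_⟩
    have := mid (L + a + t) (by omega) (by omega)
    rw [ht', show p + (L + a + t) - 1 = q + (a + t) by omega] at this
    rw [← add_assoc] at this ⊢
    exact this
  obtain ⟨a, ha1, ha2⟩ := meet 0 (by omega)
  obtain ⟨c, hc1, hc2⟩ := meet (L - L / 3) (by omega)
  -- Rays in different directions separate at speed two, and the meeting times are at least two
  -- apart, whereas the offsets at these times differ by at most two.
  have hef : e = f := by
    by_contra hne
    have h1 := l1_sub_le (ray y f (q + (L - L / 3 + c)) - ray x e (q + (L - L / 3 + c)))
      (ray y f (q + (0 + a)) - ray x e (q + (0 + a)))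
    have h2 : ray y f (q + (L - L / 3 + c)) - ray x e (q + (L - L / 3 + c)) -
        (ray y f (q + (0 + a)) - ray x e (q + (0 + a))) =
        ((L - L / 3 + c : ℕ) - a : ℤ) • (unitVec f - unitVec e) := by
      simp only [ray]; push_cast; module
    rw [h2, l1_smul, l1_unitVec_sub (Ne.symm hne)] at h1
    have h3 := le_abs_self ((L - L / 3 + c : ℕ) - a : ℤ)
    omega
  subst hef
  refine ⟨rfl, ?_⟩
  convert ha2 using 2
  simp only [ray]; abel

end BRWScenery

namespace BRWScenery

variable {d κ : ℕ}

/-! ### Locally injective nearest-neighbour maps of a box are isometries -/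

theorem apply_update_eq_of_step {α : Type*} {lo hi : Site d} (F : Site d → α) {i : Fin d}
    (h : ∀ z ∈ Set.Icc lo hi, z + Pi.single i 1 ∈ Set.Icc lo hi → F (z + Pi.single i 1) = F z)
    {z : Site d} (hz : z ∈ Set.Icc lo hi) {v : ℤ} (h1 : lo i ≤ v) (h2 : v ≤ hi i) :
    F (Function.update z i v) = F z := by
  have hmem : ∀ v, lo i ≤ v → v ≤ hi i → Function.update z i v ∈ Set.Icc lo hi := by
    intro v h1 h2
    constructor <;> intro k <;> by_cases hk : k = i
    · subst hk; simpa using h1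
    · simpa [hk] using hz.1 k
    · subst hk; simpa using h2
    · simpa [hk] using hz.2 k
  have key : ∀ m : ℕ, lo i + m ≤ hi i →
      F (Function.update z i (lo i + m)) = F (Function.update z i (lo i)) := by
    intro m
    induction m with
    | zero => simp
    | succ m ih =>
      intro hm
      push_cast at hm
      have e1 : Function.update z i (lo i + (m + 1 : ℕ)) =
          Function.update z i (lo i + m) + Pi.single i 1 := by
        funext k
        by_cases hk : k = i
        · subst hk; simp; ring
        · simp [hk]
      rw [e1, h _ (hmem _ (by omega) (by omega)) (by rw [← e1]; exact hmem _ (by push_cast; omega) (by push_cast; omega)),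
        ih (by omega)]
  have key2 : ∀ v, lo i ≤ v → v ≤ hi i →
      F (Function.update z i v) = F (Function.update z i (lo i)) := by
    intro v h1 h2
    have := key (v - lo i).toNat (by omega)
    rwa [show lo i + ((v - lo i).toNat : ℤ) = v by omega] at this
  have h3 := key2 (z i) (hz.1 i) (hz.2 i)
  rw [Function.update_eq_self] at h3
  rw [key2 v h1 h2, h3]

/-- The coordinates in `T` are changed one at a time into those of `z'`; since the box is a product,
this never leaves it. -/
theorem eq_on_box_of_step {α : Type*} {lo hi : Site d} (F : Site d → α) (T : Finset (Fin d))
    (h : ∀ i ∈ T, ∀ z ∈ Set.Icc lo hi, z + Pi.single i 1 ∈ Set.Icc lo hi →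
      F (z + Pi.single i 1) = F z)
    {z z' : Site d} (hz : z ∈ Set.Icc lo hi) (hz' : z' ∈ Set.Icc lo hi)
    (heq : ∀ i ∉ T, z i = z' i) : F z = F z' := by
  induction T using Finset.induction_on generalizing z with
  | empty => rw [show z = z' from funext fun i => heq i (by simp)]
  | insert i T hi ih =>
    rw [← apply_update_eq_of_step F (h i (by simp)) hz (hz'.1 i) (hz'.2 i)]
    refine ih (fun k hk => h k (by simp [hk])) ?_ ?_
    · constructor <;> intro k <;> by_cases hk : k = i
      · subst hk; simpa using hz'.1 k
      · simpa [hk] using hz.1 k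
      · subst hk; simpa using hz'.2 k
      · simpa [hk] using hz.2 k
    · intro k hk
      by_cases hki : k = i
      · subst hki; simp
      · simpa [hki] using heq k (by simp [hki, hk])

theorem exists_unitVec {u : Site d} (h : l1 u ≤ 1) (h0 : u ≠ 0) : ∃ j : Jump d, u = unitVec j := by
  obtain ⟨i, hi⟩ := Function.ne_iff.1 h0
  have h1 : |u i| + ∑ k ∈ Finset.univ.erase i, |u k| = l1 u :=
    Finset.add_sum_erase _ (fun k => |u k|) (Finset.mem_univ i)
  have h2 : 1 ≤ |u i| := Int.one_le_abs (by simpa using hi)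
  have h3 : 0 ≤ ∑ k ∈ Finset.univ.erase i, |u k| := Finset.sum_nonneg fun _ _ => abs_nonneg _
  have h4 : ∑ k ∈ Finset.univ.erase i, |u k| = 0 := by omega
  have h5 : ∀ k, k ≠ i → u k = 0 := fun k hk => by
    have := (Finset.sum_eq_zero_iff_of_nonneg fun k _ => abs_nonneg (u k)).1 h4 k
      (Finset.mem_erase.2 ⟨hk, Finset.mem_univ k⟩)
    simpa using this
  have h6 : u i = 1 ∨ u i = -1 := by
    have : |u i| = 1 := by omega
    exact (abs_eq (by norm_num)).1 this
  refine ⟨(i, decide (u i = 1)), ?_⟩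
  funext k
  by_cases hk : k = i
  · subst hk
    rcases h6 with h | h <;> simp [unitVec, h]
  · rw [h5 k hk, unitVec_ne _ hk]

theorem sgn_mul_unitVec_nonpos {e j : Jump d} (h : j ≠ e) : sgn e * unitVec j e.1 ≤ 0 := by
  by_cases h1 : e.1 = j.1
  · rw [h1, unitVec_same]
    have h3 : sgn j ≠ sgn e := fun h3 => h (sgn_inj h1.symm h3)
    unfold sgn at *
    split at h3 <;> split at h3 <;> simp_all
  · rw [unitVec_ne j h1]; simp

theorem unitVec_eq_neg {e j : Jump d} (h1 : j.1 = e.1) (h : j ≠ e) : unitVec j = -unitVec e := by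
  rw [unitVec_eq, unitVec_eq, h1, ← Pi.single_neg]
  congr 1
  have h3 : sgn j ≠ sgn e := fun h3 => h (sgn_inj h1 h3)
  unfold sgn at *
  split at h3 <;> split at h3 <;> simp_all

/-- The four sides of a non-degenerate lattice quadrilateral are pairwise parallel. -/
theorem parallelogram {a b c a' : Jump d}
    (h : (unitVec a : Site d) + unitVec c = unitVec b + unitVec a') (hab : a ≠ b)
    (h0 : (unitVec a : Site d) + unitVec c ≠ 0) : a' = a ∧ c = b := by
  -- Along the axis of `a`, the right side contributes nothing in the direction of `a` unless `a'`
  -- does. Then `c` has to cancel `a`, which is the degenerate case.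
  have haa : a' = a := by
    by_contra hne
    have h1 := congrArg (sgn a * ·) (congrFun h a.1)
    simp only [Pi.add_apply, unitVec_same, mul_add, sgn_sq] at h1
    have h2 := sgn_mul_unitVec_nonpos (Ne.symm hab)
    have h3 := sgn_mul_unitVec_nonpos hne
    have h4 : c.1 = a.1 := by
      by_contra h4
      rw [unitVec_ne c (Ne.symm h4)] at h1
      omega
    have h5 : c ≠ a := by
      rintro rfl
      rw [unitVec_same, sgn_sq] at h1
      omega
    rw [unitVec_eq_neg h4 h5] at h0
    simp at h0
  subst haa
  refine ⟨rfl, unitVec_injective ?_⟩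
  rw [add_comm] at h
  exact add_right_cancel h

theorem sum_smul_unitVec_apply {g : Fin d → Jump d} (hg : Function.Injective fun i => (g i).1)
    (a : Fin d → ℤ) (i : Fin d) :
    (∑ k, a k • (unitVec (g k) : Site d)) (g i).1 = a i * sgn (g i) := by
  rw [Finset.sum_apply, Finset.sum_eq_single i]
  · simp [unitVec_same]
  · intro k _ hk
    rw [Pi.smul_apply, unitVec_ne _ fun h => hk (hg h).symm, smul_zero]
  · simp

theorem mem_cube_iff_Icc {M : ℕ} {z : Site d} :
    z ∈ cube d M ↔ z ∈ Set.Icc (fun _ => -(M : ℤ)) (fun _ => (M : ℤ)) := by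
  simp only [cube, Set.mem_ofPred_eq, abs_le, Set.mem_Icc, Pi.le_def, ← forall_and]

theorem l1_single (i : Fin d) (a : ℤ) : l1 (Pi.single i a : Site d) = |a| := by
  unfold l1
  rw [Finset.sum_eq_single i]
  · simp
  · intro k _ hk; simp [hk]
  · simp

/-- A nearest-neighbour map of a box which is injective at distance two is a signed permutation of the
axes, up to a translation. -/
theorem exists_signed_permutation {M : ℕ} (hM : 1 ≤ M) (Φ : Site d → Site d)
    (hstep : ∀ z ∈ cube d M, ∀ i, z + Pi.single i 1 ∈ cube d M →
      l1 (Φ (z + Pi.single i 1) - Φ z) ≤ 1)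
    (hinj : ∀ z ∈ cube d M, ∀ z' ∈ cube d M, z ≠ z' → l1 (z' - z) ≤ 2 → Φ z ≠ Φ z') :
    ∃ g : Fin d → Jump d, Function.Injective (fun i => (g i).1) ∧
      ∀ z ∈ cube d M, Φ z = Φ 0 + ∑ i, z i • unitVec (g i) := by
  have hMZ : (1 : ℤ) ≤ M := by exact_mod_cast hM
  have hex : ∀ (i : Fin d) (z : Site d), ∃ j : Jump d, z ∈ cube d M → z + Pi.single i 1 ∈ cube d M →
      Φ (z + Pi.single i 1) = Φ z + unitVec j := by
    intro i z
    by_cases h : z ∈ cube d M ∧ z + Pi.single i 1 ∈ cube d M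
    · have hne : Φ (z + Pi.single i 1) - Φ z ≠ 0 := by
        rw [sub_ne_zero]
        refine (hinj _ h.1 _ h.2 ?_ ?_).symm
        · intro h1
          have := congrFun h1 i
          simp at this
        · rw [add_sub_cancel_left, l1_single]; norm_num
      obtain ⟨j, hj⟩ := exists_unitVec (hstep z h.1 i h.2) hne
      exact ⟨j, fun _ _ => by rw [← hj]; abel⟩
    · exact ⟨(i, true), fun h1 h2 => absurd ⟨h1, h2⟩ h⟩
  choose G hG using hex
  have mid : ∀ {z : Site d} {i k : Fin d}, i ≠ k → z ∈ cube d M →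
      z + Pi.single i 1 + Pi.single k 1 ∈ cube d M →
      z + Pi.single i 1 ∈ cube d M ∧ z + Pi.single k 1 ∈ cube d M := by
    intro z i k hik hz hz'
    constructor <;> intro r <;> have h1 := hz r <;> have h2 := hz' r <;>
      by_cases hri : r = i <;> by_cases hrk : r = k <;>
      simp_all
  -- Injectivity at distance two makes the image of a unit square non-degenerate, so its opposite
  -- sides carry equal jumps and its adjacent sides have different axes.
  have square : ∀ {z : Site d} {i k : Fin d}, i ≠ k → z ∈ cube d M →
      z + Pi.single i 1 + Pi.single k 1 ∈ cube d M →
      G i (z + Pi.single k 1) = G i z ∧ G k (z + Pi.single i 1) = G k z ∧ (G i z).1 ≠ (G k z).1 := by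
    intro z i k hik hz hz'
    obtain ⟨h1, h2⟩ := mid hik hz hz'
    have hz'' : z + Pi.single k 1 + Pi.single i 1 ∈ cube d M := by
      rwa [add_right_comm] at hz'
    have e1 := hG i z hz h1
    have e2 := hG k z hz h2
    have e3 := hG k _ h1 hz'
    have e4 := hG i _ h2 hz''
    have hab : G i z ≠ G k z := by
      intro h
      refine hinj _ h1 _ h2 ?_ ?_ (by rw [e1, e2, h])
      · intro h
        have := congrFun h i
        simp [hik] at this
      · rw [add_sub_add_left_eq_sub]
        refine (l1_sub_le _ _).trans ?_
        rw [l1_single, l1_single]; norm_num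
    have hdiag : Φ (z + Pi.single i 1 + Pi.single k 1) ≠ Φ z := by
      refine (hinj _ hz _ hz' ?_ ?_).symm
      · intro h
        have := congrFun h i
        simp [hik] at this
      · rw [add_assoc, add_sub_cancel_left]
        refine (l1_add_le _ _).trans ?_
        rw [l1_single, l1_single]; norm_num
    have h0 : (unitVec (G i z) : Site d) + unitVec (G k (z + Pi.single i 1)) ≠ 0 := by
      intro h
      apply hdiag
      rw [e3, e1, add_assoc, h, add_zero]
    obtain ⟨r1, r2⟩ := parallelogram (a' := G i (z + Pi.single k 1)) (b := G k z) (by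
      have := e3
      rw [add_right_comm, e4, e1, e2, add_assoc, add_assoc] at this
      exact (add_left_cancel this).symm) hab h0
    refine ⟨r1, r2, fun hax => ?_⟩
    rw [r2, unitVec_eq_neg hax.symm (Ne.symm hab)] at h0
    simp at h0
  have perp : ∀ (i : Fin d) (z : Site d), z ∈ cube d M → z + Pi.single i 1 ∈ cube d M →
      G i z = G i (Pi.single i (z i)) := by
    intro i z hz hz'
    -- The sites from which a step in direction `i` stays in the cube form a box too, with its upper
    -- bound in coordinate `i` lowered by one.
    have hbox : ∀ y : Site d, y ∈ Set.Icc (fun _ => -(M : ℤ)) (Function.update (fun _ => (M : ℤ)) i (M - 1))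
        ↔ y ∈ cube d M ∧ y + Pi.single i 1 ∈ cube d M := by
      intro y
      simp only [Set.mem_Icc, Pi.le_def, cube, Set.mem_ofPred_eq, abs_le, ← forall_and]
      refine forall_congr' fun r => ?_
      by_cases hr : r = i
      · subst hr; simp; omega
      · simp [hr]
    refine eq_on_box_of_step (fun z => G i z) (Finset.univ.erase i) ?_ ((hbox z).2 ⟨hz, hz'⟩)
      ((hbox _).2 ⟨?_, ?_⟩) ?_
    · intro k hk y hy hy'
      have hki : k ≠ i := Finset.ne_of_mem_erase hk
      refine (square hki.symm ((hbox y).1 hy).1 ?_).1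
      have := ((hbox _).1 hy').2
      rwa [add_right_comm] at this
    · intro r
      by_cases hr : r = i
      · subst hr; simpa using hz r
      · simp [hr]
    · intro r
      by_cases hr : r = i
      · subst hr; simpa using hz' r
      · simp [hr]
    · intro r hr
      have : r = i := by simpa using hr
      subst this; simp
  -- Squares do not compare consecutive jumps on one line. Here the other directions already occupy
  -- `d - 1` axes at both sites, which leaves only one axis for direction `i`; turning back on it
  -- would violate injectivity at distance two.
  have line : ∀ (i : Fin d) (s : ℤ), -(M : ℤ) ≤ s → s + 2 ≤ M →
      G i (Pi.single i (s + 1)) = G i (Pi.single i s) := by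
    intro i s h1 h2
    have e1 : (Pi.single i (s + 1) : Site d) = Pi.single i s + Pi.single i 1 := by
      rw [← Pi.single_add]
    set z : Site d := Pi.single i s with hz
    have zi : z i = s := by simp [hz]
    have zr : ∀ r, r ≠ i → z r = 0 := fun r hr => by simp [hz, hr]
    rw [e1]
    have hz0 : z ∈ cube d M := by
      intro r; by_cases hr : r = i
      · subst hr; rw [zi, abs_le]; omega
      · rw [zr r hr]; simp
    have hz1 : z + Pi.single i 1 ∈ cube d M := by
      intro r; by_cases hr : r = i
      · subst hr; simp only [Pi.add_apply, zi, Pi.single_eq_same]; rw [abs_le]; omega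
      · simp [zr r hr, hr]
    have hz2 : z + Pi.single i 1 + Pi.single i 1 ∈ cube d M := by
      intro r; by_cases hr : r = i
      · subst hr; simp only [Pi.add_apply, zi, Pi.single_eq_same]; rw [abs_le]; omega
      · simp [zr r hr, hr]
    have hcorner : ∀ k k', k ≠ k' → z + Pi.single k 1 + Pi.single k' 1 ∈ cube d M := by
      intro k k' hkk r
      simp only [Pi.add_apply, Pi.single_apply]
      by_cases hr : r = i
      · subst hr; rw [zi, abs_le]; split <;> split <;> omega
      · rw [zr r hr, abs_le]; split <;> split <;> omega
    have hcorner2 : ∀ k, k ≠ i → z + Pi.single i 1 + Pi.single i 1 + Pi.single k 1 ∈ cube d M := by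
      intro k hk r
      simp only [Pi.add_apply, Pi.single_apply]
      by_cases hr : r = i
      · subst hr; rw [zi, abs_le]; simp only [if_true]; rw [if_neg (Ne.symm hk)]; omega
      · rw [zr r hr, abs_le]; simp only [hr, if_false]; split <;> omega
    have hAinj : Function.Injective fun k => (G k z).1 := by
      intro k k' hkk
      by_contra hne
      exact (square hne hz0 (hcorner k k' hne)).2.2 hkk
    obtain ⟨k, hk⟩ := Finite.surjective_of_injective hAinj (G i (z + Pi.single i 1)).1
    have hki : k = i := by
      by_contra hne
      have s1 := square (Ne.symm hne) hz0 (hcorner i k (Ne.symm hne))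
      have s2 := square (Ne.symm hne) hz1 (hcorner2 k hne)
      apply s2.2.2
      rw [← hk, s1.2.1]
    subst hki
    by_contra hne
    have h3 := unitVec_eq_neg hk.symm hne
    refine hinj _ hz0 _ hz2 ?_ ?_ ?_
    · intro h
      have := congrFun h k
      simp only [Pi.add_apply, Pi.single_eq_same] at this
      omega
    · rw [add_assoc, add_sub_cancel_left]
      refine (l1_add_le _ _).trans ?_
      rw [l1_single]; norm_num
    · rw [hG k _ hz1 hz2, hG k _ hz0 hz1, h3]; abel
  have const : ∀ (i : Fin d) (z : Site d), z ∈ cube d M → z + Pi.single i 1 ∈ cube d M →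
      G i z = G i 0 := by
    intro i z hz hz'
    have h1 := hz i
    have h2 := hz' i
    simp only [Pi.add_apply, Pi.single_eq_same] at h2
    rw [abs_le] at h1 h2
    have up : ∀ m : ℕ, -(M : ℤ) + m + 1 ≤ M →
        G i (Pi.single i (-(M : ℤ) + m)) = G i (Pi.single i (-(M : ℤ))) := by
      intro m
      induction m with
      | zero => simp
      | succ m ih =>
        intro hm
        push_cast at hm ⊢
        rw [← add_assoc, line i _ (by omega) (by omega), ih (by omega)]
    have a1 := up (z i + M).toNat (by omega)
    have a2 := up M (by omega)
    rw [show -(M : ℤ) + ((z i + M).toNat : ℤ) = z i by omega] at a1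
    rw [neg_add_cancel, Pi.single_zero] at a2
    rw [perp i z hz hz', a1, a2]
  refine ⟨fun i => G i 0, ?_, ?_⟩
  · intro i k hik
    by_contra hne
    refine (square hne (z := 0) (by intro r; simp) ?_).2.2 hik
    intro r
    simp only [Pi.add_apply, Pi.single_apply, Pi.zero_apply]
    rw [abs_le]; split <;> split <;> omega
  · intro z hz
    have := eq_on_box_of_step (lo := fun _ => -(M : ℤ)) (hi := fun _ => (M : ℤ))
      (fun z => Φ z - ∑ i, z i • unitVec (G i 0)) Finset.univ ?_ (mem_cube_iff_Icc.1 hz)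
      (mem_cube_iff_Icc.1 (show (0 : Site d) ∈ cube d M by intro r; simp)) (by simp)
    · simp only [Pi.zero_apply, zero_smul, Finset.sum_const_zero, sub_zero] at this
      rw [← this]; abel
    · intro i _ y hy hy'
      rw [hG i y (mem_cube_iff_Icc.2 hy) (mem_cube_iff_Icc.2 hy'),
        const i y (mem_cube_iff_Icc.2 hy) (mem_cube_iff_Icc.2 hy')]
      simp only [Pi.add_apply, add_smul, Finset.sum_add_distrib]
      have : ∑ k, (Pi.single i 1 : Site d) k • (unitVec (G k 0) : Site d) = unitVec (G i 0) := by
        rw [Finset.sum_eq_single i]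
        · simp
        · intro k _ hk; simp [hk]
        · simp
      rw [this]; abel

end BRWScenery

namespace BRWScenery

variable {d κ : ℕ}

/-! ### The outcomes of the algorithm -/

theorem mem_box_iff {n : ℕ} {x z : Site d} :
    z ∈ box x (4 * (n : ℝ)) ↔ ∀ i, |z i - x i| ≤ ((4 * n : ℕ) : ℤ) := by
  refine forall_congr' fun i => ?_
  rw [← Int.cast_abs]
  exact_mod_cast Iff.rfl

theorem mem_box_zero_iff {n : ℕ} {z : Site d} :
    z ∈ box (0 : Site d) (4 * (n : ℝ)) ↔ z ∈ cube d (4 * n) := by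
  simp [mem_box_iff, cube]

theorem lineSite_val {n : ℕ} (j : Fin d) (z : OutBox d n) (k : Fin (longSize n)) :
    (lineSite j z k : Site d) = ray (Function.update z.1 j (-(4 * (n : ℤ)))) (j, true) k := by
  funext i
  by_cases hi : i = j
  · subst hi
    simp [lineSite, ray, unitVec]; ring
  · simp [lineSite, ray, unitVec, hi]

theorem lineWord_eq_iff {n : ℕ} {c : OutBox d n → Fin κ} {j : Fin d} {z : OutBox d n}
    {ξ : Scenery d κ} {R : ℕ → Site d} :
    lineWord c j z = readAlong ξ R (longSize n) ↔
      ∀ k : Fin (longSize n), c (lineSite j z k) = ξ (R k) := by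
  unfold lineWord readAlong
  constructor
  · intro h k
    have := congrArg (fun l => l[(k : ℕ)]?) h
    simpa using this
  · intro h
    refine List.ext_getElem (by simp) fun i h1 h2 => ?_
    simp only [List.length_ofFn] at h1
    simpa using h ⟨i, h1⟩

theorem lineSite_congr {n : ℕ} {j : Fin d} {z z' : OutBox d n} (h : ∀ i, i ≠ j → z.1 i = z'.1 i)
    (k : Fin (longSize n)) : lineSite j z k = lineSite j z' k := by
  apply Subtype.ext
  funext i
  by_cases hi : i = j
  · subst hi; simp [lineSite]
  · simp [lineSite, hi, h i hi]

theorem lineWord_congr {n : ℕ} {c : OutBox d n → Fin κ} {j : Fin d} {z z' : OutBox d n}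
    (h : ∀ i, i ≠ j → z.1 i = z'.1 i) : lineWord c j z = lineWord c j z' := by
  unfold lineWord
  simp only [lineSite_congr h]

theorem lineSite_self {n : ℕ} (j : Fin d) (z : OutBox d n) (k : Fin (longSize n))
    (hk : (k : ℤ) = z.1 j + 4 * n) : lineSite j z k = z := by
  apply Subtype.ext
  funext i
  by_cases hi : i = j
  · subst hi; simp [lineSite, hk]
  · simp [lineSite, hi]

theorem sqDist_add_single (z : Site d) (i : Fin d) : sqDist z (z + Pi.single i 1) = 1 := by
  unfold sqDist
  rw [Finset.sum_eq_single i]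
  · simp
  · intro k _ hk; simp [hk]
  · simp

/-- A map which acts as a signed permutation of the axes and a translation yields equivalent
colourings. -/
theorem equivalent_of_signed_permutation {n : ℕ} {ξ : Scenery d κ} {c : OutBox d n → Fin κ}
    {Φ : Site d → Site d} {g : Fin d → Jump d} (hg : Function.Injective fun i => (g i).1)
    (hΦ : ∀ z ∈ cube d (4 * n), Φ z = Φ 0 + ∑ i, z i • unitVec (g i))
    (hc : ∀ z : OutBox d n, ξ (Φ z) = c z) :
    Equivalent c (fun z : box (Φ 0) (4 * (n : ℝ)) => ξ z) := by
  have hbij : Function.Bijective fun i => (g i).1 := Finite.injective_iff_bijective.1 hg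
  have hcoord : ∀ z : OutBox d n, ∀ i, Φ z (g i).1 = Φ 0 (g i).1 + z.1 i * sgn (g i) := by
    intro z i
    rw [hΦ z (mem_box_zero_iff.1 z.2), Pi.add_apply, sum_smul_unitVec_apply hg]
  have habs : ∀ (i : Fin d) (a : ℤ), |a * sgn (g i)| = |a| := fun i a => by
    rw [abs_mul, abs_sgn, mul_one]
  have hmem : ∀ z : OutBox d n, Φ z ∈ box (Φ 0) (4 * (n : ℝ)) := by
    intro z
    rw [mem_box_iff]
    intro r
    obtain ⟨i, rfl⟩ := hbij.2 r
    simp only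
    rw [hcoord, add_sub_cancel_left, habs]
    exact mem_box_zero_iff.1 z.2 i
  have hφ : Function.Bijective fun z : OutBox d n => (⟨Φ z, hmem z⟩ : box (Φ 0) (4 * (n : ℝ))) := by
    constructor
    · intro z w hzw
      apply Subtype.ext
      funext i
      have h1 := congrFun (congrArg Subtype.val hzw) (g i).1
      simp only at h1
      rw [hcoord, hcoord] at h1
      have h2 : sgn (g i) ≠ 0 := by
        have := abs_sgn (g i)
        intro h; simp [h] at this
      exact mul_right_cancel₀ h2 (add_left_cancel h1)
    · intro w
      have hz : (fun i => sgn (g i) * (w.1 (g i).1 - Φ 0 (g i).1)) ∈ box (0 : Site d) (4 * (n : ℝ)) := by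
        rw [mem_box_zero_iff]
        intro i
        simp only
        rw [mul_comm, habs]
        exact mem_box_iff.1 w.2 _
      refine ⟨⟨_, hz⟩, ?_⟩
      apply Subtype.ext
      funext r
      obtain ⟨i, rfl⟩ := hbij.2 r
      have := hcoord ⟨_, hz⟩ i
      simp only at this ⊢
      rw [this, mul_right_comm, sgn_sq]; ring
  refine ⟨Equiv.ofBijective _ hφ, ?_, ?_⟩
  · intro z w
    simp only [Equiv.ofBijective_apply, sqDist]
    rw [← (Equiv.ofBijective _ hbij).sum_comp]
    refine Finset.sum_congr rfl fun i _ => ?_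
    simp only [Equiv.ofBijective_apply]
    rw [hcoord, hcoord]
    linear_combination (z.1 i - w.1 i) ^ 2 * sgn_sq (g i)
  · intro z
    exact hc z

/-- Every outcome is equivalent to the scenery on a box whose centre is near the origin. -/
theorem equivalent_of_isOutcome {n : ℕ} {ξ : Scenery d κ} {o : Observations κ}
    (hS : Separated n ξ) (hE : Explored n ξ o) (hn : LargeParam n)
    (hS' : Separated (seedParam n) ξ) (hE' : Explored (seedParam n) ξ o)
    (hn' : LargeParam (seedParam n)) (hln : shortSize n ≤ seedParam n) (hmn : seedParam n ≤ n)
    {c : OutBox d n → Fin κ} (hc : IsOutcome n o c) :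
    ∃ x ∈ cube d (seedParam n ^ 2), Equivalent c (fun z : box x (4 * (n : ℝ)) => ξ z) := by
  have h6 := hn.six_le
  have h3 := hn.le
  obtain ⟨j, hlong, hseed, hnb, hdis⟩ := hc
  have hbox : ∀ z : Site d, z ∈ cube d (4 * n) → z ∈ box (0 : Site d) (4 * (n : ℝ)) :=
    fun z hz => mem_box_zero_iff.2 hz
  have hex : ∀ z : Site d, ∃ (x : Site d) (e : Jump d), ∀ h : z ∈ cube d (4 * n),
      (∀ t < longSize n, ray x e t ∈ cube d (n ^ 2)) ∧
      lineWord c j ⟨z, hbox z h⟩ = readAlong ξ (ray x e) (longSize n) := by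
    intro z
    by_cases h : z ∈ cube d (4 * n)
    · obtain ⟨x, e, hx⟩ := straight_of_mem_longWords hS hE hn (hlong ⟨z, hbox z h⟩)
      exact ⟨x, e, fun _ => hx⟩
    · exact ⟨0, (j, true), fun h' => absurd h' h⟩
  choose X E hXE using hex
  have same : ∀ z ∈ cube d (4 * n), ∀ z' ∈ cube d (4 * n), (∀ i, i ≠ j → z i = z' i) →
      E z' = E z ∧ X z' = X z := by
    intro z hz z' hz' h
    refine ray_unique hS hn (l := longSize n) (by unfold longSize; omega) (hXE z' hz').1 (hXE z hz).1 ?_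
    rw [← (hXE z' hz').2, ← (hXE z hz).2]
    exact lineWord_congr fun i hi => (h i hi).symm
  have next : ∀ z ∈ cube d (4 * n), ∀ i, i ≠ j → z + Pi.single i 1 ∈ cube d (4 * n) →
      E (z + Pi.single i 1) = E z ∧ l1 (X (z + Pi.single i 1) - X z) ≤ 1 := by
    intro z hz i hi hz'
    have h1 := hnb ⟨z, hbox z hz⟩ ⟨_, hbox _ hz'⟩ (by simp [Ne.symm hi]) (sqDist_add_single z i)
    rw [(hXE z hz).2, (hXE _ hz').2] at h1
    obtain ⟨h2, h3⟩ := parallel_of_neighbours hS hE hn (hXE z hz).1 (hXE _ hz').1 h1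
    exact ⟨h2.symm, h3⟩
  have hEstep : ∀ z ∈ cube d (4 * n), ∀ i, z + Pi.single i 1 ∈ cube d (4 * n) →
      E (z + Pi.single i 1) = E z := by
    intro z hz i hz'
    by_cases hi : i = j
    · subst hi
      exact (same z hz _ hz' fun k hk => by simp [hk]).1
    · exact (next z hz i hi hz').1
  have h0 : (0 : Site d) ∈ cube d (4 * n) := fun i => by simp
  have hE0 : ∀ z ∈ cube d (4 * n), E z = E 0 := fun z hz =>
    eq_on_box_of_step (lo := fun _ => -((4 * n : ℕ) : ℤ)) (hi := fun _ => ((4 * n : ℕ) : ℤ)) E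
      Finset.univ (fun i _ y hy hy' => hEstep y (mem_cube_iff_Icc.2 hy) i (mem_cube_iff_Icc.2 hy'))
      (mem_cube_iff_Icc.1 hz) (mem_cube_iff_Icc.1 h0) (by simp)
  set A : Site d → ℕ := fun z => (z j + 4 * n).toNat with hA
  have hAz : ∀ z ∈ cube d (4 * n), (A z : ℤ) = z j + 4 * n ∧ A z < longSize n := by
    intro z hz
    have := hz j
    rw [abs_le] at this
    push_cast at this
    simp only [hA]
    unfold longSize
    constructor <;> omega
  -- Each site of the output is sent to the site of the scenery from which its letter was read, on
  -- the ray that carries the word of its line.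
  set Φ : Site d → Site d := fun z => ray (X z) (E z) (A z) with hΦ
  have hstep : ∀ z ∈ cube d (4 * n), ∀ i, z + Pi.single i 1 ∈ cube d (4 * n) →
      l1 (Φ (z + Pi.single i 1) - Φ z) ≤ 1 := by
    intro z hz i hz'
    by_cases hi : i = j
    · subst hi
      obtain ⟨h1, h2⟩ := same z hz _ hz' fun k hk => by simp [hk]
      simp only [hΦ, h1, h2]
      rw [ray_sub, (hAz z hz).1, (hAz _ hz').1, l1_smul, l1_unitVec]
      simp
    · obtain ⟨h1, h2⟩ := next z hz i hi hz'
      have h3 : A (z + Pi.single i 1) = A z := by simp [hA, Ne.symm hi]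
      simp only [hΦ, h1, h3]
      convert h2 using 2
      simp only [ray]; abel
  have hinj : ∀ z ∈ cube d (4 * n), ∀ z' ∈ cube d (4 * n), z ≠ z' → l1 (z' - z) ≤ 2 →
      Φ z ≠ Φ z' := by
    intro z hz z' hz' hne hl heq
    have ha := hAz z hz
    have ha' := hAz z' hz'
    by_cases hsame : ∀ i, i ≠ j → z i = z' i
    · obtain ⟨h1, h2⟩ := same z hz z' hz' hsame
      simp only [hΦ, h1, h2] at heq
      have h3 := ray_injective _ _ heq
      apply hne
      funext i
      by_cases hi : i = j
      · subst hi; omega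
      · exact hsame i hi
    · push Not at hsame
      obtain ⟨i, hi, hii⟩ := hsame
      have hj := (abs_le_l1 (z' - z) j).trans hl
      rw [Pi.sub_apply, abs_le] at hj
      simp only [hΦ] at heq
      rw [hE0 z hz, hE0 z' hz'] at heq
      -- If two lines had a common image they would be shifts of one ray, sharing a short string.
      -- The indices differ by at most two, so starting at `2` keeps the shifted index nonnegative.
      have hray : ∀ t, ray (X z) (E 0) (2 + t) = ray (X z') (E 0) (2 + A z' - A z + t) := by
        intro t
        have e1 := ray_sub (X z) (E 0) (A z) (2 + t)
        have e2 := ray_sub (X z') (E 0) (A z') (2 + A z' - A z + t)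
        rw [show (((2 + A z' - A z + t : ℕ) : ℤ) - A z') = ((2 + t : ℕ) : ℤ) - A z by omega, ← e1,
          heq] at e2
        exact (sub_left_inj.1 e2).symm
      refine hdis ⟨z, hbox z hz⟩ ⟨z', hbox z' hz'⟩ ⟨i, hi, hii⟩
        (readAlong ξ (fun t => ray (X z) (E 0) (2 + t)) (shortSize n)) (by simp) ?_ ?_
      · rw [(hXE z hz).2, hE0 z hz]
        exact isInfix_iff_occursAt.2 ⟨2, readAlong_occursAt ξ _ (by unfold longSize; omega)⟩
      · rw [(hXE z' hz').2, hE0 z' hz']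
        simp only [hray]
        exact isInfix_iff_occursAt.2 ⟨_, readAlong_occursAt ξ _ (by unfold longSize; omega)⟩
  obtain ⟨g, hg, hgΦ⟩ := exists_signed_permutation (by omega) Φ hstep hinj
  refine ⟨Φ 0, ?_, equivalent_of_signed_permutation hg hgΦ ?_⟩
  · have h1 : lineWord c j (origin d n) = readAlong ξ (ray (X 0) (E 0)) (longSize n) := (hXE 0 h0).2
    rw [h1] at hseed
    have h2 := centre_mem_of_isSeeded hS hn hS' hE' hn' hln hmn (hXE 0 h0).1 hseed
    have h3 : A 0 = 4 * n := by simp [hA]; omega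
    simpa only [hΦ, h3] using h2
  · intro z
    have hz := mem_box_zero_iff.1 z.2
    have h1 := lineWord_eq_iff.1 (hXE z.1 hz).2 ⟨A z.1, (hAz z.1 hz).2⟩
    rw [lineSite_self _ _ _ (hAz z.1 hz).1] at h1
    exact h1.symm

/-- The scenery around the origin is an outcome. -/
theorem isOutcome_scenery {n : ℕ} {ξ : Scenery d κ} {o : Observations κ} (j : Fin d)
    (hS : Separated n ξ) (hE : Explored n ξ o) (hn : LargeParam n)
    (hS' : Separated (seedParam n) ξ) (hE' : Explored (seedParam n) ξ o)
    (hn' : LargeParam (seedParam n)) (hmn : seedParam n ≤ n) :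
    IsOutcome n o (fun z : OutBox d n => ξ z) := by
  have h6 := hn.six_le
  have h3 := hn.le
  have hsq := hn.sq_le
  set c : OutBox d n → Fin κ := fun z => ξ z with hcdef
  set base : OutBox d n → Site d := fun z => Function.update z.1 j (-(4 * (n : ℤ))) with hbase
  have hline : ∀ z : OutBox d n, lineWord c j z = readAlong ξ (ray (base z) (j, true)) (longSize n) := by
    intro z
    rw [lineWord_eq_iff]
    intro k
    simp only [hcdef]
    rw [lineSite_val]
  have hcube : ∀ z : OutBox d n, ∀ t < longSize n, ray (base z) (j, true) t ∈ cube d (4 * n) := by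
    intro z t ht
    have := lineSite_val j z ⟨t, ht⟩
    rw [← this]
    exact mem_box_zero_iff.1 (lineSite j z ⟨t, ht⟩).2
  have hlong : ∀ z, lineWord c j z ∈ LongWords n o := fun z => by
    rw [hline]; exact mem_longWords_of_ray hS hE hn (hcube z)
  have hsub : cube d (4 * n) ⊆ cube d (n ^ 2) := cube_mono (by omega)
  refine ⟨j, hlong, ⟨hlong _, ?_⟩, ?_, ?_⟩
  · set y : Site d := ray (base (origin d n)) (j, true) (4 * n - 4 * seedParam n) with hy
    refine ⟨readAlong ξ (ray y (j, true)) (longSize (seedParam n)), ?_,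
      4 * n - 4 * seedParam n, ?_, by omega⟩
    · refine mem_longWords_of_ray hS' hE' hn' fun t ht => ?_
      unfold longSize at ht
      intro i
      rw [hy, ← ray_add]
      by_cases hi : i = j
      · subst hi
        simp only [hbase, origin, ray, unitVec, Pi.add_apply, Function.update_self, Pi.smul_apply,
          Pi.single_eq_same, if_true, smul_eq_mul, mul_one]
        rw [abs_le]; push_cast [Nat.mul_le_mul_left 4 hmn]; omega
      · simp [hbase, origin, ray, unitVec, hi]
    · rw [hline]
      have hfun : ray y (j, true) =
          fun t => ray (base (origin d n)) (j, true) (4 * n - 4 * seedParam n + t) :=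
        funext fun t => by rw [hy, ray_add _ _ (4 * n - 4 * seedParam n)]
      rw [hfun]
      exact readAlong_occursAt ξ _ (by unfold longSize; omega)
  · intro z z' hj hd1
    have hl1 : ∃ u : Jump d, base z' = base z + unitVec u := by
      have hjj : base z' - base z = z'.1 - z.1 := by
        funext i
        by_cases hi : i = j
        · subst hi; simp [hbase, hj]
        · simp [hbase, hi]
      have hle : l1 (z'.1 - z.1) ≤ sqDist z.1 z'.1 := by
        refine Finset.sum_le_sum fun i _ => ?_
        rw [Pi.sub_apply, abs_sub_comm, ← sq_abs]
        have := abs_nonneg (z.1 i - z'.1 i)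
        nlinarith [Int.le_self_sq |z.1 i - z'.1 i|]
      obtain ⟨u, hu⟩ := exists_unitVec (u := z'.1 - z.1) (by omega) (by
        intro h
        have : z'.1 = z.1 := sub_eq_zero.1 h
        rw [this] at hd1
        simp [sqDist] at hd1)
      exact ⟨u, by rw [← hu, ← hjj]; abel⟩
    obtain ⟨u, hu⟩ := hl1
    rw [hline, hline]
    set L := shortSize n with hL
    set e : Jump d := (j, true) with he
    have hback : ∃ u' : Jump d, (unitVec u' : Site d) = -unitVec u :=
      ⟨(u.1, !u.2), by
        rw [unitVec_eq, unitVec_eq, ← Pi.single_neg]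
        congr 1
        unfold sgn
        cases u.2 <;> simp⟩
    obtain ⟨u', hu'⟩ := hback
    -- The witness for neighbours reads `L` sites of the first line, steps across, reads `L` sites
    -- of the second and steps back. The two crossings account for the two missing letters of `vb`.
    set s : ℕ → Jump d := fun i => if i = L - 1 then u else if i = 2 * L - 1 then u' else e with hs
    have t1 : ∀ t ≤ L - 1, trail (base z) s t = ray (base z) e t := by
      intro t ht
      rw [← trail_const]
      exact trail_congr fun i hi => by simp only [hs]; rw [if_neg (by omega), if_neg (by omega)]
    have t2 : ∀ t ≤ L - 1, trail (base z) s (L + t) = ray (base z') e (L - 1 + t) := by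
      intro t ht
      induction t with
      | zero =>
        have : L + 0 = L - 1 + 1 := by omega
        rw [this, trail_succ, t1 _ le_rfl, add_zero, hu]
        simp only [hs, if_true, ray]; abel
      | succ t ih =>
        rw [← add_assoc, trail_succ, ih (by omega), ← add_assoc, ray_succ]
        simp only [hs]
        rw [if_neg (by omega), if_neg (by omega)]
    have t3 : ∀ t, trail (base z) s (2 * L + t) = ray (base z) e (2 * L - 2 + t) := by
      intro t
      induction t with
      | zero =>
        have : 2 * L + 0 = L + (L - 1) + 1 := by omega
        rw [this, trail_succ, t2 _ le_rfl, hu]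
        have h4 : s (L + (L - 1)) = u' := by
          simp only [hs]; rw [if_neg (by omega), if_pos (by omega)]
        rw [h4, hu', show 2 * L - 2 + 0 = L - 1 + (L - 1) by omega]
        simp only [ray]; abel
      | succ t ih =>
        rw [← add_assoc, trail_succ, ih, ← add_assoc, ray_succ]
        simp only [hs]
        rw [if_neg (by omega), if_neg (by omega)]
    refine ⟨readAlong ξ (ray (base z) e) L, readAlong ξ (fun t => ray (base z) e (L + t)) (L - 2),
      readAlong ξ (fun t => ray (base z) e (L + (L - 2) + t)) L,
      readAlong ξ (fun t => ray (base z') e (L - 1 + t)) L, by simp [hL], by simp; omega, by simp [hL],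
      by simp [hL], ?_, 0, L - 1, ?_, ?_, by simp; omega⟩
    · have h0 : base z ∈ cube d (n ^ 2) := by
        have := hcube z 0 (by unfold longSize; omega)
        rw [ray_zero] at this; exact hsub this
      have := hE.far_cover _ h0 s
      rw [readAlong_three] at this
      convert this using 2
      · congr 1
        · rw [readAlong_eq_iff]
          intro t ht
          rw [t1 t (by omega)]
        · rw [readAlong_eq_iff]
          intro t ht
          rw [← hL, t2 t (by omega)]
      · rw [← hL, readAlong_eq_iff]
        intro t ht
        rw [t3, show L + (L - 2) = 2 * L - 2 by omega]
    · rw [← readAlong_add, ← readAlong_add]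
      have := readAlong_occursAt ξ (ray (base z) e) (k := longSize n) (p := 0) (l := L + (L - 2) + L)
        (by unfold longSize; omega)
      simpa only [zero_add] using this
    · exact readAlong_occursAt ξ _ (by unfold longSize; omega)
  · intro z z' hzz s hs h1 h2
    rw [hline] at h1 h2
    obtain ⟨p, hp⟩ := isInfix_iff_occursAt.1 h1
    obtain ⟨q, hq⟩ := isInfix_iff_occursAt.1 h2
    obtain ⟨hp1, hp2⟩ := occursAt_readAlong hp
    obtain ⟨hq1, hq2⟩ := occursAt_readAlong hq
    rw [hs] at hp1 hp2 hq1 hq2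
    simp only [ray_add] at hp1 hq1
    have := (ray_unique hS hn (l := shortSize n) (by omega)
      (fun t ht => by rw [← ray_add]; exact hsub (hcube z _ (by omega)))
      (fun t ht => by rw [← ray_add]; exact hsub (hcube z' _ (by omega))) (hp1.symm.trans hq1)).2
    obtain ⟨i, hi, hii⟩ := hzz
    apply hii
    have h4 := congrFun this i
    simpa [ray, hbase, hi, unitVec] using h4

end BRWScenery

namespace BRWScenery

variable {d κ : ℕ}

/-! ### Independence of colours -/

instance instProbUniformFin [NeZero κ] :
    IsProbabilityMeasure (uniformOn (Set.univ : Set (Fin κ))) :=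
  isProbabilityMeasure_uniformOn Set.finite_univ Set.univ_nonempty

instance instProbSceneryLaw [NeZero κ] : IsProbabilityMeasure (sceneryLaw d κ) := by
  unfold sceneryLaw; infer_instance

theorem map_equiv_uniformOn {α : Type*} [MeasurableSpace α] [MeasurableSingletonClass α] [Fintype α]
    (σ : α ≃ α) (hσ : Measurable σ) :
    (uniformOn (Set.univ : Set α)).map σ = uniformOn Set.univ := by
  refine Measure.ext fun s hs => ?_
  rw [Measure.map_apply hσ hs, uniformOn_univ, uniformOn_univ,
    Measure.count_apply (hσ hs), Measure.count_apply hs, Set.encard_preimage_of_bijective σ.bijective]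

/-- Changes the colour of the site `a`. -/
def recolour [NeZero κ] (a : Site d) (c : Fin κ) (ξ : Scenery d κ) : Scenery d κ :=
  fun z => if z = a then ξ z + c else ξ z

theorem measurePreserving_recolour [NeZero κ] (a : Site d) (c : Fin κ) :
    MeasurePreserving (recolour a c) (sceneryLaw d κ) (sceneryLaw d κ) := by
  refine ⟨measurable_pi_lambda _ fun z => (measurable_from_top (f := fun x : Fin κ =>
    if z = a then x + c else x)).comp (measurable_pi_apply z), ?_⟩
  have h := Measure.infinitePi_map_pi (μ := fun _ : Site d => uniformOn (Set.univ : Set (Fin κ)))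
    (f := fun z x => if z = a then x + c else x) (fun z => measurable_from_top)
  refine (show (sceneryLaw d κ).map (recolour a c) = _ from h).trans ?_
  unfold sceneryLaw
  congr 1
  funext z
  by_cases hz : z = a
  · simp only [hz, if_true]
    exact map_equiv_uniformOn (Equiv.addRight c) measurable_from_top
  · simp only [hz, if_false]
    exact Measure.map_id

theorem measurableSet_colour_eq (a b : Site d) :
    MeasurableSet {ξ : Scenery d κ | ξ a = ξ b} :=
  measurableSet_eq_fun (measurable_pi_apply a) (measurable_pi_apply b)

/-- Rotating the colour of `a` preserves the law and `F`, and permutes the `κ` events `ξ a = ξ b +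
c`, which partition `F`; they therefore have equal measure. -/
theorem measure_colour_eq_inter [NeZero κ] {a b : Site d} (hab : a ≠ b) {F : Set (Scenery d κ)}
    (hF : MeasurableSet F) (hinv : ∀ c ξ, recolour a c ξ ∈ F ↔ ξ ∈ F) :
    sceneryLaw d κ ({ξ | ξ a = ξ b} ∩ F) = (κ : ENNReal)⁻¹ * sceneryLaw d κ F := by
  set G : Fin κ → Set (Scenery d κ) := fun c => {ξ | ξ a = ξ b + c} ∩ F with hG
  have hGm : ∀ c, MeasurableSet (G c) := fun c => (measurableSet_eq_fun (measurable_pi_apply a)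
    ((measurable_from_top (f := fun x : Fin κ => x + c)).comp (measurable_pi_apply b))).inter hF
  have hGc : ∀ c, sceneryLaw d κ (G c) = sceneryLaw d κ ({ξ | ξ a = ξ b} ∩ F) := by
    intro c
    rw [← (measurePreserving_recolour a c).measure_preimage (hGm c).nullMeasurableSet]
    congr 1
    ext ξ
    simp only [hG, Set.mem_preimage, Set.mem_inter_iff, hinv]
    refine and_congr_left fun _ => ?_
    simp [recolour, Ne.symm hab]
  have hsum : sceneryLaw d κ F = ∑ c, sceneryLaw d κ (G c) := by
    rw [← measure_biUnion_finset]
    · congr 1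
      ext ξ
      simp only [hG, Finset.mem_univ, Set.iUnion_true, Set.mem_iUnion, Set.mem_inter_iff]
      constructor
      · intro h
        exact ⟨ξ a - ξ b, by simp, h⟩
      · rintro ⟨c, -, h⟩; exact h
    · intro c _ c' _ hcc
      refine Set.disjoint_left.2 fun ξ h h' => hcc ?_
      have h1 : ξ a = ξ b + c := h.1
      have h2 : ξ a = ξ b + c' := h'.1
      exact add_left_cancel (h1.symm.trans h2)
    · exact fun c _ => hGm c
  simp only [hGc, Finset.sum_const, Finset.card_univ, Fintype.card_fin, nsmul_eq_mul] at hsum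
  rw [hsum, ← mul_assoc, ENNReal.inv_mul_cancel (by simp [NeZero.ne κ]) (by simp), one_mul]

/-- Coincidences of colours which can be ordered so that each of them involves a fresh site are
independent. -/
theorem measure_forall_colour_eq [NeZero κ] {ι : Type*} [DecidableEq ι] (I : Finset ι)
    (a b : ι → Site d) (key : ι → ℤ) (ha : Set.InjOn a I) (hab : ∀ i ∈ I, a i ≠ b i)
    (hkey : ∀ i ∈ I, ∀ k ∈ I, b k = a i → key i < key k) :
    sceneryLaw d κ {ξ | ∀ i ∈ I, ξ (a i) = ξ (b i)} = ((κ : ENNReal)⁻¹) ^ I.card := by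
  induction I using Finset.induction_on_max_value key with
  | empty => simp
  | insert i s hi hmax ih =>
    have hF : MeasurableSet {ξ : Scenery d κ | ∀ k ∈ s, ξ (a k) = ξ (b k)} := by
      simp only [Set.ofPred_forall]
      exact Finset.measurableSet_biInter s fun k _ => measurableSet_colour_eq _ _
    have h1 : {ξ : Scenery d κ | ∀ k ∈ insert i s, ξ (a k) = ξ (b k)} =
        {ξ | ξ (a i) = ξ (b i)} ∩ {ξ | ∀ k ∈ s, ξ (a k) = ξ (b k)} := by
      ext ξ; simp
    rw [h1, measure_colour_eq_inter (hab i (by simp)) hF, ih, Finset.card_insert_of_notMem hi,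
      pow_succ, mul_comm]
    · exact ha.mono (by simp)
    · exact fun k hk => hab k (by simp [hk])
    · exact fun k hk m hm => hkey k (by simp [hk]) m (by simp [hm])
    · intro c ξ
      refine forall₂_congr fun k hk => ?_
      have h2 : a k ≠ a i := fun h => hi (by
        rw [← ha (by simp [hk]) (by simp) h]; exact hk)
      have h3 : b k ≠ a i := fun h => by
        have := hkey i (by simp) k (by simp [hk]) h
        have := hmax k hk
        omega
      simp [recolour, h2, h3]

/-! ### Paths which read the same word as a ray -/

/-- A path moves by one site per step and a ray is a geodesic, so the index of the meeting point
cannot change faster than time. -/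
theorem abs_sub_le_of_meet {x y : Site d} {e : Jump d} {s : ℕ → Jump d} {t t' u u' : ℕ}
    (h : trail y s t = ray x e u) (h' : trail y s t' = ray x e u') :
    |(u : ℤ) - u'| ≤ |(t : ℤ) - t'| := by
  wlog htt : t ≤ t' generalizing t t' u u'
  · rw [abs_sub_comm, abs_sub_comm (t : ℤ)]
    exact this h' h (by omega)
  have h1 := l1_trail_sub_le' y s htt
  rw [h, h', ray_sub, l1_smul, l1_unitVec, mul_one] at h1
  rw [abs_sub_comm, abs_sub_comm (t : ℤ)]
  exact h1.trans (le_abs_self _)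

/-- This is the case of equality: with `j - i` steps to cover a distance `j - i` along an axis, the
path has no freedom and runs along the ray backwards. -/
theorem trail_eq_reversed {x y : Site d} {e : Jump d} {s : ℕ → Jump d} {i j t : ℕ}
    (hi : trail y s i = ray x e j) (hj : trail y s j = ray x e i) (h1 : i ≤ t) (h2 : t ≤ j) :
    trail y s t = ray x e (i + j - t) := by
  have key : l1 (ray x e (i + j - t) - trail y s t) ≤ 0 := by
    refine l1_le_of_between (e := e) (α := (t : ℤ) - i) (β := (j : ℤ) - t) ?_ ?_
    · have e1 := ray_sub x e (i + j - t) j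
      rw [show ((j : ℤ) - (i + j - t : ℕ)) = t - i by omega] at e1
      have := l1_trail_sub_le' y s h1
      rw [hi, l1_sub_comm] at this
      rw [← e1, add_zero]
      convert this using 2
      abel
    · have e1 := ray_sub x e i (i + j - t)
      rw [show (((i + j - t : ℕ) : ℤ) - i) = j - t by omega] at e1
      have := l1_trail_sub_le' y s h2
      rw [hj, l1_sub_comm] at this
      rw [← e1, add_zero]
      convert this using 2
      abel
  exact (sub_eq_zero.1 (l1_eq_zero.1 (le_antisymm key (l1_nonneg _)))).symm

open Classical in
/-- The signed delay between a path and a ray which it meets. -/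
noncomputable def delay (k : ℕ) (x y : Site d) (e : Jump d) (s : ℕ → Jump d) (t : ℕ) : ℤ :=
  if h : ∃ u < k, trail y s t = ray x e u then (h.choose : ℤ) - t else 0

theorem delay_eq {k : ℕ} {x y : Site d} {e : Jump d} {s : ℕ → Jump d} {t u : ℕ} (hu : u < k)
    (h : trail y s t = ray x e u) : delay k x y e s t = (u : ℤ) - t := by
  have hex : ∃ u < k, trail y s t = ray x e u := ⟨u, hu, h⟩
  rw [delay, dif_pos hex, ray_injective x e (hex.choose_spec.2.symm.trans h)]

theorem delay_eq_zero {k : ℕ} {x y : Site d} {e : Jump d} {s : ℕ → Jump d} {t : ℕ}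
    (h : ¬ ∃ u < k, trail y s t = ray x e u) : delay k x y e s t = 0 := by
  rw [delay, dif_neg h]

/-- The coincidences along a path which avoids a ray are independent on any set of times on which
there is no exchange of sites. -/
theorem measure_coincide [NeZero κ] {k : ℕ} {x y : Site d} {e : Jump d} {s : ℕ → Jump d}
    (hne : ∀ t < k, trail y s t ≠ ray x e t) (I : Finset ℕ) (hI : ∀ t ∈ I, t < k)
    (hcyc : ∀ i ∈ I, ∀ j ∈ I, trail y s i = ray x e j → trail y s j ≠ ray x e i) :
    sceneryLaw d κ {ξ | ∀ t < k, ξ (trail y s t) = ξ (ray x e t)} ≤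
      ((κ : ENNReal)⁻¹) ^ I.card := by
  -- The order is by the size of the delay, with ties broken by time: backwards for positive and
  -- forwards for negative delays. Where a path site is a ray site of another coincidence,
  -- `abs_sub_le_of_meet` bounds the delay there by the present one; equality with opposite signs
  -- would be an exchange. The weight `2 * k + 1` makes the time term irrelevant except in ties.
  rw [← measure_forall_colour_eq (κ := κ) I (ray x e) (trail y s)
    (fun t => |delay k x y e s t| * (2 * k + 1) - (delay k x y e s t).sign * t)
    ((ray_injective x e).injOn) (fun t ht => (hne t (hI t ht)).symm) ?_]
  · exact measure_mono fun ξ h t ht => (h t (hI t ht)).symm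
  · intro i hi m hm hmi
    have hik := hI i hi
    have hmk := hI m hm
    have hmi' : m ≠ i := by
      rintro rfl; exact hne m hmk hmi
    have gm := delay_eq hik hmi
    rw [gm]
    have sgn_abs : ∀ a : ℤ, a ≠ 0 → a.sign = 1 ∧ |a| = a ∧ 0 < a ∨ a.sign = -1 ∧ |a| = -a ∧ a < 0 := by
      intro a ha
      rcases lt_or_gt_of_ne ha with h | h
      · right; exact ⟨Int.sign_eq_neg_one_of_neg h, abs_of_neg h, h⟩
      · left; exact ⟨Int.sign_eq_one_of_pos h, abs_of_pos h, h⟩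
    by_cases hex : ∃ u < k, trail y s i = ray x e u
    · obtain ⟨u, hu, hiu⟩ := hex
      have hui : u ≠ i := by rintro rfl; exact hne u hik hiu
      have hlip := abs_sub_le_of_meet hiu hmi
      have hnc : u ≠ m := by
        rintro rfl; exact hcyc u hm i hi hmi hiu
      rw [delay_eq hu hiu]
      rw [abs_sub_comm (i : ℤ) m] at hlip
      rcases sgn_abs ((u : ℤ) - i) (by omega) with ⟨a1, a2, a3⟩ | ⟨a1, a2, a3⟩ <;>
        rcases sgn_abs ((i : ℤ) - m) (by omega) with ⟨b1, b2, b3⟩ | ⟨b1, b2, b3⟩ <;>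
        rw [a1, a2, b1, b2] <;>
        rw [abs_sub_comm (m : ℤ) i, a2, b2] at hlip
      · rcases eq_or_lt_of_le hlip with h | h
        · rw [h]; nlinarith
        · nlinarith
      · rcases eq_or_lt_of_le hlip with h | h
        · omega
        · nlinarith
      · rcases eq_or_lt_of_le hlip with h | h
        · omega
        · nlinarith
      · rcases eq_or_lt_of_le hlip with h | h
        · rw [h]; nlinarith
        · nlinarith
    · rw [delay_eq_zero hex]
      rcases sgn_abs ((i : ℤ) - m) (by omega) with ⟨b1, b2, b3⟩ | ⟨b1, b2, b3⟩ <;>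
        rw [b1, b2] <;> simp <;> nlinarith

/-- A union bound over paths which are prescribed on a time interval. -/
theorem measure_exists_trail_le {i j k : ℕ} (hij : i ≤ j) (hj : j < k)
    (M : ℕ → Site d) (x : Site d) (e : Jump d) (P : Site d → (ℕ → Jump d) → Prop) (δ : ENNReal)
    (hM : ∀ y s, P y s → ∀ t, i ≤ t → t ≤ j → trail y s t = M t)
    (hδ : ∀ y s, P y s → sceneryLaw d κ {ξ | ∀ t < k, ξ (trail y s t) = ξ (ray x e t)} ≤ δ) :
    sceneryLaw d κ {ξ | ∃ y s, P y s ∧ ∀ t < k, ξ (trail y s t) = ξ (ray x e t)} ≤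
      (2 * d : ℕ) ^ (k - (j - i)) * δ := by
  -- The jumps outside the prescribed interval suffice: the earlier ones, read backwards from `M i`,
  -- also recover the starting site.
  set code : (ℕ → Jump d) → (Fin (k - (j - i)) → Jump d) :=
    fun s r => s (if (r : ℕ) < i then r else r + (j - i)) with hcode
  have hagree : ∀ y s y' s', P y s → P y' s' → code s = code s' →
      ∀ t < k, trail y s t = trail y' s' t := by
    intro y s y' s' h h' hc
    have h1 : ∀ r < i, s r = s' r := by
      intro r hr
      have := congrFun hc ⟨r, by omega⟩
      simpa [hcode, hr] using this
    have h2 : ∀ r, j ≤ r → r < k → s r = s' r := by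
      intro r hr hrk
      have := congrFun hc ⟨r - (j - i), by omega⟩
      simp only [hcode] at this
      rw [if_neg (by omega), show r - (j - i) + (j - i) = r by omega] at this
      exact this
    have hy : y = y' := by
      have e1 := (hM y s h i le_rfl hij).trans (hM y' s' h' i le_rfl hij).symm
      have e2 : trail y s i - y = trail y' s' i - y' := by
        simp only [trail, add_sub_cancel_left]
        exact Finset.sum_congr rfl fun r hr => by rw [h1 r (Finset.mem_range.1 hr)]
      rw [e1] at e2
      exact sub_right_inj.1 e2
    intro t ht
    rcases le_total t i with hti | hti
    · rw [hy]
      exact trail_congr fun r hr => h1 r (by omega)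
    · rcases le_total t j with htj | htj
      · rw [hM y s h t hti htj, hM y' s' h' t hti htj]
      · obtain ⟨c, rfl⟩ := Nat.exists_eq_add_of_le htj
        rw [trail_add, trail_add y', hM y s h j hij le_rfl, hM y' s' h' j hij le_rfl]
        exact trail_congr fun r hr => h2 _ (by omega) (by omega)
  have hsub : {ξ : Scenery d κ | ∃ y s, P y s ∧ ∀ t < k, ξ (trail y s t) = ξ (ray x e t)} ⊆
      ⋃ c : Fin (k - (j - i)) → Jump d,
        {ξ | ∃ y s, code s = c ∧ P y s ∧ ∀ t < k, ξ (trail y s t) = ξ (ray x e t)} := by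
    rintro ξ ⟨y, s, h1, h2⟩
    exact Set.mem_iUnion.2 ⟨code s, y, s, rfl, h1, h2⟩
  refine (measure_mono hsub).trans ((measure_iUnion_fintype_le _ _).trans ?_)
  calc _ ≤ ∑ c : Fin (k - (j - i)) → Jump d, δ := by
        refine Finset.sum_le_sum fun c _ => ?_
        by_cases hex : ∃ y s, code s = c ∧ P y s
        · obtain ⟨y, s, hc, hP⟩ := hex
          refine (measure_mono ?_).trans (hδ y s hP)
          rintro ξ ⟨y', s', hc', hP', h⟩ t ht
          rw [hagree y s y' s' hP hP' (hc.trans hc'.symm) t ht]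
          exact h t ht
        · have hempty : {ξ : Scenery d κ | ∃ y s, code s = c ∧ P y s ∧
              ∀ t < k, ξ (trail y s t) = ξ (ray x e t)} = ∅ := by
            refine Set.eq_empty_iff_forall_notMem.2 ?_
            rintro ξ ⟨y, s, hc, hP, -⟩
            exact hex ⟨y, s, hc, hP⟩
          rw [hempty, measure_empty]
          exact zero_le
    _ = _ := by
        simp [Finset.card_univ, mul_comm]

end BRWScenery

namespace BRWScenery

variable {d κ : ℕ}

/-! ### Typical sceneries are separated -/

/-- The sites of a cube, as a finite set. -/
noncomputable def cubeFinset (d N : ℕ) : Finset (Site d) :=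
  Fintype.piFinset fun _ => Finset.Icc (-(N : ℤ)) N

theorem mem_cubeFinset {N : ℕ} {x : Site d} : x ∈ cubeFinset d N ↔ x ∈ cube d N := by
  simp [cubeFinset, cube, abs_le]

theorem card_cubeFinset (d N : ℕ) : (cubeFinset d N).card = (2 * N + 1) ^ d := by
  simp only [cubeFinset, Fintype.card_piFinset, Int.card_Icc, Finset.prod_const, Finset.card_univ,
    Fintype.card_fin]
  congr 1
  omega

/-- The rate of coincidences between paths and straight words. -/
noncomputable def coincidenceRate (d : ℕ) : ℝ := 2 * d / (2 * d + 1)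

theorem ofReal_count (a b : ℕ) (hκ : 0 < κ) :
    ((2 * d : ℕ) : ENNReal) ^ a * ((κ : ENNReal)⁻¹) ^ b =
      ENNReal.ofReal ((2 * d) ^ a * ((κ : ℝ)⁻¹) ^ b) := by
  have hκ' : (0 : ℝ) < κ := by exact_mod_cast hκ
  rw [ENNReal.ofReal_mul (by positivity), ENNReal.ofReal_pow (by positivity),
    ENNReal.ofReal_pow (by positivity), ENNReal.ofReal_inv_of_pos hκ']
  congr 2
  · rw [← ENNReal.ofReal_natCast]; push_cast; rfl
  · simp

/-- Each prescribed step saves a factor `2d` in the count, while only about half of these steps lose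
a factor `κ⁻¹`. The balance holds because `κ⁻¹` is at most the square of the rate, that is, `2d + 1
≤ 4d²`. Rounding costs one factor `2d`. -/
theorem count_le_rate (hd : 1 ≤ d) (hκ : 2 * d + 1 ≤ κ) {k h D : ℕ} (h1 : 2 * h ≤ D + 1)
    (h2 : D < k) (h3 : D ≤ 2 * h) :
    (2 * d : ℝ) ^ (k - D) * ((κ : ℝ)⁻¹) ^ (k - h) ≤ 2 * d * coincidenceRate d ^ k := by
  have hd' : (1 : ℝ) ≤ d := by exact_mod_cast hd
  have hκ' : (2 * d + 1 : ℝ) ≤ κ := by exact_mod_cast hκ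
  have hκ0 : (0 : ℝ) < κ := by linarith
  have hq0 : 0 < coincidenceRate d := by unfold coincidenceRate; positivity
  have e1 : (2 * d : ℝ) * (κ : ℝ)⁻¹ ≤ coincidenceRate d := by
    rw [← div_eq_mul_inv]
    unfold coincidenceRate
    exact div_le_div_of_nonneg_left (by positivity) (by positivity) hκ'
  have e2 : (κ : ℝ)⁻¹ ≤ coincidenceRate d ^ 2 := by
    refine (inv_anti₀ (by positivity) hκ').trans ?_
    unfold coincidenceRate
    rw [div_pow, inv_eq_one_div, div_le_div_iff₀ (by positivity) (by positivity)]
    nlinarith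
  calc (2 * d : ℝ) ^ (k - D) * ((κ : ℝ)⁻¹) ^ (k - h)
      ≤ (2 * d : ℝ) ^ (k - 2 * h + 1) * ((κ : ℝ)⁻¹) ^ (k - h) := by
        gcongr
        · linarith
        · omega
    _ = 2 * d * (((2 * d : ℝ) * (κ : ℝ)⁻¹) ^ (k - 2 * h) * ((κ : ℝ)⁻¹) ^ h) := by
        rw [show k - h = k - 2 * h + h by omega, pow_add _ (k - 2 * h) h, pow_succ, mul_pow]; ring
    _ ≤ 2 * d * (coincidenceRate d ^ (k - 2 * h) * (coincidenceRate d ^ 2) ^ h) := by gcongr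
    _ = 2 * d * coincidenceRate d ^ k := by
        rw [← pow_mul, ← pow_add, Nat.sub_add_cancel (by omega)]

/-- The coincidences along a path which travels backwards along the ray between the times `i` and `j`,
and exchanges sites with it at no other times. -/
theorem measure_coincide_reversed [NeZero κ] {i j k : ℕ} {x y : Site d} {e : Jump d}
    {s : ℕ → Jump d} (hij : i < j) (hj : j < k)
    (hne : ∀ t < k, trail y s t ≠ ray x e t)
    (h1 : trail y s i = ray x e j) (h2 : trail y s j = ray x e i)
    (hmax : ∀ a b, a < b → b < k → trail y s a = ray x e b → trail y s b = ray x e a →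
      b - a ≤ j - i) :
    sceneryLaw d κ {ξ | ∀ t < k, ξ (trail y s t) = ξ (ray x e t)} ≤
      ((κ : ENNReal)⁻¹) ^ (k - (j - i + 1) / 2) := by
  -- For even `i + j` the reversed path would be on the ray at its own time halfway between `i` and
  -- `j`.
  have hodd : (i + j) % 2 = 1 := by
    by_contra hev
    have := trail_eq_reversed h1 h2 (t := (i + j) / 2) (by omega) (by omega)
    rw [show i + j - (i + j) / 2 = (i + j) / 2 by omega] at this
    exact hne _ (by omega) this
  have hcard : (Finset.range k \ Finset.Ico i (i + (j - i + 1) / 2)).card = k - (j - i + 1) / 2 := by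
    rw [Finset.card_sdiff_of_subset, Finset.card_range, Nat.card_Ico, Nat.add_sub_cancel_left]
    intro t ht
    simp only [Finset.mem_Ico, Finset.mem_range] at ht ⊢
    omega
  rw [← hcard]
  -- The Lipschitz bound applied to the four pairs of meetings shows that any other exchange has the
  -- same midpoint; by maximality it is nested inside. Deleting the first half of the interval thus
  -- breaks every exchange.
  have key : ∀ a b, a < b → b < k → trail y s a = ray x e b → trail y s b = ray x e a →
      a ∈ Finset.Ico i (i + (j - i + 1) / 2) := by
    intro a b hab hb ha' hb'
    have l1 := abs_sub_le_of_meet h1 ha'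
    have l2 := abs_sub_le_of_meet h2 hb'
    have l3 := abs_sub_le_of_meet h1 hb'
    have l4 := abs_sub_le_of_meet h2 ha'
    have l5 := hmax a b hab hb ha' hb'
    have hsum : i + j = a + b := by
      have q1 := le_antisymm l1 l2
      have q2 := le_antisymm l3 l4
      rcases abs_eq_abs.1 q1 with q | q <;> rcases abs_eq_abs.1 q2 with q' | q' <;> omega
    simp only [Finset.mem_Ico]
    omega
  refine measure_coincide hne _ (fun t ht => ?_) ?_
  · simp only [Finset.mem_sdiff, Finset.mem_range] at ht; exact ht.1
  · intro a ha b hb ha' hb'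
    simp only [Finset.mem_sdiff, Finset.mem_range] at ha hb
    rcases lt_trichotomy a b with h | h | h
    · exact ha.2 (key a b h hb.1 ha' hb')
    · subst h; exact hne a ha.1 ha'
    · exact hb.2 (key b a h ha.1 hb' ha')

/-- Paths without exchanges are counted by their starting site, which gives the term `(2 * N + 1) ^
d`. The others are sorted by their longest exchange, which fixes them in space, so only the `k ^ 2`
choices of a pair of times enter. -/
theorem measure_not_rigid_le (hd : 1 ≤ d) (hκ : 2 * d + 1 ≤ κ) (x : Site d) (e : Jump d) {k : ℕ}
    (hk : 0 < k) (N : ℕ) :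
    sceneryLaw d κ {ξ | ∃ y s, y ∈ cube d N ∧ (∀ t < k, ξ (trail y s t) = ξ (ray x e t)) ∧
      ∀ t < k, trail y s t ≠ ray x e t} ≤
      ENNReal.ofReal (((2 * N + 1) ^ d + k ^ 2) * (2 * d * coincidenceRate d ^ k)) := by
  have : NeZero κ := ⟨by omega⟩
  have hκ0 : 0 < κ := by omega
  have hq0 : 0 ≤ 2 * d * coincidenceRate d ^ k := by unfold coincidenceRate; positivity
  set ρ : ENNReal := ENNReal.ofReal (2 * d * coincidenceRate d ^ k) with hρ
  set A : Site d → Set (Scenery d κ) := fun y₀ => {ξ | ∃ y s, (y = y₀ ∧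
    (∀ t < k, trail y s t ≠ ray x e t) ∧
    (∀ i < k, ∀ j < k, trail y s i = ray x e j → trail y s j ≠ ray x e i)) ∧
    ∀ t < k, ξ (trail y s t) = ξ (ray x e t)} with hA
  set B : ℕ × ℕ → Set (Scenery d κ) := fun p => {ξ | ∃ y s, ((p.1 < p.2 ∧ p.2 < k) ∧
    (∀ t < k, trail y s t ≠ ray x e t) ∧
    trail y s p.1 = ray x e p.2 ∧ trail y s p.2 = ray x e p.1 ∧
    ∀ a b, a < b → b < k → trail y s a = ray x e b → trail y s b = ray x e a →
      b - a ≤ p.2 - p.1) ∧ ∀ t < k, ξ (trail y s t) = ξ (ray x e t)} with hB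
  have hAle : ∀ y₀, sceneryLaw d κ (A y₀) ≤ ρ := by
    intro y₀
    refine (measure_exists_trail_le (i := 0) (j := 0) le_rfl hk (fun _ => y₀) x e _
      (((κ : ENNReal)⁻¹) ^ k) ?_ ?_).trans ?_
    · rintro y s ⟨rfl, -⟩ t - ht
      rw [Nat.le_zero.1 ht, trail_zero]
    · rintro y s ⟨-, h1, h2⟩
      have := measure_coincide (κ := κ) h1 (Finset.range k) (fun t ht => Finset.mem_range.1 ht)
        (fun i hi j hj => h2 i (Finset.mem_range.1 hi) j (Finset.mem_range.1 hj))
      rwa [Finset.card_range] at this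
    · rw [ofReal_count _ _ hκ0]
      exact ENNReal.ofReal_le_ofReal (count_le_rate hd hκ (h := 0) (D := 0) (by omega) hk (by omega))
  have hBle : ∀ p, sceneryLaw d κ (B p) ≤ ρ := by
    rintro ⟨i, j⟩
    by_cases hij : i < j ∧ j < k
    · refine (measure_exists_trail_le (i := i) (j := j) hij.1.le hij.2
        (fun t => ray x e (i + j - t)) x e _ (((κ : ENNReal)⁻¹) ^ (k - (j - i + 1) / 2)) ?_ ?_).trans ?_
      · rintro y s ⟨-, -, h1, h2, -⟩ t ht1 ht2
        exact trail_eq_reversed h1 h2 ht1 ht2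
      · rintro y s ⟨-, h0, h1, h2, h3⟩
        exact measure_coincide_reversed hij.1 hij.2 h0 h1 h2 h3
      · rw [ofReal_count _ _ hκ0]
        exact ENNReal.ofReal_le_ofReal (count_le_rate hd hκ (by omega) (by omega) (by omega))
    · have : B (i, j) = ∅ := by
        refine Set.eq_empty_iff_forall_notMem.2 ?_
        rintro ξ ⟨y, s, ⟨h, -⟩, -⟩
        exact hij h
      rw [this, measure_empty]
      exact zero_le
  have hsub : {ξ : Scenery d κ | ∃ y s, y ∈ cube d N ∧ (∀ t < k, ξ (trail y s t) = ξ (ray x e t)) ∧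
      ∀ t < k, trail y s t ≠ ray x e t} ⊆
      (⋃ y ∈ cubeFinset d N, A y) ∪ ⋃ p ∈ Finset.range k ×ˢ Finset.range k, B p := by
    rintro ξ ⟨y, s, hy, hr, hne⟩
    by_cases hcyc : ∀ i < k, ∀ j < k, trail y s i = ray x e j → trail y s j ≠ ray x e i
    · exact Or.inl (Set.mem_biUnion (mem_cubeFinset.2 hy) ⟨y, s, ⟨rfl, hne, hcyc⟩, hr⟩)
    · right
      push Not at hcyc
      set T : Finset (ℕ × ℕ) := (Finset.range k ×ˢ Finset.range k).filter fun p =>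
        p.1 < p.2 ∧ trail y s p.1 = ray x e p.2 ∧ trail y s p.2 = ray x e p.1 with hT
      have hTne : T.Nonempty := by
        obtain ⟨i, hi, j, hj, h1, h2⟩ := hcyc
        rcases lt_trichotomy i j with h | h | h
        · exact ⟨(i, j), by simp [hT, hi, hj, h, h1, h2]⟩
        · subst h; exact absurd h1 (hne i hi)
        · exact ⟨(j, i), by simp [hT, hi, hj, h, h1, h2]⟩
      obtain ⟨p, hp, hmax⟩ := T.exists_max_image (fun p => p.2 - p.1) hTne
      simp only [hT, Finset.mem_filter, Finset.mem_product, Finset.mem_range] at hp hmax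
      refine Set.mem_biUnion (x := p) (by simp [hp.1]) ?_
      exact ⟨y, s, ⟨⟨hp.2.1, hp.1.2⟩, hne, hp.2.2.1, hp.2.2.2, fun a b hab hb h1 h2 =>
        hmax (a, b) ⟨⟨by simp only; omega, hb⟩, hab, h1, h2⟩⟩, hr⟩
  refine (measure_mono hsub).trans ((measure_union_le _ _).trans ?_)
  have e1 : sceneryLaw d κ (⋃ y ∈ cubeFinset d N, A y) ≤ ((2 * N + 1) ^ d : ℕ) * ρ := by
    refine (measure_biUnion_finset_le _ _).trans ?_
    refine (Finset.sum_le_card_nsmul _ _ ρ fun y _ => hAle y).trans ?_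
    rw [card_cubeFinset, nsmul_eq_mul]
  have e2 : sceneryLaw d κ (⋃ p ∈ Finset.range k ×ˢ Finset.range k, B p) ≤ (k ^ 2 : ℕ) * ρ := by
    refine (measure_biUnion_finset_le _ _).trans ?_
    refine (Finset.sum_le_card_nsmul _ _ ρ fun y _ => hBle y).trans ?_
    rw [Finset.card_product, Finset.card_range, nsmul_eq_mul, sq]
  refine (add_le_add e1 e2).trans ?_
  rw [← add_mul, ENNReal.ofReal_mul (by positivity), ← hρ]
  gcongr
  rw [← Nat.cast_add, ← ENNReal.ofReal_natCast]
  refine ENNReal.ofReal_le_ofReal (le_of_eq ?_)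
  push_cast; rfl

/-- The two sequences of sites can only overlap if `f` is opposite to `e`, and then with a delay in
one direction; the natural order of time makes each coincidence involve a fresh site. -/
theorem measure_not_bent_le (hκ : 0 < κ) (x : Site d) {e f : Jump d} (hef : e ≠ f) (p : ℕ) :
    sceneryLaw d κ {ξ | ∀ t < p, ξ (ray x e (t + 1)) = ξ (ray (x + unitVec f) e t)} ≤
      ENNReal.ofReal ((κ : ℝ)⁻¹ ^ p) := by
  have : NeZero κ := ⟨by omega⟩
  have hmeet : ∀ i m : ℕ, ray (x + unitVec f) e m = ray x e (i + 1) → i < m := by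
    intro i m h
    have h1 : (unitVec f : Site d) = ((i : ℤ) + 1 - m) • unitVec e := by
      simp only [ray] at h
      push_cast at h
      have : (unitVec f : Site d) = ((i : ℤ) + 1) • unitVec e - (m : ℤ) • unitVec e := by
        rw [eq_sub_iff_add_eq]
        rw [add_assoc] at h
        exact add_left_cancel h
      rw [this, ← sub_smul]
    have h2 := congrArg l1 h1
    rw [l1_smul, l1_unitVec, l1_unitVec, mul_one] at h2
    rcases (abs_eq (by norm_num)).1 h2.symm with h3 | h3
    · rw [h3, one_smul] at h1
      exact absurd (unitVec_injective h1).symm hef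
    · omega
  have := measure_forall_colour_eq (κ := κ) (Finset.range p) (fun t => ray x e (t + 1))
    (fun t => ray (x + unitVec f) e t) (fun t => (t : ℤ))
    (fun a _ b _ h => by have := ray_injective x e h; omega)
    (fun i _ h => absurd (hmeet i i h.symm) (lt_irrefl _))
    (fun i _ m _ h => by exact_mod_cast hmeet i m h)
  simp only [Finset.mem_range, Finset.card_range] at this
  rw [this]
  have h1 := ofReal_count (d := 0) (κ := κ) 0 p hκ
  simp only [pow_zero, one_mul] at h1
  rw [h1]

/-- A bound for the probability that the scenery is not separated. -/
noncomputable def separationError (d κ n : ℕ) : ℝ :=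
  (2 * (n : ℝ) ^ 2 + 1) ^ d * (2 * d) *
      (((2 * (n : ℝ) ^ 4 + 1) ^ d + ((shortSize n / 3 : ℕ) : ℝ) ^ 2) *
        (2 * d * coincidenceRate d ^ (shortSize n / 3))) +
    (2 * (n : ℝ) ^ 2 + 1) ^ d * (2 * d) ^ 2 * (κ : ℝ)⁻¹ ^ (shortSize n / (2 * d))

theorem measure_not_separated_le (hd : 1 ≤ d) (hκ : 2 * d + 1 ≤ κ) {n : ℕ}
    (hn : 6 ≤ shortSize n) :
    sceneryLaw d κ {ξ | ¬ Separated n ξ} ≤ ENNReal.ofReal (separationError d κ n) := by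
  have hκ0 : 0 < κ := by omega
  have hq0 : 0 ≤ coincidenceRate d := by unfold coincidenceRate; positivity
  set k := shortSize n / 3 with hk
  set A : Site d × Jump d → Set (Scenery d κ) := fun q => {ξ | ∃ y s, y ∈ cube d (n ^ 4) ∧
    (∀ t < k, ξ (trail y s t) = ξ (ray q.1 q.2 t)) ∧ ∀ t < k, trail y s t ≠ ray q.1 q.2 t} with hA
  set B : Site d × Jump d × Jump d → Set (Scenery d κ) := fun q => {ξ | q.2.1 ≠ q.2.2 ∧
    ∀ t < shortSize n / (2 * d), ξ (ray q.1 q.2.1 (t + 1)) = ξ (ray (q.1 + unitVec q.2.2) q.2.1 t)}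
    with hB
  have hsub : {ξ : Scenery d κ | ¬ Separated n ξ} ⊆
      (⋃ q ∈ cubeFinset d (n ^ 2) ×ˢ (Finset.univ : Finset (Jump d)), A q) ∪
      ⋃ q ∈ cubeFinset d (n ^ 2) ×ˢ (Finset.univ : Finset (Jump d × Jump d)), B q := by
    intro ξ hξ
    by_contra hcon
    simp only [Set.mem_union, Set.mem_iUnion, not_or, not_exists] at hcon
    apply hξ
    refine ⟨fun x hx e y hy s hr => ?_, fun x hx e f hef => ?_⟩
    · by_contra hno
      push Not at hno
      exact hcon.1 (x, e) (by simpa using mem_cubeFinset.2 hx) ⟨y, s, hy, hr, hno⟩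
    · by_contra hno
      push Not at hno
      exact hcon.2 (x, e, f) (by simpa using mem_cubeFinset.2 hx) ⟨hef, hno⟩
  refine (measure_mono hsub).trans ((measure_union_le _ _).trans ?_)
  unfold separationError
  rw [ENNReal.ofReal_add (by positivity) (by positivity)]
  refine add_le_add ?_ ?_
  · refine (measure_biUnion_finset_le _ _).trans ?_
    refine (Finset.sum_le_card_nsmul _ _ _ fun q _ =>
      measure_not_rigid_le hd hκ q.1 q.2 (by omega) (n ^ 4)).trans ?_
    rw [Finset.card_product, card_cubeFinset, nsmul_eq_mul, ENNReal.ofReal_mul (by positivity),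
      ← ENNReal.ofReal_natCast]
    push_cast
    simp only [Finset.card_univ, Fintype.card_prod, Fintype.card_fin, Fintype.card_bool]
    push_cast
    rw [mul_comm (d : ℝ) 2, ← ENNReal.ofReal_mul (by positivity), ← ENNReal.ofReal_mul (by positivity)]
  · refine (measure_biUnion_finset_le _ _).trans ?_
    refine (Finset.sum_le_card_nsmul _ _ (ENNReal.ofReal ((κ : ℝ)⁻¹ ^ (shortSize n / (2 * d))))
      fun q _ => ?_).trans ?_
    · by_cases hq : q.2.1 = q.2.2
      · have : B q = ∅ := by
          refine Set.eq_empty_iff_forall_notMem.2 ?_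
          rintro ξ ⟨h, -⟩
          exact h hq
        rw [this, measure_empty]
        exact zero_le
      · exact (measure_mono fun ξ h => h.2).trans (measure_not_bent_le hκ0 q.1 hq _)
    · rw [Finset.card_product, card_cubeFinset, nsmul_eq_mul, ENNReal.ofReal_mul (by positivity),
        ← ENNReal.ofReal_natCast]
      push_cast
      simp only [Finset.card_univ, Fintype.card_prod, Fintype.card_fin, Fintype.card_bool]
      push_cast
      rw [mul_comm (d : ℝ) 2, sq (2 * (d : ℝ))]

end BRWScenery

namespace BRWScenery

variable {d κ : ℕ}

/-! ### A discrete travelling front -/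

/-- The average over the neighbours of a site. -/
noncomputable def nbAvg (f : Site d → ℝ) (x : Site d) : ℝ :=
  (∑ e : Jump d, f (x + unitVec e)) / (2 * d)

theorem nbAvg_mono {f g : Site d → ℝ} (h : ∀ x, f x ≤ g x) (x : Site d) : nbAvg f x ≤ nbAvg g x := by
  unfold nbAvg
  gcongr
  exact h _

theorem nbAvg_const_mul (c : ℝ) (f : Site d → ℝ) (x : Site d) :
    nbAvg (fun y => c * f y) x = c * nbAvg f x := by
  unfold nbAvg
  rw [← Finset.mul_sum, mul_div_assoc]

theorem sum_jump_const (c : ℝ) : ∑ _e : Jump d, c = 2 * d * c := by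
  simp only [Finset.sum_const, Finset.card_univ, Fintype.card_prod, Fintype.card_fin,
    Fintype.card_bool, nsmul_eq_mul]
  push_cast; ring

theorem nbAvg_le {f : Site d → ℝ} {x : Site d} {c : ℝ} (hd : 1 ≤ d)
    (h : ∀ e : Jump d, f (x + unitVec e) ≤ c) : nbAvg f x ≤ c := by
  have hd' : (0 : ℝ) < d := by exact_mod_cast hd
  unfold nbAvg
  rw [div_le_iff₀ (by positivity), mul_comm, ← sum_jump_const]
  exact Finset.sum_le_sum fun e _ => h e

theorem le_nbAvg {f : Site d → ℝ} {x : Site d} {c : ℝ} (hd : 1 ≤ d)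
    (h : ∀ e : Jump d, c ≤ f (x + unitVec e)) : c ≤ nbAvg f x := by
  have hd' : (0 : ℝ) < d := by exact_mod_cast hd
  unfold nbAvg
  rw [le_div_iff₀ (by positivity), mul_comm, ← sum_jump_const]
  exact Finset.sum_le_sum fun e _ => h e

theorem div_le_nbAvg {f : Site d → ℝ} (h0 : ∀ x, 0 ≤ f x) (x : Site d) (e : Jump d) :
    f (x + unitVec e) / (2 * d) ≤ nbAvg f x := by
  unfold nbAvg
  gcongr
  exact Finset.single_le_sum (f := fun e => f (x + unitVec e)) (fun _ _ => h0 _) (Finset.mem_univ e)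

/-- A cosine cut off at its zeros. -/
noncomputable def cosCut (R : ℕ) (k : ℤ) : ℝ :=
  if |k| ≤ R then Real.cos (Real.pi / (2 * R) * k) else 0

theorem cosCut_nonneg {R : ℕ} (hR : 1 ≤ R) (k : ℤ) : 0 ≤ cosCut R k := by
  unfold cosCut
  split
  · next h =>
    have hR' : (0 : ℝ) < R := by exact_mod_cast hR
    have hk : |(k : ℝ)| ≤ R := by exact_mod_cast h
    rw [abs_le] at hk
    have hc : Real.pi / (2 * R) * R = Real.pi / 2 := by field_simp
    have hpos : 0 ≤ Real.pi / (2 * R) := by positivity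
    refine Real.cos_nonneg_of_mem_Icc ⟨?_, ?_⟩
    · rw [← hc]; nlinarith
    · rw [← hc]; nlinarith
  · exact le_rfl

theorem cosCut_le_one (R : ℕ) (k : ℤ) : cosCut R k ≤ 1 := by
  unfold cosCut
  split
  · exact Real.cos_le_one _
  · norm_num

theorem cosCut_zero (R : ℕ) : cosCut R 0 = 1 := by simp [cosCut]

/-- Inside the cut this is the addition formula, with equality. From the zeros outwards the left
side vanishes and the right side is nonnegative. -/
theorem cosCut_add_ge {R : ℕ} (hR : 1 ≤ R) (k : ℤ) :
    2 * Real.cos (Real.pi / (2 * R)) * cosCut R k ≤ cosCut R (k + 1) + cosCut R (k - 1) := by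
  have hR' : (0 : ℝ) < R := by exact_mod_cast hR
  have hedge : ∀ k : ℤ, |k| = R → cosCut R k = 0 := by
    intro k hk
    have hc : Real.pi / (2 * R) * R = Real.pi / 2 := by field_simp
    unfold cosCut
    rw [if_pos hk.le]
    rcases (abs_eq (by positivity)).1 hk with h | h <;> rw [h] <;> push_cast
    · rw [hc, Real.cos_pi_div_two]
    · rw [mul_neg, Real.cos_neg, hc, Real.cos_pi_div_two]
  by_cases hk : |k| < R
  · have h1 : |k + 1| ≤ R := by rw [abs_lt] at hk; rw [abs_le]; omega
    have h2 : |k - 1| ≤ R := by rw [abs_lt] at hk; rw [abs_le]; omega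
    unfold cosCut
    rw [if_pos hk.le, if_pos h1, if_pos h2]
    push_cast
    rw [mul_add, mul_sub, Real.cos_add, Real.cos_sub, mul_one]
    apply le_of_eq; ring
  · have h0 : cosCut R k = 0 := by
      rcases eq_or_lt_of_le (not_lt.1 hk) with h | h
      · exact hedge k h.symm
      · unfold cosCut; rw [if_neg (not_le.2 h)]
    rw [h0, mul_zero]
    exact add_nonneg (cosCut_nonneg hR _) (cosCut_nonneg hR _)

/-- A positive bump which loses little under averaging. -/
noncomputable def bump (R : ℕ) (x : Site d) : ℝ := ∏ i, cosCut R (x i)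

theorem bump_nonneg {R : ℕ} (hR : 1 ≤ R) (x : Site d) : 0 ≤ bump R x :=
  Finset.prod_nonneg fun _ _ => cosCut_nonneg hR _

theorem bump_le_one {R : ℕ} (hR : 1 ≤ R) (x : Site d) : bump R x ≤ 1 :=
  Finset.prod_le_one (fun _ _ => cosCut_nonneg hR _) fun _ _ => cosCut_le_one _ _

theorem bump_zero (R : ℕ) : bump R (0 : Site d) = 1 := by simp [bump, cosCut_zero]

theorem bump_eq_zero {R : ℕ} {x : Site d} (h : (d * R : ℕ) < l1 x) : bump R x = 0 := by
  by_contra hne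
  have h1 : ∀ i, |x i| ≤ R := by
    intro i
    by_contra hi
    apply hne
    refine Finset.prod_eq_zero (Finset.mem_univ i) ?_
    unfold cosCut
    rw [if_neg hi]
  have h2 : l1 x ≤ ∑ _i : Fin d, (R : ℤ) := Finset.sum_le_sum fun i _ => h1 i
  simp at h2
  push_cast at h
  omega

theorem le_nbAvg_bump {R : ℕ} (hd : 1 ≤ d) (hR : 1 ≤ R) (x : Site d) :
    Real.cos (Real.pi / (2 * R)) * bump R x ≤ nbAvg (bump R) x := by
  have hd' : (0 : ℝ) < d := by exact_mod_cast hd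
  unfold nbAvg
  rw [le_div_iff₀ (by positivity), Fintype.sum_prod_type]
  have hupd : ∀ (i : Fin d) (v : Bool), bump R (x + unitVec (i, v)) =
      cosCut R (x i + sgn (i, v)) * ∏ k ∈ Finset.univ.erase i, cosCut R (x k) := by
    intro i v
    unfold bump
    rw [← Finset.mul_prod_erase _ _ (Finset.mem_univ i)]
    congr 1
    · rw [Pi.add_apply]
      have := unitVec_same ((i, v) : Jump d)
      simp only at this
      rw [this]
    · refine Finset.prod_congr rfl fun k hk => ?_
      rw [Pi.add_apply, unitVec_ne _ (Finset.ne_of_mem_erase hk), add_zero]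
  have hone : ∀ i : Fin d, 2 * Real.cos (Real.pi / (2 * R)) * bump R x ≤
      ∑ v : Bool, bump R (x + unitVec (i, v)) := by
    intro i
    rw [Fintype.sum_bool, hupd, hupd, ← add_mul]
    unfold bump
    rw [← Finset.mul_prod_erase _ _ (Finset.mem_univ i), ← mul_assoc]
    refine mul_le_mul_of_nonneg_right ?_ (Finset.prod_nonneg fun _ _ => cosCut_nonneg hR _)
    exact cosCut_add_ge hR (x i)
  calc Real.cos (Real.pi / (2 * R)) * bump R x * (2 * d)
      = ∑ _i : Fin d, 2 * Real.cos (Real.pi / (2 * R)) * bump R x := by simp; ring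
    _ ≤ _ := Finset.sum_le_sum fun i _ => hone i

/-- On a large enough box the loss of the bump by averaging is outweighed by half of the branching
rate, leaving a net growth factor `1 + b / 4`. -/
theorem exists_radius {b : ℝ} (hb0 : 0 < b) :
    ∃ R : ℕ, 1 ≤ R ∧ 1 + b / 4 ≤ (1 + b / 2) * Real.cos (Real.pi / (2 * R)) := by
  have h1 : Filter.Tendsto (fun R : ℕ => (1 + b / 2) * Real.cos (Real.pi / (2 * R))) Filter.atTop
      (nhds ((1 + b / 2) * Real.cos 0)) := by
    refine Filter.Tendsto.const_mul _ ((Real.continuous_cos.tendsto 0).comp ?_)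
    have : (fun R : ℕ => Real.pi / (2 * R)) = fun R : ℕ => (Real.pi / 2) / (R : ℝ) := by
      funext R; rw [div_div]
    rw [this]
    exact tendsto_const_div_atTop_nhds_zero_nat _
  rw [Real.cos_zero, mul_one] at h1
  have h2 := h1.eventually (lt_mem_nhds (show 1 + b / 4 < 1 + b / 2 by linarith))
  obtain ⟨R, hR, hR1⟩ := (h2.and (Filter.eventually_ge_atTop 1)).exists
  exact ⟨R, hR1, hR.le⟩

/-- The evolution inequality satisfied by hitting probabilities of the branching walk. -/
structure FrontIneq (b : ℝ) (p : ℕ → Site d → ℝ) : Prop where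
  nonneg : ∀ t x, 0 ≤ p t x
  le_one : ∀ t x, p t x ≤ 1
  mono : ∀ t x, p t x ≤ p (t + 1) x
  step : ∀ t x, nbAvg (p t) x * (1 + b * (1 - nbAvg (p t) x)) ≤ p (t + 1) x

namespace FrontIneq

variable {b : ℝ} {p : ℕ → Site d → ℝ}

theorem mono_of_le (hp : FrontIneq b p) {s t : ℕ} (h : s ≤ t) (x : Site d) : p s x ≤ p t x :=
  monotone_nat_of_le_succ (f := fun t => p t x) (fun t => hp.mono t x) h

theorem avg_nonneg (hp : FrontIneq b p) (t : ℕ) (x : Site d) : 0 ≤ nbAvg (p t) x :=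
  div_nonneg (Finset.sum_nonneg fun _ _ => hp.nonneg _ _) (by positivity)

theorem avg_le (hp : FrontIneq b p) (hd : 1 ≤ d) (hb0 : 0 ≤ b) (t : ℕ) (x : Site d) :
    nbAvg (p t) x ≤ p (t + 1) x := by
  refine le_trans ?_ (hp.step t x)
  have h0 := hp.avg_nonneg t x
  have h1 : nbAvg (p t) x ≤ 1 := nbAvg_le hd fun e => hp.le_one _ _
  nlinarith [mul_nonneg h0 (mul_nonneg hb0 (sub_nonneg.2 h1))]

/-- The map `a ↦ a (1 + b (1 - a))` is increasing on `[0, 1]` since `b ≤ 1`, and below `1/2` it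
multiplies by at least `1 + b / 2`. -/
theorem grow_one (hp : FrontIneq b p) (hd : 1 ≤ d) (hb0 : 0 ≤ b) (hb1 : b ≤ 1) {R : ℕ} (hR : 1 ≤ R)
    (hRb : 1 + b / 4 ≤ (1 + b / 2) * Real.cos (Real.pi / (2 * R))) {t : ℕ} {θ : ℝ} (hθ0 : 0 ≤ θ)
    (hθ1 : θ ≤ 1 / 2) {y : Site d} (h : ∀ x, θ * bump R (x - y) ≤ p t x) (x : Site d) :
    (1 + b / 4) * θ * bump R (x - y) ≤ p (t + 1) x := by
  have h1 := nbAvg_mono h x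
  have h2 : nbAvg (fun z => θ * bump R (z - y)) x = θ * nbAvg (bump R) (x - y) := by
    rw [nbAvg_const_mul]
    unfold nbAvg
    simp only [add_sub_right_comm]
  rw [h2] at h1
  have h3 := mul_le_mul_of_nonneg_left (le_nbAvg_bump hd hR (x - y)) hθ0
  have hφ0 := bump_nonneg hR (x - y)
  have hφ1 := bump_le_one hR (x - y)
  have hc1 := Real.cos_le_one (Real.pi / (2 * R))
  set C := Real.cos (Real.pi / (2 * R))
  set φ := bump R (x - y)
  have hC0 : 0 ≤ C := by
    by_contra hneg
    push Not at hneg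
    nlinarith
  set a := nbAvg (p t) x
  have ha1 : a ≤ 1 := nbAvg_le hd fun e => hp.le_one _ _
  have h4 : θ * (C * φ) ≤ a := h3.trans h1
  have h5 : θ * (C * φ) ≤ 1 / 2 := by
    have : C * φ ≤ 1 := by nlinarith
    nlinarith [mul_nonneg hC0 hφ0]
  have h0 : 0 ≤ θ * (C * φ) := by positivity
  refine le_trans ?_ (hp.step t x)
  set a₀ := θ * (C * φ)
  have h6 : (1 + b / 4) * θ * φ ≤ (1 + b / 2) * a₀ := by
    have : (1 + b / 2) * a₀ = ((1 + b / 2) * C) * (θ * φ) := by simp only [a₀]; ring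
    rw [this, mul_assoc]
    exact mul_le_mul_of_nonneg_right hRb (by positivity)
  have h7 : (1 + b / 2) * a₀ ≤ a₀ * (1 + b * (1 - a₀)) := by
    nlinarith [mul_nonneg hb0 h0]
  have h8 : a₀ * (1 + b * (1 - a₀)) ≤ a * (1 + b * (1 - a)) := by
    have : a * (1 + b * (1 - a)) - a₀ * (1 + b * (1 - a₀)) = (a - a₀) * (1 + b * (1 - a - a₀)) := by ring
    have h9 : 0 ≤ 1 + b * (1 - a - a₀) := by nlinarith
    nlinarith [mul_nonneg (sub_nonneg.2 h4) h9]
  linarith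

theorem grow (hp : FrontIneq b p) (hd : 1 ≤ d) (hb0 : 0 ≤ b) (hb1 : b ≤ 1) {R : ℕ} (hR : 1 ≤ R)
    (hRb : 1 + b / 4 ≤ (1 + b / 2) * Real.cos (Real.pi / (2 * R))) {t : ℕ} {θ : ℝ} (hθ0 : 0 ≤ θ)
    (hθ1 : θ ≤ 1 / 2) {y : Site d} (h : ∀ x, θ * bump R (x - y) ≤ p t x) (m : ℕ) (x : Site d) :
    min ((1 + b / 4) ^ m * θ) (1 / 2) * bump R (x - y) ≤ p (t + m) x := by
  induction m generalizing x with
  | zero => rw [pow_zero, one_mul, min_eq_left hθ1]; exact h x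
  | succ m ih =>
    have hm0 : 0 ≤ min ((1 + b / 4) ^ m * θ) (1 / 2) := by positivity
    refine le_trans ?_ (hp.grow_one hd hb0 hb1 hR hRb hm0 (min_le_right _ _) ih x)
    refine mul_le_mul_of_nonneg_right ?_ (bump_nonneg hR _)
    rw [mul_min_of_nonneg _ _ (by positivity), pow_succ', mul_assoc]
    exact min_le_min le_rfl (by linarith)

theorem shift (hp : FrontIneq b p) (hd : 1 ≤ d) (hb0 : 0 ≤ b) {t : ℕ} {x : Site d} (e : Jump d) :
    p t (x + unitVec e) / (2 * d) ≤ p (t + 1) x :=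
  (div_le_nbAvg (hp.nonneg t) x e).trans (hp.avg_le hd hb0 t x)

end FrontIneq

theorem exists_step_towards {u : Site d} (h : u ≠ 0) : ∃ e : Jump d, l1 (u + unitVec e) = l1 u - 1 := by
  obtain ⟨i, hi⟩ := Function.ne_iff.1 h
  have hi' : u i ≠ 0 := hi
  have key : ∀ v : Site d, l1 v = |v i| + ∑ k ∈ Finset.univ.erase i, |v k| := fun v =>
    (Finset.add_sum_erase _ (fun k => |v k|) (Finset.mem_univ i)).symm
  refine ⟨(i, decide (u i < 0)), ?_⟩
  rw [key, key u]
  have h1 : ∑ k ∈ Finset.univ.erase i, |(u + unitVec (i, decide (u i < 0))) k| =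
      ∑ k ∈ Finset.univ.erase i, |u k| := Finset.sum_congr rfl fun k hk => by
    rw [Pi.add_apply, unitVec_ne _ (Finset.ne_of_mem_erase hk), add_zero]
  have h2 : |(u + unitVec (i, decide (u i < 0))) i| = |u i| - 1 := by
    rw [Pi.add_apply]
    have := unitVec_same ((i, decide (u i < 0)) : Jump d)
    simp only at this
    rw [this]
    unfold sgn
    rcases lt_or_gt_of_ne hi' with h | h
    · rw [if_pos (by simpa using h), abs_of_neg h, abs_of_nonpos (by omega)]; ring
    · rw [if_neg (by simpa using h.le), abs_of_pos h, abs_of_nonneg (by omega)]; ring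
  rw [h1, h2]; ring

namespace FrontIneq

variable {b : ℝ} {p : ℕ → Site d → ℝ}

/-- A particle is always followed by at least one child, which takes a shortest way to `z` with
probability at least `(2d)⁻¹` per step; spare time is harmless by monotonicity. -/
theorem near_source (hp : FrontIneq b p) (hd : 1 ≤ d) (hb0 : 0 ≤ b) {z : Site d} {δ : ℝ}
    (hδ : δ ≤ p 0 z) (hδ0 : 0 ≤ δ) (m : ℕ) (x : Site d) (hx : l1 (x - z) ≤ m) :
    δ / (2 * d) ^ m ≤ p m x := by
  have hd' : (1 : ℝ) ≤ d := by exact_mod_cast hd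
  induction m generalizing x with
  | zero =>
    have : x = z := sub_eq_zero.1 (l1_eq_zero.1 (le_antisymm (by simpa using hx) (l1_nonneg _)))
    subst this
    simpa using hδ
  | succ m ih =>
    by_cases hxz : x = z
    · have h1 := ih x (by rw [hxz, sub_self, l1_zero]; positivity)
      refine le_trans ?_ (h1.trans (hp.mono m x))
      gcongr
      · linarith
      · omega
    · obtain ⟨e, he⟩ := exists_step_towards (sub_ne_zero.2 hxz)
      have h1 := ih (x + unitVec e) (by
        rw [add_sub_right_comm, he]; push_cast at hx; linarith)
      refine le_trans ?_ (hp.shift hd hb0 e)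
      rw [pow_succ, ← div_div]
      gcongr

/-- A weak bump is spread around the source in time `d * R`, and `K` steps regain each lost factor
`2d`. After that the centre moves by one site at the cost of one factor `2d`, so every unit of
distance takes `K + 1` steps. -/
theorem half_le (hp : FrontIneq b p) (hd : 1 ≤ d) (hb0 : 0 ≤ b) (hb1 : b ≤ 1) {R K : ℕ} (hR : 1 ≤ R)
    (hRb : 1 + b / 4 ≤ (1 + b / 2) * Real.cos (Real.pi / (2 * R)))
    (hK : 2 * d ≤ (1 + b / 4) ^ K) {z : Site d} {r : ℕ} (hz : ((2 * d : ℝ) ^ r)⁻¹ ≤ p 0 z)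
    (m : ℕ) (y : Site d) (hy : l1 (y - z) = m) (x : Site d) :
    1 / 2 * bump R (x - y) ≤ p (d * R + K * (r + d * R) + m * (K + 1)) x := by
  have hd' : (1 : ℝ) ≤ d := by exact_mod_cast hd
  induction m generalizing y x with
  | zero =>
    have : y = z := sub_eq_zero.1 (l1_eq_zero.1 (by simpa using hy))
    subst this
    set θ : ℝ := ((2 * d : ℝ) ^ (r + d * R))⁻¹ with hθ
    have hθ0 : 0 ≤ θ := by positivity
    have hdR : r + d * R ≠ 0 := by
      have := Nat.mul_le_mul hd hR
      omega
    have hθ1 : θ ≤ 1 / 2 := by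
      rw [hθ, one_div]
      refine inv_anti₀ (by norm_num) ?_
      calc (2 : ℝ) ≤ 2 * d := by linarith
        _ ≤ (2 * d : ℝ) ^ (r + d * R) := le_self_pow₀ (by linarith) hdR
    have hstart : ∀ x, θ * bump R (x - y) ≤ p (d * R) x := by
      intro x
      by_cases hx : l1 (x - y) ≤ (d * R : ℕ)
      · have := hp.near_source hd hb0 hz (by positivity) (d * R) x hx
        refine le_trans ?_ this
        rw [hθ, pow_add, mul_inv, ← div_eq_mul_inv]
        exact mul_le_of_le_one_right (by positivity) (bump_le_one hR _)
      · rw [bump_eq_zero (not_le.1 hx), mul_zero]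
        exact hp.nonneg _ _
    have := hp.grow hd hb0 hb1 hR hRb hθ0 hθ1 hstart (K * (r + d * R)) x
    rw [zero_mul, add_zero]
    refine le_trans ?_ this
    refine mul_le_mul_of_nonneg_right (le_min ?_ le_rfl) (bump_nonneg hR _)
    have h1 : (2 * d : ℝ) ^ (r + d * R) ≤ (1 + b / 4) ^ (K * (r + d * R)) := by
      rw [pow_mul]; gcongr
    have h2 : 1 ≤ (1 + b / 4) ^ (K * (r + d * R)) * θ := by
      rw [hθ, ← div_eq_mul_inv, le_div_iff₀ (by positivity), one_mul]
      exact h1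
    linarith
  | succ m ih =>
    have hyz : y - z ≠ 0 := by
      intro h
      rw [h, l1_zero] at hy
      push_cast at hy
      omega
    obtain ⟨e, he⟩ := exists_step_towards hyz
    have hprev := ih (y + unitVec e) (by rw [add_sub_right_comm, he, hy]; push_cast; ring)
    set t := d * R + K * (r + d * R) + m * (K + 1) with ht
    have hmove : ∀ x, 1 / (4 * d) * bump R (x - y) ≤ p (t + 1) x := by
      intro x
      refine le_trans ?_ (hp.shift hd hb0 e)
      have := hprev (x + unitVec e)
      rw [add_sub_add_right_eq_sub] at this
      rw [le_div_iff₀ (by positivity)]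
      refine le_trans (le_of_eq ?_) this
      field_simp; ring
    have := hp.grow hd hb0 hb1 hR hRb (by positivity) (by
      rw [div_le_div_iff₀ (by positivity) (by norm_num)]; linarith) hmove K x
    rw [show d * R + K * (r + d * R) + (m + 1) * (K + 1) = t + 1 + K by rw [ht]; ring]
    refine le_trans ?_ this
    refine mul_le_mul_of_nonneg_right (le_min ?_ le_rfl) (bump_nonneg hR _)
    rw [mul_one_div, div_le_div_iff₀ (by norm_num) (by positivity)]
    linarith

end FrontIneq

/-- Failure probabilities decay exponentially, after a time which is linear in the distance to the
source and in the strength of the source. -/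
theorem exists_front_time (hd : 1 ≤ d) {b : ℝ} (hb0 : 0 < b) (hb1 : b ≤ 1) :
    ∃ C : ℕ, ∀ (p : ℕ → Site d → ℝ) (_ : FrontIneq b p) (z : Site d) (r : ℕ),
      ((2 * d : ℝ) ^ r)⁻¹ ≤ p 0 z → ∀ (m i T : ℕ) (y : Site d), l1 (y - z) ≤ m →
        C * (r + 1 + m + i) + i ≤ T → 1 - p T y ≤ (1 - b / 2) ^ i := by
  obtain ⟨R, hR, hRb⟩ := exists_radius hb0
  obtain ⟨K, hK⟩ := pow_unbounded_of_one_lt (2 * d : ℝ) (show 1 < 1 + b / 4 by linarith)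
  set C := d * R + K * (1 + d * R) + (K + 1) with hC
  refine ⟨C, fun p hp z r hz => ?_⟩
  have hhalf : ∀ (m T : ℕ) (y : Site d), l1 (y - z) ≤ m → C * (r + 1 + m) ≤ T → 1 / 2 ≤ p T y := by
    intro m T y hy hT
    obtain ⟨k, hk⟩ := Int.eq_ofNat_of_zero_le (l1_nonneg (y - z))
    have h1 := hp.half_le hd hb0.le hb1 hR hRb hK.le hz k y hk y
    rw [sub_self, bump_zero, mul_one] at h1
    refine h1.trans (hp.mono_of_le ?_ y)
    refine le_trans ?_ hT
    have hkm : k ≤ m := by omega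
    rw [hC]
    have e1 : K * (r + d * R) ≤ K * (1 + d * R) * (r + 1) := by
      rw [mul_assoc]; refine Nat.mul_le_mul_left _ ?_; nlinarith [Nat.zero_le (d * R * r)]
    have e2 : k * (K + 1) ≤ (K + 1) * m := by rw [mul_comm]; exact Nat.mul_le_mul_left _ hkm
    nlinarith [Nat.zero_le (d * R * (r + m)), Nat.zero_le (K * (1 + d * R) * m),
      Nat.zero_le ((K + 1) * (r + 1))]
  intro m i
  induction i generalizing m with
  | zero =>
    intro T y _ _
    have := hp.nonneg T y
    simpa using this
  | succ i ih =>
    intro T y hy hT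
    obtain ⟨T, rfl⟩ : ∃ T', T = T' + 1 := ⟨T - 1, by omega⟩
    have hstep := hp.step T y
    have hnb : ∀ e : Jump d, l1 (y + unitVec e - z) ≤ (m + 1 : ℕ) := by
      intro e
      rw [add_sub_right_comm]
      refine (l1_add_le _ _).trans ?_
      rw [l1_unitVec]; push_cast; linarith
    -- One generation is traded for one more factor `1 - b / 2`, at a distance larger by one; the
    -- budget `C * (m + i)` is unchanged by this trade.
    have hT' : C * (r + 1 + (m + 1) + i) + i ≤ T := by
      have : r + 1 + (m + 1) + i = r + 1 + m + (i + 1) := by ring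
      rw [this]; omega
    have ha : 1 / 2 ≤ nbAvg (p T) y := le_nbAvg hd fun e =>
      hhalf (m + 1) T _ (hnb e) (by
        refine le_trans ?_ hT'
        nlinarith [Nat.zero_le (C * i)])
    have ha1 : nbAvg (p T) y ≤ 1 := nbAvg_le hd fun e => hp.le_one _ _
    have hq : 1 - (1 - b / 2) ^ i ≤ nbAvg (p T) y := le_nbAvg hd fun e => by
      have := ih (m + 1) T _ (hnb e) hT'
      linarith
    set a := nbAvg (p T) y
    have hfac : 1 - a * (1 + b * (1 - a)) = (1 - a) * (1 - b * a) := by ring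
    have h1 : 1 - p (T + 1) y ≤ (1 - a) * (1 - b * a) := by linarith
    refine h1.trans ?_
    rw [pow_succ]
    refine mul_le_mul (by linarith) (by nlinarith) (by nlinarith) (by
      have : 0 ≤ 1 - b / 2 := by linarith
      positivity)

end BRWScenery

namespace BRWScenery

variable {d κ : ℕ}

/-! ### The branching property -/

/-- The law of the split and the jump of one particle. -/
noncomputable abbrev stepLaw (d : ℕ) (b : unitInterval) : Measure (Bool × (Fin d × Bool)) :=
  (bernoulliMeasure true false b).prod (uniformOn (Set.univ : Set (Fin d × Bool)))

instance instProbUniformJump [NeZero d] :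
    IsProbabilityMeasure (uniformOn (Set.univ : Set (Fin d × Bool))) :=
  isProbabilityMeasure_uniformOn Set.finite_univ Set.univ_nonempty

instance instProbWalkLaw [NeZero d] (b : unitInterval) : IsProbabilityMeasure (walkLaw d b) := by
  unfold walkLaw; infer_instance

/-- The evolution of the descendants of the child `c` of the root. -/
def subEvolution (c : Bool) (η : Evolution d) : Evolution d := fun v => η (v ++ [c])

/-- The events which depend on the particles in `S` only. -/
abbrev particleAlgebra (d : ℕ) (S : Set Particle) : MeasurableSpace (Evolution d) :=
  ⨆ v ∈ S, MeasurableSpace.comap (fun η : Evolution d => η v) inferInstance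

theorem indep_particleAlgebra [NeZero d] (b : unitInterval) {S T : Set Particle} (h : Disjoint S T) :
    Indep (particleAlgebra d S) (particleAlgebra d T) (walkLaw d b) := by
  have h1 : iIndepFun (fun (v : Particle) (η : Evolution d) => η v) (walkLaw d b) :=
    iIndepFun_infinitePi (P := fun _ => stepLaw d b) (X := fun _ x => x) fun _ => measurable_id
  exact indep_iSup_of_disjoint (fun v => (measurable_pi_apply v).comap_le) h1 h

theorem measurable_subEvolution_particleAlgebra (c : Bool) {S : Set Particle}
    (hS : ∀ v, v ++ [c] ∈ S) :
    @Measurable _ _ (particleAlgebra d S) _ (subEvolution (d := d) c) := by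
  refine @measurable_pi_lambda _ _ _ (particleAlgebra d S) _ _ fun v => ?_
  exact Measurable.of_comap_le
    (le_biSup (fun v => MeasurableSpace.comap (fun η : Evolution d => η v) inferInstance) (hS v))

theorem measurePreserving_subEvolution [NeZero d] (b : unitInterval) (c : Bool) :
    MeasurePreserving (subEvolution (d := d) c) (walkLaw d b) (walkLaw d b) := by
  refine ⟨measurable_pi_lambda _ fun v => measurable_pi_apply _, ?_⟩
  exact Measure.map_infinitePi_infinitePi_of_inj (P := fun _ : Particle => stepLaw d b)
    (f := fun v => v ++ [c]) fun v w h => List.append_cancel_right h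

theorem measurableSet_particle (v : Particle) (A : Set (Bool × (Fin d × Bool))) :
    MeasurableSet {η : Evolution d | η v ∈ A} :=
  (measurable_pi_apply (X := fun _ : Particle => Bool × (Fin d × Bool)) v)
    (Set.toFinite A).measurableSet

theorem measurableSet_split (v : Particle) : MeasurableSet {η : Evolution d | (η v).1 = true} :=
  measurableSet_particle v {p | p.1 = true}

theorem measurableSet_jump (v : Particle) (e : Jump d) :
    MeasurableSet {η : Evolution d | (η v).2 = e} :=
  measurableSet_particle v {p | p.2 = e}

theorem measureReal_split [NeZero d] (b : unitInterval) (v : Particle) :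
    (walkLaw d b).real {η : Evolution d | (η v).1 = true} = b := by
  have h1 : {η : Evolution d | (η v).1 = true} =
      (fun η : Evolution d => η v) ⁻¹' ({true} ×ˢ Set.univ) := by
    ext η; simp
  have h2 : MeasurePreserving (fun η : Evolution d => η v) (walkLaw d b) (stepLaw d b) :=
    measurePreserving_eval_infinitePi (fun _ : Particle => stepLaw d b) v
  rw [h1, h2.measureReal_preimage (Set.toFinite _).measurableSet.nullMeasurableSet,
    measureReal_prod_prod]
  simp

/-- The probability that the first child and, if it is born, the second child both fail. -/
theorem measureReal_children_fail [NeZero d] (b : unitInterval) {S : Set (Evolution d)}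
    (hS : MeasurableSet S) :
    (walkLaw d b).real {η | subEvolution false η ∉ S ∧ ((η []).1 = true → subEvolution true η ∉ S)} =
      (1 - (walkLaw d b).real S) * (1 - b * (walkLaw d b).real S) := by
  set q := (walkLaw d b).real S
  set A : Set (Evolution d) := subEvolution false ⁻¹' S with hA
  set B : Set (Evolution d) := subEvolution true ⁻¹' S with hB
  set D : Set (Evolution d) := {η | (η []).1 = true} with hD
  have hAq : (walkLaw d b).real A = q :=
    (measurePreserving_subEvolution b false).measureReal_preimage hS.nullMeasurableSet
  have hBq : (walkLaw d b).real B = q :=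
    (measurePreserving_subEvolution b true).measureReal_preimage hS.nullMeasurableSet
  have mA : MeasurableSet A := (measurePreserving_subEvolution b false).measurable hS
  have mB : MeasurableSet B := (measurePreserving_subEvolution b true).measurable hS
  have mD : MeasurableSet D := measurableSet_split []
  have mD' : MeasurableSet[particleAlgebra d {[]}] D := by
    refine (le_biSup (fun v => MeasurableSpace.comap (fun η : Evolution d => η v) inferInstance)
      (Set.mem_singleton [])) D ?_
    exact ⟨{p | p.1 = true}, (Set.toFinite _).measurableSet, rfl⟩
  have hsplit : ∀ {S T : Set Particle} {E F : Set (Evolution d)}, Disjoint S T →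
      MeasurableSet[particleAlgebra d S] E → MeasurableSet[particleAlgebra d T] F →
      (walkLaw d b).real (E ∩ F) = (walkLaw d b).real E * (walkLaw d b).real F := by
    intro S T E F hST hE hF
    have := (Indep_iff _ _ _).1 (indep_particleAlgebra b hST) E F hE hF
    simp only [Measure.real, this, ENNReal.toReal_mul]
  have hDB : (walkLaw d b).real (D ∩ B) = b * q := by
    rw [hsplit (S := {[]}) (T := {v | ∃ w, v = w ++ [true]}) _ mD'
      (measurable_subEvolution_particleAlgebra true
        (S := {v | ∃ w, v = w ++ [true]}) (fun v => ⟨v, rfl⟩) hS),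
      hBq, hD, measureReal_split]
    rw [Set.disjoint_left]
    rintro v hv ⟨w, hw⟩
    rw [Set.mem_singleton_iff.1 hv] at hw
    simp at hw
  have hset : {η | subEvolution false η ∉ S ∧ ((η []).1 = true → subEvolution true η ∉ S)} =
      Aᶜ ∩ (D ∩ B)ᶜ := by
    ext η
    simp [hA, hB, hD]
  have mono : ∀ {S T : Set Particle}, S ⊆ T → particleAlgebra d S ≤ particleAlgebra d T :=
    fun h => biSup_mono h
  -- The descendants of the first child are disjoint from the root together with those of the
  -- second, and the split is decided at the root.
  rw [hset, hsplit (S := {v | ∃ w, v = w ++ [false]})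
    (T := {[]} ∪ {v | ∃ w, v = w ++ [true]}),
    probReal_compl_eq_one_sub mA, probReal_compl_eq_one_sub (mD.inter mB), hAq, hDB]
  · rw [Set.disjoint_left]
    rintro v ⟨w, rfl⟩ (hv | ⟨w', hw⟩)
    · simp at hv
    · simp at hw
  · exact (measurable_subEvolution_particleAlgebra false
      (S := {v | ∃ w, v = w ++ [false]}) (fun v => ⟨v, rfl⟩) hS).compl
  · refine MeasurableSet.compl (MeasurableSet.inter (mono Set.subset_union_left _ mD') ?_)
    exact measurable_subEvolution_particleAlgebra true
      (S := {[]} ∪ {v | ∃ w, v = w ++ [true]}) (fun v => Or.inr ⟨v, rfl⟩) hS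

/-- Changes the jump of the root. -/
def rejump (σ : Equiv.Perm (Jump d)) (η : Evolution d) : Evolution d :=
  fun v => if v = [] then ((η v).1, σ (η v).2) else η v

theorem measurePreserving_rejump [NeZero d] (b : unitInterval) (σ : Equiv.Perm (Jump d)) :
    MeasurePreserving (rejump σ) (walkLaw d b) (walkLaw d b) := by
  have hm : ∀ v : Particle, Measurable (fun x : Bool × (Fin d × Bool) =>
      if v = [] then (x.1, σ x.2) else x) := fun v => measurable_of_finite _
  refine ⟨measurable_pi_lambda _ fun v => (hm v).comp (measurable_pi_apply v), ?_⟩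
  have h := Measure.infinitePi_map_pi (μ := fun _ : Particle => stepLaw d b)
    (f := fun v x => if v = [] then (x.1, σ x.2) else x) hm
  refine (show (walkLaw d b).map (rejump σ) = _ from h).trans ?_
  unfold walkLaw
  congr 1
  funext v
  by_cases hv : v = []
  · simp only [hv, if_true]
    exact ((MeasurePreserving.id (bernoulliMeasure true false b)).prod
      ⟨measurable_of_finite σ, map_equiv_uniformOn σ (measurable_of_finite σ)⟩).map_eq
  · simp only [hv, if_false]
    exact Measure.map_id

/-- The jump of the root is uniform and independent of everything else. -/
theorem measureReal_root_jump [NeZero d] (b : unitInterval) (F : Jump d → Set (Evolution d))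
    (hF : ∀ e, MeasurableSet (F e)) (hinv : ∀ e σ η, rejump σ η ∈ F e ↔ η ∈ F e) :
    (walkLaw d b).real {η | η ∈ F (η []).2} = (∑ e, (walkLaw d b).real (F e)) / (2 * d) := by
  have hd : (0 : ℝ) < d := by exact_mod_cast Nat.pos_of_ne_zero (NeZero.ne d)
  set H : Jump d → Jump d → Set (Evolution d) := fun e e' => {η | (η []).2 = e'} ∩ F e with hH
  have hHm : ∀ e e', MeasurableSet (H e e') := fun e e' =>
    (measurableSet_jump [] e').inter (hF e)
  have hdisj : ∀ f : Jump d → Jump d,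
      Set.PairwiseDisjoint (Finset.univ : Finset (Jump d)) fun e' => H (f e') e' := by
    intro f e _ e' _ hee
    refine Set.disjoint_left.2 fun η h h' => hee ?_
    exact h.1.symm.trans h'.1
  -- Exchanging two values of the root's jump preserves the law and `F e`, so conditionally on `F e`
  -- the jump is still uniform.
  have hHe : ∀ e e', (walkLaw d b).real (H e e') = (walkLaw d b).real (H e e) := by
    intro e e'
    rw [← (measurePreserving_rejump b (Equiv.swap e e')).measureReal_preimage
      (hHm e e').nullMeasurableSet]
    congr 1
    ext η
    simp only [hH, Set.mem_preimage, Set.mem_inter_iff, hinv]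
    refine and_congr_left fun _ => ?_
    simp only [rejump, Set.mem_ofPred_eq, if_true]
    rw [Equiv.swap_apply_eq_iff, Equiv.swap_apply_right]
  have hHF : ∀ e, (walkLaw d b).real (H e e) = (walkLaw d b).real (F e) / (2 * d) := by
    intro e
    have h1 : F e = ⋃ e' ∈ (Finset.univ : Finset (Jump d)), H e e' := by
      ext η; simp [hH]
    rw [eq_div_iff (by positivity), h1, measureReal_biUnion_finset (hdisj fun _ => e)
      fun e' _ => hHm e e']
    simp only [hHe, sum_jump_const]
    ring
  have h2 : {η : Evolution d | η ∈ F (η []).2} =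
      ⋃ e ∈ (Finset.univ : Finset (Jump d)), H e e := by
    ext η; simp [hH]
  rw [h2, measureReal_biUnion_finset (hdisj fun e => e) fun e _ => hHm e e, Finset.sum_div]
  exact Finset.sum_congr rfl fun e _ => hHF e

/-! ### Following a given path -/

/-- By time `t` the walk started at `x` reaches `z`, whereupon a line of descent makes the given
jumps. -/
def reachEvent (t : ℕ) (x z : Site d) (s : ℕ → Jump d) (r : ℕ) : Set (Evolution d) :=
  {η | ∃ u : Particle, u.length ≤ t ∧ IsBorn η u ∧ x + position η u = z ∧
    ∀ i < r, (η (List.replicate (i + 1) false ++ u)).2 = s i}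

theorem measurableSet_isBorn (u : Particle) : MeasurableSet {η : Evolution d | IsBorn η u} := by
  induction u with
  | nil => simp [IsBorn]
  | cons c v ih =>
    have : {η : Evolution d | IsBorn η (c :: v)} =
        {η | IsBorn η v} ∩ ({_η | c = true}ᶜ ∪ {η | (η v).1 = true}) := by
      ext η
      simp only [IsBorn, Set.mem_inter_iff, Set.mem_union, Set.mem_compl_iff, Set.mem_ofPred_eq]
      tauto
    rw [this]
    exact ih.inter ((MeasurableSet.const _).compl.union (measurableSet_split v))

theorem measurable_position (u : Particle) :
    Measurable fun η : Evolution d => position η u := by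
  induction u with
  | nil => exact measurable_const
  | cons c v ih =>
    exact ih.add ((measurable_of_finite fun p : Bool × (Fin d × Bool) => unitVec p.2).comp
      (measurable_pi_apply (c :: v)))

theorem measurableSet_reachEvent (t : ℕ) (x z : Site d) (s : ℕ → Jump d) (r : ℕ) :
    MeasurableSet (reachEvent t x z s r) := by
  have : reachEvent t x z s r = ⋃ u : Particle, ({_η | u.length ≤ t} ∩ ({η | IsBorn η u} ∩
      ({η | x + position η u = z} ∩
        ⋂ i ∈ Finset.range r, {η | (η (List.replicate (i + 1) false ++ u)).2 = s i}))) := by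
    ext η; simp [reachEvent]
  rw [this]
  refine MeasurableSet.iUnion fun u => (MeasurableSet.const _).inter ((measurableSet_isBorn u).inter
    (MeasurableSet.inter ?_ ?_))
  · exact ((measurable_position u).const_add x) (measurableSet_singleton z)
  · refine Finset.measurableSet_biInter _ fun i _ => ?_
    exact measurableSet_jump _ (s i)

theorem isBorn_rejump (σ : Equiv.Perm (Jump d)) (η : Evolution d) (u : Particle) :
    IsBorn (rejump σ η) u ↔ IsBorn η u := by
  induction u with
  | nil => simp [IsBorn]
  | cons c v ih =>
    have : (rejump σ η v).1 = (η v).1 := by unfold rejump; split <;> rfl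
    simp only [IsBorn, ih, this]

theorem position_rejump (σ : Equiv.Perm (Jump d)) (η : Evolution d) (u : Particle) :
    position (rejump σ η) u = position η u := by
  induction u with
  | nil => rfl
  | cons c v ih => simp [position, ih, rejump]

theorem rejump_mem_reachEvent {t r : ℕ} {x z : Site d} {s : ℕ → Jump d} (σ : Equiv.Perm (Jump d))
    (η : Evolution d) : rejump σ η ∈ reachEvent t x z s r ↔ η ∈ reachEvent t x z s r := by
  refine exists_congr fun u => ?_
  rw [isBorn_rejump, position_rejump]
  refine and_congr_right fun _ => and_congr_right fun _ => and_congr_right fun _ => ?_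
  simp [rejump]

theorem isBorn_append (η : Evolution d) (c : Bool) (u : Particle) :
    IsBorn η (u ++ [c]) ↔ IsBorn (subEvolution c η) u ∧ (c = true → (η []).1 = true) := by
  induction u with
  | nil => simp [IsBorn]
  | cons a v ih =>
    rw [List.cons_append, IsBorn, IsBorn, ih]
    simp only [subEvolution]
    tauto

theorem position_append (η : Evolution d) (c : Bool) (u : Particle) :
    position η (u ++ [c]) = unitVec (η [c]).2 + position (subEvolution c η) u := by
  induction u with
  | nil => simp [position]
  | cons a v ih => simp [position, ih, subEvolution, add_assoc]

/-- A child whose descendants succeed makes the parent succeed. -/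
theorem mem_reachEvent_succ {t r : ℕ} {x z : Site d} {s : ℕ → Jump d} {η : Evolution d} {c : Bool}
    (hc : c = true → (η []).1 = true)
    (h : subEvolution c η ∈ reachEvent t (x + unitVec (subEvolution c η []).2) z s r) :
    η ∈ reachEvent (t + 1) x z s r := by
  obtain ⟨u, h1, h2, h3, h4⟩ := h
  refine ⟨u ++ [c], by simpa using h1, (isBorn_append η c u).2 ⟨h2, hc⟩, ?_, fun i hi => ?_⟩
  · rw [position_append, ← add_assoc]; exact h3
  · rw [← List.append_assoc]; exact h4 i hi

theorem reachEvent_mono {t t' r : ℕ} (h : t ≤ t') (x z : Site d) (s : ℕ → Jump d) :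
    reachEvent t x z s r ⊆ reachEvent t' x z s r := fun _ ⟨u, h1, h2⟩ => ⟨u, h1.trans h, h2⟩

/-- The first children of first children exist with certainty, so it is enough that their `r`
independent jumps are the prescribed ones. -/
theorem measureReal_reachEvent_zero [NeZero d] (b : unitInterval) (z : Site d) (s : ℕ → Jump d)
    (r : ℕ) : ((2 * d : ℝ) ^ r)⁻¹ ≤ (walkLaw d b).real (reachEvent 0 z z s r) := by
  set I : Finset Particle := (Finset.range r).image fun i => List.replicate (i + 1) false with hI
  set F : Particle → Set (Bool × (Fin d × Bool)) := fun v => Set.univ ×ˢ {s (v.length - 1)} with hF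
  have hcard : I.card = r := by
    rw [hI, Finset.card_image_of_injective, Finset.card_range]
    intro i j h
    simpa using congrArg List.length h
  have hFv : ∀ v, stepLaw d b (F v) = ((2 * d : ℕ) : ENNReal)⁻¹ := by
    intro v
    rw [hF, Measure.prod_prod, uniformOn_univ]
    simp [mul_comm]
  have h1 := Measure.infinitePi_pi (fun _ : Particle => stepLaw d b) (s := I) (t := F)
    fun v _ => (Set.toFinite _).measurableSet
  simp only [hFv, Finset.prod_const, hcard] at h1
  have h2 : Set.pi I F ⊆ reachEvent 0 z z s r := by
    intro η hη
    refine ⟨[], by simp, by simp [IsBorn], by simp [position], fun i hi => ?_⟩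
    have := hη (List.replicate (i + 1) false) (Finset.mem_coe.2 (Finset.mem_image.2
      ⟨i, Finset.mem_range.2 hi, rfl⟩))
    simpa [hF] using this
  refine le_trans (le_of_eq ?_) (measureReal_mono h2)
  have h3 : (walkLaw d b) (Set.pi I F) = ((2 * d : ℕ) : ENNReal)⁻¹ ^ r := h1
  rw [Measure.real, h3, ENNReal.toReal_pow, ENNReal.toReal_inv, ENNReal.toReal_natCast, inv_pow]
  push_cast; rfl

/-- If both potential children fail or are unborn, which has probability `(1 - a) (1 - b a)` for the
average `a` over neighbours, the parent may fail; otherwise it succeeds. -/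
theorem frontIneq_reachEvent [NeZero d] (b : unitInterval) (z : Site d) (s : ℕ → Jump d) (r : ℕ) :
    FrontIneq (b : ℝ) fun t (x : Site d) => (walkLaw d b).real (reachEvent t x z s r) where
  nonneg _ _ := measureReal_nonneg
  le_one _ _ := measureReal_le_one
  mono t x := measureReal_mono (reachEvent_mono (Nat.le_succ t) x z s)
  step t x := by
    -- In the evolution of a child, the jump stored at the root is the child's own. Reaching ignores
    -- the root's jump, which permits averaging over it.
    set S : Set (Evolution d) := {η | η ∈ reachEvent t (x + unitVec (η []).2) z s r} with hS
    have hSq : (walkLaw d b).real S =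
        nbAvg (fun x => (walkLaw d b).real (reachEvent t x z s r)) x :=
      measureReal_root_jump b (fun e => reachEvent t (x + unitVec e) z s r)
        (fun e => measurableSet_reachEvent _ _ _ _ _) fun e σ η => rejump_mem_reachEvent σ η
    have hSm : MeasurableSet S := by
      have : S = ⋃ e : Jump d, ({η | (η []).2 = e} ∩ reachEvent t (x + unitVec e) z s r) := by
        ext η; simp [hS]
      rw [this]
      exact MeasurableSet.iUnion fun e =>
        (measurableSet_jump [] e).inter (measurableSet_reachEvent _ _ _ _ _)
    have hfail := measureReal_children_fail b hSm
    rw [hSq] at hfail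
    have hsub : (reachEvent (t + 1) x z s r)ᶜ ⊆
        {η | subEvolution false η ∉ S ∧ ((η []).1 = true → subEvolution true η ∉ S)} := by
      intro η hη
      exact ⟨fun h => hη (mem_reachEvent_succ (by simp) h),
        fun h1 h => hη (mem_reachEvent_succ (fun _ => h1) h)⟩
    have h2 := measureReal_mono hsub (μ := walkLaw d b)
    rw [probReal_compl_eq_one_sub (measurableSet_reachEvent _ _ _ _ _), hfail] at h2
    nlinarith

/-- The probability that some path from some site of a cube is not followed. -/
theorem exists_cover_time (hd : 1 ≤ d) (b : unitInterval) (hb0 : 0 < b) :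
    ∃ C : ℕ, ∀ N i r T : ℕ, C * (r + 1 + d * N + i) + i ≤ T →
      walkLaw d b {η | ∃ z ∈ cube d N, ∃ s, η ∉ reachEvent T 0 z s r} ≤
        ENNReal.ofReal ((2 * N + 1) ^ d * (2 * d) ^ r * (1 - b / 2) ^ i) := by
  have : NeZero d := ⟨by omega⟩
  obtain ⟨C, hC⟩ := exists_front_time hd (show (0 : ℝ) < b from hb0) b.2.2
  refine ⟨C, fun N i r T hT => ?_⟩
  have hb2 : (0 : ℝ) ≤ 1 - b / 2 := by have := b.2.2; linarith
  -- Only the first `r` jumps matter; the default beyond them makes the union bound finite.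
  set ext : (Fin r → Jump d) → ℕ → Jump d := fun a i => if h : i < r then a ⟨i, h⟩ else (0, true)
    with hext
  have hcong : ∀ z s, reachEvent T (0 : Site d) z s r =
      reachEvent T 0 z (ext fun i => s i) r := by
    intro z s
    ext η
    refine exists_congr fun u => and_congr_right fun _ => and_congr_right fun _ =>
      and_congr_right fun _ => forall₂_congr fun i hi => ?_
    simp [hext, hi]
  have hone : ∀ z ∈ cubeFinset d N, ∀ a : Fin r → Jump d,
      walkLaw d b (reachEvent T 0 z (ext a) r)ᶜ ≤ ENNReal.ofReal ((1 - b / 2) ^ i) := by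
    intro z hz a
    have hl : l1 (0 - z) ≤ (d * N : ℕ) := by
      rw [zero_sub, l1_neg]
      have := Finset.sum_le_sum fun i (_ : i ∈ (Finset.univ : Finset (Fin d))) =>
        mem_cubeFinset.1 hz i
      simpa [l1] using this
    have h1 := hC _ (frontIneq_reachEvent b z (ext a) r) z r
      (measureReal_reachEvent_zero b z (ext a) r) (d * N) i T 0 hl hT
    rw [← probReal_compl_eq_one_sub (measurableSet_reachEvent _ _ _ _ _)] at h1
    rw [← ofReal_measureReal]
    exact ENNReal.ofReal_le_ofReal h1
  have hsub : {η : Evolution d | ∃ z ∈ cube d N, ∃ s, η ∉ reachEvent T 0 z s r} ⊆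
      ⋃ q ∈ cubeFinset d N ×ˢ (Finset.univ : Finset (Fin r → Jump d)),
        (reachEvent T 0 q.1 (ext q.2) r)ᶜ := by
    rintro η ⟨z, hz, s, hs⟩
    rw [hcong] at hs
    exact Set.mem_biUnion (x := (z, fun i : Fin r => s i)) (by simpa using mem_cubeFinset.2 hz) hs
  refine (measure_mono hsub).trans ((measure_biUnion_finset_le _ _).trans ?_)
  refine (Finset.sum_le_card_nsmul _ _ _ fun q hq =>
    hone q.1 (Finset.mem_product.1 hq).1 q.2).trans ?_
  rw [Finset.card_product, card_cubeFinset, nsmul_eq_mul, ENNReal.ofReal_mul (by positivity),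
    ← ENNReal.ofReal_natCast]
  gcongr
  apply le_of_eq
  simp [mul_comm]

/-! ### What is observed -/

theorem lineRecord_cons (o : Observations κ) (c : Bool) (v : Particle) :
    lineRecord o (c :: v) = lineRecord o v ++ [o (c :: v)] := by
  simp [lineRecord]

theorem lineRecord_eq (o : Observations κ) (u : Particle) :
    lineRecord o u = (List.range (u.length + 1)).map fun a => o (u.drop (u.length - a)) := by
  induction u with
  | nil => simp [lineRecord]
  | cons c v ih =>
    rw [lineRecord_cons, ih, List.length_cons, List.range_succ (n := v.length + 1), List.map_append]
    congr 1
    · refine List.map_congr_left fun a ha => ?_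
      have : a ≤ v.length := by have := List.mem_range.1 ha; omega
      rw [show v.length + 1 - a = v.length - a + 1 by omega, List.drop_succ_cons]
    · simp

theorem l1_position_le (η : Evolution d) (u : Particle) : l1 (position η u) ≤ u.length := by
  induction u with
  | nil => simp [position, l1_zero]
  | cons c v ih =>
    rw [position]
    refine (l1_add_le _ _).trans ?_
    rw [l1_unitVec, List.length_cons]; push_cast; linarith

/-- Ancestors in consecutive generations are at neighbouring sites, and a particle of generation at
most `T` is within `T` steps of the origin. -/
theorem exists_trail_of_appears {T T' : ℕ} {η : Evolution d} {ξ : Scenery d κ} {w : Str κ}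
    (h : Appears (observations T' η ξ) T w) : ∃ (x : Site d) (s : ℕ → Jump d),
      (∀ t < w.length, trail x s t ∈ cube d T) ∧ w = readAlong ξ (trail x s) w.length := by
  obtain ⟨u, hu, p, q, hpq⟩ := h
  rw [lineRecord_eq] at hpq
  have hlen := congrArg List.length hpq
  simp only [List.length_append, List.length_map, List.length_range] at hlen
  set anc : ℕ → Particle := fun a => u.drop (u.length - a) with hanc
  set s : ℕ → Jump d := fun i => (η (anc (p.length + i + 1))).2 with hs
  have hstep : ∀ a, a + 1 ≤ u.length →
      position η (anc (a + 1)) = position η (anc a) + unitVec (η (anc (a + 1))).2 := by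
    intro a ha
    have h1 : anc (a + 1) = u[u.length - (a + 1)]'(by omega) :: anc a := by
      simp only [hanc]
      rw [List.drop_eq_getElem_cons (by omega), show u.length - (a + 1) + 1 = u.length - a by omega]
    rw [h1, position]
  have htrail : ∀ t, p.length + t ≤ u.length →
      trail (position η (anc p.length)) s t = position η (anc (p.length + t)) := by
    intro t
    induction t with
    | zero => intro _; rw [trail_zero]; rfl
    | succ t ih =>
      intro ht
      rw [trail_succ, ih (by omega), ← add_assoc, hstep _ (by omega)]
  refine ⟨position η (anc p.length), s, fun t ht => ?_, ?_⟩
  · rw [htrail t (by omega)]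
    intro i
    refine (abs_le_l1 _ i).trans ((l1_position_le _ _).trans ?_)
    simp only [hanc, List.length_drop]
    omega
  · refine List.ext_getElem (by simp) fun t ht _ => ?_
    rw [getElem_readAlong, htrail t (by omega)]
    have h1 : (p ++ w.map some ++ q)[p.length + t]'(by simp; omega) = some w[t] := by
      rw [List.getElem_append_left (by simp; omega), List.getElem_append_right (by omega)]
      simp
    have h2 := List.getElem_of_eq hpq.symm (i := p.length + t) (by simp; omega)
    rw [h1] at h2
    simp only [List.getElem_map, List.getElem_range, observations] at h2
    split at h2
    · exact (Option.some.inj h2).symm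
    · exact absurd h2 (by simp)

theorem appears_of_mem_reachEvent {t r T T' : ℕ} {η : Evolution d} (ξ : Scenery d κ) {z : Site d}
    {s : ℕ → Jump d} (h : η ∈ reachEvent t 0 z s r) (hT : t + r ≤ T) (hT' : T ≤ T') :
    Appears (observations T' η ξ) T (readAlong ξ (trail z s) (r + 1)) := by
  obtain ⟨u, h1, h2, h3, h4⟩ := h
  rw [zero_add] at h3
  have hpos : ∀ i ≤ r, position η (List.replicate i false ++ u) = trail z s i := by
    intro i
    induction i with
    | zero => intro _; rw [trail_zero]; exact h3
    | succ i ih =>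
      intro hi
      rw [List.replicate_succ, List.cons_append, position, ih (by omega), trail_succ, ← h4 i (by omega),
        List.replicate_succ, List.cons_append]
  have hborn : ∀ i, IsBorn η (List.replicate i false ++ u) := by
    intro i
    induction i with
    | zero => exact h2
    | succ i ih => exact ⟨ih, by simp⟩
  have hobs : ∀ i ≤ r, observations T' η ξ (List.replicate i false ++ u) =
      some (ξ (trail z s i)) := by
    intro i hi
    unfold observations
    rw [if_pos ⟨by simp; omega, hborn i⟩, hpos i hi]
  refine ⟨List.replicate r false ++ u, by simp; omega, ?_⟩
  have key : ∀ i ≤ r, ∃ p, p ++ (readAlong ξ (trail z s) (i + 1)).map some =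
      lineRecord (observations T' η ξ) (List.replicate i false ++ u) := by
    intro i
    induction i with
    | zero =>
      intro _
      have h0 := hobs 0 (by omega)
      simp only [List.replicate_zero, List.nil_append] at h0 ⊢
      rw [lineRecord_eq, List.range_succ, List.map_append]
      refine ⟨_, congrArg₂ _ rfl ?_⟩
      simp [h0, readAlong, trail_zero]
    | succ i ih =>
      intro hi
      obtain ⟨p, hp⟩ := ih (by omega)
      refine ⟨p, ?_⟩
      have h0 := hobs (i + 1) hi
      rw [List.replicate_succ, List.cons_append] at h0 ⊢
      rw [lineRecord_cons, ← hp, h0, readAlong_succ, List.map_append, List.append_assoc]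
      rfl
  obtain ⟨p, hp⟩ := key r le_rfl
  exact ⟨p, [], by rw [List.append_nil]; exact hp⟩

end BRWScenery

namespace BRWScenery

variable {d κ : ℕ}

open Filter

/-! ### Orders of magnitude -/

/-- Eventually bounded by a power of `n`. -/
def PolyBounded (g : ℕ → ℝ) : Prop := ∃ k : ℕ, ∀ᶠ n : ℕ in atTop, 0 ≤ g n ∧ g n ≤ (n : ℝ) ^ k

/-- Eventually bounded by `exp (-c (log n)²)` for some positive `c`. -/
def Negligible (f : ℕ → ℝ) : Prop :=
  ∃ c : ℝ, 0 < c ∧ ∀ᶠ n : ℕ in atTop, f n ≤ Real.exp (-c * Real.log n ^ 2)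

theorem PolyBounded.const {c : ℝ} (hc : 0 ≤ c) : PolyBounded fun _ => c :=
  ⟨1, (eventually_ge_atTop ⌈c⌉₊).mono fun n hn => ⟨hc, by
    rw [pow_one]; exact (Nat.le_ceil c).trans (by exact_mod_cast hn)⟩⟩

theorem PolyBounded.natCast : PolyBounded fun n => (n : ℝ) :=
  ⟨1, Eventually.of_forall fun n => ⟨Nat.cast_nonneg n, by rw [pow_one]⟩⟩

theorem PolyBounded.mul {f g : ℕ → ℝ} (hf : PolyBounded f) (hg : PolyBounded g) :
    PolyBounded fun n => f n * g n := by
  obtain ⟨k, hk⟩ := hf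
  obtain ⟨l, hl⟩ := hg
  refine ⟨k + l, (hk.and hl).mono fun n h => ⟨mul_nonneg h.1.1 h.2.1, ?_⟩⟩
  rw [pow_add]
  exact mul_le_mul h.1.2 h.2.2 h.2.1 (by positivity)

theorem PolyBounded.add {f g : ℕ → ℝ} (hf : PolyBounded f) (hg : PolyBounded g) :
    PolyBounded fun n => f n + g n := by
  obtain ⟨k, hk⟩ := hf
  obtain ⟨l, hl⟩ := hg
  refine ⟨k + l + 1, ((hk.and hl).and (eventually_ge_atTop 2)).mono fun n h =>
    ⟨add_nonneg h.1.1.1 h.1.2.1, ?_⟩⟩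
  have h2 : (2 : ℝ) ≤ n := by exact_mod_cast h.2
  have h1 : (1 : ℝ) ≤ n := by linarith
  have e1 : (n : ℝ) ^ k ≤ (n : ℝ) ^ (k + l) := pow_le_pow_right₀ h1 (by omega)
  have e2 : (n : ℝ) ^ l ≤ (n : ℝ) ^ (k + l) := pow_le_pow_right₀ h1 (by omega)
  have e3 : 0 ≤ (n : ℝ) ^ (k + l) := by positivity
  rw [pow_succ]
  nlinarith [h.1.1.2, h.1.2.2]

theorem PolyBounded.pow {f : ℕ → ℝ} (hf : PolyBounded f) (k : ℕ) : PolyBounded fun n => f n ^ k := by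
  induction k with
  | zero => simpa using PolyBounded.const zero_le_one
  | succ k ih => simpa only [pow_succ] using ih.mul hf

theorem tendsto_log_natCast : Tendsto (fun n : ℕ => Real.log n) atTop atTop :=
  Real.tendsto_log_atTop.comp tendsto_natCast_atTop_atTop

theorem eventually_log_sq_le (K : ℝ) : ∀ᶠ n : ℕ in atTop, K * Real.log n ^ 2 ≤ n := by
  have h := (Real.isLittleO_pow_log_id_atTop (n := 2)).comp_tendsto tendsto_natCast_atTop_atTop
  have h1 := h.def (c := 1 / (|K| + 1)) (by positivity)
  filter_upwards [h1] with n hn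
  simp only [Function.comp_apply, id, Real.norm_eq_abs, Nat.abs_cast] at hn
  rw [abs_of_nonneg (sq_nonneg _), one_div, inv_mul_eq_div, le_div_iff₀ (by positivity)] at hn
  nlinarith [le_abs_self K, sq_nonneg (Real.log n)]

theorem Negligible.add {f g : ℕ → ℝ} (hf : Negligible f) (hg : Negligible g) :
    Negligible fun n => f n + g n := by
  obtain ⟨c, hc, hf⟩ := hf
  obtain ⟨c', hc', hg⟩ := hg
  have hm : 0 < min c c' := lt_min hc hc'
  refine ⟨min c c' / 2, by positivity, ?_⟩
  filter_upwards [hf, hg, tendsto_log_natCast.eventually_ge_atTop (max 1 (2 / min c c'))]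
    with n h1 h2 h3
  set L := Real.log n
  have hL1 : 1 ≤ L := (le_max_left _ _).trans h3
  have hL2 : 2 ≤ min c c' * L := by
    have := (le_max_right _ _).trans h3
    rw [div_le_iff₀ hm] at this; linarith
  have e1 : f n ≤ Real.exp (-min c c' * L ^ 2) := h1.trans (Real.exp_le_exp.2 (by
    nlinarith [min_le_left c c', sq_nonneg L]))
  have e2 : g n ≤ Real.exp (-min c c' * L ^ 2) := h2.trans (Real.exp_le_exp.2 (by
    nlinarith [min_le_right c c', sq_nonneg L]))
  have e3 : (2 : ℝ) ≤ Real.exp 1 := by have := Real.add_one_le_exp 1; linarith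
  calc f n + g n ≤ Real.exp 1 * Real.exp (-min c c' * L ^ 2) := by
        nlinarith [Real.exp_pos (-min c c' * L ^ 2)]
    _ = Real.exp (1 + -min c c' * L ^ 2) := (Real.exp_add _ _).symm
    _ ≤ _ := Real.exp_le_exp.2 (by nlinarith)

theorem Negligible.poly_mul {f g : ℕ → ℝ} (hf : Negligible f) (hg : PolyBounded g) :
    Negligible fun n => g n * f n := by
  obtain ⟨c, hc, hf⟩ := hf
  obtain ⟨k, hg⟩ := hg
  refine ⟨c / 2, by positivity, ?_⟩
  filter_upwards [hf, hg, tendsto_log_natCast.eventually_ge_atTop (2 * k / c),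
    tendsto_log_natCast.eventually_ge_atTop 0, eventually_gt_atTop 0] with n h1 h2 h3 h4 h5
  have hn : (0 : ℝ) < n := by exact_mod_cast h5
  set L := Real.log n
  have hk : (n : ℝ) ^ k = Real.exp (k * L) := by
    rw [mul_comm, Real.exp_mul, Real.exp_log hn, Real.rpow_natCast]
  rw [div_le_iff₀ hc] at h3
  calc g n * f n ≤ (n : ℝ) ^ k * Real.exp (-c * L ^ 2) :=
        mul_le_mul_of_nonneg h2.2 h1 h2.1 (Real.exp_pos _).le
    _ = Real.exp (k * L + -c * L ^ 2) := by rw [hk, ← Real.exp_add]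
    _ ≤ _ := Real.exp_le_exp.2 (by nlinarith)

theorem shortSize_le_log_sq (n : ℕ) : (shortSize n : ℝ) ≤ Real.log n ^ 2 :=
  Nat.floor_le (sq_nonneg _)

theorem log_sq_lt_shortSize (n : ℕ) : Real.log n ^ 2 < shortSize n + 1 := Nat.lt_floor_add_one _

theorem negligible_pow_shortSize_div {q : ℝ} (hq0 : 0 < q) (hq1 : q < 1) {D : ℕ} (hD : 0 < D) :
    Negligible fun n => q ^ (shortSize n / D) := by
  have hD' : (0 : ℝ) < D := by exact_mod_cast hD
  have hlq : 0 < -Real.log q := by have := Real.log_neg hq0 hq1; linarith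
  refine ⟨-Real.log q / (2 * D), by positivity, ?_⟩
  filter_upwards [tendsto_log_natCast.eventually_ge_atTop (4 * D)] with n hn
  set L := Real.log n
  have hD1 : (1 : ℝ) ≤ D := by exact_mod_cast hD
  have h1 : (shortSize n : ℝ) < D * (shortSize n / D : ℕ) + D := by
    exact_mod_cast Nat.lt_mul_div_succ (shortSize n) hD
  have h2 := log_sq_lt_shortSize n
  have h3 : L ^ 2 / (2 * D) ≤ (shortSize n / D : ℕ) := by
    rw [div_le_iff₀ (by positivity)]
    nlinarith
  have e1 : q ^ (shortSize n / D) = Real.exp (Real.log q * (shortSize n / D : ℕ)) := by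
    rw [Real.exp_mul, Real.exp_log hq0, Real.rpow_natCast]
  rw [e1]
  refine Real.exp_le_exp.2 ?_
  have : - (-Real.log q / (2 * D)) * L ^ 2 = Real.log q * (L ^ 2 / (2 * D)) := by
    field_simp
  rw [this]
  exact mul_le_mul_of_nonpos_left h3 (by linarith)

theorem polyBounded_shortSize_div (D : ℕ) : PolyBounded fun n => ((shortSize n / D : ℕ) : ℝ) := by
  refine ⟨1, (eventually_log_sq_le 1).mono fun n hn => ⟨Nat.cast_nonneg _, ?_⟩⟩
  rw [pow_one]
  have h1 : ((shortSize n / D : ℕ) : ℝ) ≤ shortSize n := by exact_mod_cast Nat.div_le_self _ _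
  have h2 := shortSize_le_log_sq n
  linarith

/-- The number of paths is only exponential in `(log n)²`, and the failure probability is
exponential in `n`. -/
theorem negligible_walk {a q : ℝ} (ha : 1 ≤ a) (hq0 : 0 < q) (hq1 : q < 1) :
    Negligible fun n => a ^ (3 * shortSize n - 1) * q ^ n := by
  have hlq : 0 < -Real.log q := by have := Real.log_neg hq0 hq1; linarith
  have hla : 0 ≤ Real.log a := Real.log_nonneg ha
  refine ⟨1, one_pos, ?_⟩
  filter_upwards [eventually_log_sq_le ((3 * Real.log a + 1) / -Real.log q)] with n hn
  set L := Real.log n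
  rw [div_mul_eq_mul_div, div_le_iff₀ hlq] at hn
  have h2 := shortSize_le_log_sq n
  have e1 : a ^ (3 * shortSize n - 1) ≤ Real.exp (Real.log a * (3 * shortSize n)) := by
    rw [Real.exp_mul, Real.exp_log (by linarith)]
    have : a ^ (3 * shortSize n - 1) ≤ a ^ (3 * shortSize n) := pow_le_pow_right₀ ha (by omega)
    refine this.trans (le_of_eq ?_)
    rw [← Real.rpow_natCast]; push_cast; rfl
  have e2 : q ^ n = Real.exp (Real.log q * n) := by
    rw [Real.exp_mul, Real.exp_log hq0, Real.rpow_natCast]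
  rw [e2]
  refine (mul_le_mul_of_nonneg_right e1 (Real.exp_pos _).le).trans ?_
  rw [← Real.exp_add]
  refine Real.exp_le_exp.2 ?_
  have : Real.log a * (3 * shortSize n) ≤ 3 * Real.log a * L ^ 2 := by nlinarith
  nlinarith

theorem negligible_separationError (hd : 1 ≤ d) (hκ : 2 * d + 1 ≤ κ) :
    Negligible (separationError d κ) := by
  have hd' : (1 : ℝ) ≤ d := by exact_mod_cast hd
  have hκ' : (1 : ℝ) < κ := by exact_mod_cast (by omega : 1 < κ)
  have P : ∀ k j : ℕ, PolyBounded fun n => (2 * (n : ℝ) ^ k + 1) ^ j := fun k j =>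
    (((PolyBounded.const (by norm_num)).mul (PolyBounded.natCast.pow k)).add
      (PolyBounded.const zero_le_one)).pow j
  have C2d : PolyBounded fun _ => (2 * d : ℝ) := PolyBounded.const (by positivity)
  refine Negligible.add ?_ ?_
  · refine Negligible.poly_mul (Negligible.poly_mul (Negligible.poly_mul
      (negligible_pow_shortSize_div ?_ ?_ (by norm_num)) C2d) ?_) ((P 2 d).mul C2d)
    · unfold coincidenceRate; positivity
    · unfold coincidenceRate; rw [div_lt_one (by positivity)]; linarith
    · exact (P 4 d).add ((polyBounded_shortSize_div 3).pow 2)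
  · refine Negligible.poly_mul (negligible_pow_shortSize_div ?_ ?_ (by positivity))
      ((P 2 d).mul (C2d.pow 2))
    · positivity
    · exact inv_lt_one_of_one_lt₀ hκ'

/-! ### The seed parameter -/

theorem seedParam_pow_le (n : ℕ) : seedParam n ^ 4 ≤ n := by
  have h1 : (seedParam n : ℝ) ≤ (n : ℝ) ^ (1 / 4 : ℝ) := Nat.floor_le (by positivity)
  have h2 : ((seedParam n : ℝ)) ^ 4 ≤ ((n : ℝ) ^ (1 / 4 : ℝ)) ^ 4 :=
    pow_le_pow_left₀ (Nat.cast_nonneg _) h1 4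
  rw [← Real.rpow_natCast ((n : ℝ) ^ (1 / 4 : ℝ)), ← Real.rpow_mul (Nat.cast_nonneg _)] at h2
  norm_num at h2
  exact_mod_cast h2

theorem seedParam_le (n : ℕ) : seedParam n ≤ n :=
  (Nat.le_self_pow (by norm_num) _).trans (seedParam_pow_le n)

theorem tendsto_seedParam : Tendsto seedParam atTop atTop :=
  tendsto_nat_floor_atTop.comp
    ((tendsto_rpow_atTop (by norm_num)).comp tendsto_natCast_atTop_atTop)

/-- The factor is `8` instead of `4` to absorb the rounding: the integer part is at least the square
root for large arguments. -/
theorem eventually_log_le_seedParam :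
    ∀ᶠ n : ℕ in atTop, Real.log n ≤ 8 * Real.log (seedParam n) := by
  have h : Tendsto (fun n : ℕ => (n : ℝ) ^ (1 / 4 : ℝ)) atTop atTop :=
    (tendsto_rpow_atTop (by norm_num)).comp tendsto_natCast_atTop_atTop
  filter_upwards [h.eventually_ge_atTop 4, eventually_gt_atTop 0] with n hn hn0
  have hn' : (0 : ℝ) < n := by exact_mod_cast hn0
  set x := (n : ℝ) ^ (1 / 4 : ℝ) with hx
  have h1 : x < seedParam n + 1 := Nat.lt_floor_add_one _
  have h2 : Real.sqrt x ≤ seedParam n := by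
    have h3 : Real.sqrt x * Real.sqrt x = x := Real.mul_self_sqrt (by linarith)
    have h4 : 2 ≤ Real.sqrt x := Real.le_sqrt_of_sq_le (by linarith)
    nlinarith
  have h5 : Real.log (Real.sqrt x) = Real.log n / 8 := by
    rw [Real.log_sqrt (by linarith), hx, Real.log_rpow hn']; ring
  have h6 := Real.log_le_log (Real.sqrt_pos.2 (by linarith)) h2
  linarith

theorem Negligible.comp_seedParam {f : ℕ → ℝ} (hf : Negligible f) :
    Negligible fun n => f (seedParam n) := by
  obtain ⟨c, hc, hf⟩ := hf
  refine ⟨c / 64, by positivity, ?_⟩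
  filter_upwards [tendsto_seedParam.eventually hf, eventually_log_le_seedParam,
    tendsto_log_natCast.eventually_ge_atTop 0] with n h1 h2 h3
  refine h1.trans (Real.exp_le_exp.2 ?_)
  have : Real.log n ^ 2 ≤ 64 * Real.log (seedParam n) ^ 2 := by nlinarith
  nlinarith

theorem eventually_largeParam : ∀ᶠ n : ℕ in atTop, LargeParam n := by
  filter_upwards [eventually_log_sq_le 3, tendsto_log_natCast.eventually_ge_atTop 3] with n h1 h2
  refine ⟨?_, ?_⟩
  · refine Nat.le_floor ?_
    push_cast
    nlinarith
  · have := shortSize_le_log_sq n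
    have h3 : (3 : ℝ) * shortSize n ≤ n := by linarith
    exact_mod_cast h3

theorem eventually_shortSize_le_seedParam : ∀ᶠ n : ℕ in atTop, shortSize n ≤ seedParam n := by
  filter_upwards [tendsto_seedParam.eventually (eventually_log_sq_le 64),
    eventually_log_le_seedParam, tendsto_log_natCast.eventually_ge_atTop 0] with n h1 h2 h3
  have := shortSize_le_log_sq n
  have h4 : (shortSize n : ℝ) ≤ seedParam n := by nlinarith
  exact_mod_cast h4

/-! ### Typical walks explore -/

/-- All the relevant paths have been followed by the times `n²` and `n⁴`. -/
def Covering (n : ℕ) (η : Evolution d) : Prop :=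
  (∀ z ∈ cube d (5 * n), ∀ s,
    η ∈ reachEvent (n ^ 2 - 3 * shortSize n) 0 z s (3 * shortSize n - 1)) ∧
  ∀ z ∈ cube d (n ^ 2), ∀ s,
    η ∈ reachEvent (n ^ 4 - 3 * shortSize n) 0 z s (3 * shortSize n - 1)

/-- The horizon `T` may exceed `n ^ 4`, as it does when level `m` is run on the observations up to
the time of level `n`. -/
theorem explored_of_covering {n T : ℕ} {η : Evolution d} (ξ : Scenery d κ)
    (hn : LargeParam n) (hT : n ^ 4 ≤ T) (h : Covering n η) :
    Explored n ξ (observations T η ξ) := by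
  have h6 := hn.six_le
  have h3 := hn.le
  have hsq := hn.sq_le
  have h24 : n ^ 2 ≤ n ^ 4 := Nat.pow_le_pow_right (by omega) (by norm_num)
  have hr : 3 * shortSize n - 1 + 1 = 3 * shortSize n := by omega
  refine ⟨fun w hw => exists_trail_of_appears hw, fun w hw => exists_trail_of_appears hw,
    fun x hx s => ?_, fun x hx s => ?_⟩
  · have := appears_of_mem_reachEvent (T := n ^ 2) (T' := T) ξ (h.1 x hx s) (by omega) (by omega)
    rwa [hr] at this
  · have := appears_of_mem_reachEvent (T := n ^ 4) (T' := T) ξ (h.2 x hx s) (by omega) (by omega)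
    rwa [hr] at this

/-- A bound for the probability that the walk does not cover. -/
noncomputable def coveringError (d : ℕ) (b : ℝ) (n : ℕ) : ℝ :=
  (2 * ((5 * n : ℕ) : ℝ) + 1) ^ d *
      ((2 * d : ℝ) ^ (3 * shortSize n - 1) * (1 - b / 2) ^ n) +
    (2 * ((n ^ 2 : ℕ) : ℝ) + 1) ^ d * ((2 * d : ℝ) ^ (3 * shortSize n - 1) * (1 - b / 2) ^ n)

theorem negligible_coveringError (hd : 1 ≤ d) {b : ℝ} (hb0 : 0 < b) (hb1 : b ≤ 1) :
    Negligible (coveringError d b) := by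
  have hd' : (1 : ℝ) ≤ d := by exact_mod_cast hd
  have hw : Negligible fun n => (2 * d : ℝ) ^ (3 * shortSize n - 1) * (1 - b / 2) ^ n :=
    negligible_walk (by linarith) (by linarith) (by linarith)
  refine Negligible.add (hw.poly_mul ?_) (hw.poly_mul ?_)
  · push_cast
    exact (((PolyBounded.const (by norm_num)).mul ((PolyBounded.const (by norm_num)).mul
      PolyBounded.natCast)).add (PolyBounded.const zero_le_one)).pow d
  · push_cast
    exact (((PolyBounded.const (by norm_num)).mul (PolyBounded.natCast.pow 2)).add
      (PolyBounded.const zero_le_one)).pow d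

theorem eventually_measure_not_covering_le (hd : 1 ≤ d) (b : unitInterval) (hb0 : 0 < b) :
    ∀ᶠ n : ℕ in atTop, walkLaw d b {η | ¬ Covering n η} ≤ ENNReal.ofReal (coveringError d b n) := by
  obtain ⟨C, hC⟩ := exists_cover_time hd b hb0
  filter_upwards [eventually_largeParam, eventually_ge_atTop (C * (5 * d + 2) + 2)] with n hn hCn
  have h6 := hn.six_le
  have h3 := hn.le
  have hr : 3 * shortSize n - 1 + 1 = 3 * shortSize n := by omega
  have hnn : (C * (5 * d + 2) + 2) * n ≤ n ^ 2 := by rw [sq]; exact Nat.mul_le_mul_right n hCn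
  have e0 : C * (3 * shortSize n) ≤ C * n := Nat.mul_le_mul_left _ h3
  -- With `i = n`, covering a cube of radius `5n` takes time linear in `n`, which fits into `n ^ 2`.
  -- Likewise, radius `n ^ 2` fits into `n ^ 4`.
  have t1 : C * (3 * shortSize n - 1 + 1 + d * (5 * n) + n) + n ≤ n ^ 2 - 3 * shortSize n := by
    rw [hr]
    refine Nat.le_sub_of_add_le ?_
    nlinarith
  have hn1 : 1 ≤ n := by omega
  have t2 : C * (3 * shortSize n - 1 + 1 + d * n ^ 2 + n) + n ≤ n ^ 4 - 3 * shortSize n := by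
    rw [hr]
    refine Nat.le_sub_of_add_le ?_
    have e1 : (C * (5 * d + 2) + 2) * n * n ^ 2 ≤ n ^ 2 * n ^ 2 := Nat.mul_le_mul_right _ hnn
    have e2 : n ≤ n ^ 2 := Nat.le_self_pow (by norm_num) n
    have e4 : n ^ 2 ≤ n * n ^ 2 := Nat.le_mul_of_pos_left _ hn1
    have e5 : n ^ 2 * n ^ 2 = n ^ 4 := by ring
    have e6 : (C * (5 * d + 2) + 2) * n ^ 2 ≤ (C * (5 * d + 2) + 2) * (n * n ^ 2) :=
      Nat.mul_le_mul_left _ e4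
    have e7 : C * n ≤ C * n ^ 2 := Nat.mul_le_mul_left _ e2
    nlinarith [Nat.zero_le (C * d * n ^ 2)]
  have hsub : {η : Evolution d | ¬ Covering n η} ⊆
      {η | ∃ z ∈ cube d (5 * n), ∃ s,
        η ∉ reachEvent (n ^ 2 - 3 * shortSize n) 0 z s (3 * shortSize n - 1)} ∪
      {η | ∃ z ∈ cube d (n ^ 2), ∃ s,
        η ∉ reachEvent (n ^ 4 - 3 * shortSize n) 0 z s (3 * shortSize n - 1)} := by
    intro η hη
    by_contra hcon
    simp only [Set.mem_union, Set.mem_ofPred_eq, not_or, not_exists, not_and, not_not] at hcon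
    exact hη ⟨hcon.1, hcon.2⟩
  refine (measure_mono hsub).trans ((measure_union_le _ _).trans ?_)
  have hb2 : (0 : ℝ) ≤ 1 - b / 2 := by have := b.2.2; linarith
  unfold coveringError
  rw [ENNReal.ofReal_add (by positivity) (by positivity), ← mul_assoc, ← mul_assoc]
  exact add_le_add (hC _ _ _ _ t1) (hC _ _ _ _ t2)

/-! ### Selection of outcomes and the final union bound -/

theorem exists_carriesOut [NeZero κ] (d n : ℕ) :
    ∃ Λ : Observations κ → OutBox d n → Fin κ, CarriesOut n Λ := by
  have : ∀ o : Observations κ, ∃ c : OutBox d n → Fin κ,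
      (∃ c : OutBox d n → Fin κ, IsOutcome n o c) → IsOutcome n o c := by
    intro o
    by_cases h : ∃ c : OutBox d n → Fin κ, IsOutcome n o c
    · obtain ⟨c, hc⟩ := h
      exact ⟨c, fun _ => hc⟩
    · exact ⟨fun _ => 0, fun h' => absurd h' h⟩
  choose Λ hΛ using this
  exact ⟨Λ, hΛ⟩

end BRWScenery

theorem theorem2 (d κ : ℕ) (hd : 1 ≤ d) (hκ : 2 * d + 1 ≤ κ) (b : unitInterval)
    (hb0 : 0 < b) (hb1 : b < 1) :
    ∃ C : ℝ, 0 < C ∧ ∃ N : ℕ, ∀ n : ℕ, N ≤ n →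
      (∃ Λ : Observations κ → OutBox d n → Fin κ, CarriesOut n Λ) ∧
      ∀ Λ : Observations κ → OutBox d n → Fin κ, CarriesOut n Λ →
        ENNReal.ofReal (1 - Real.exp (-C * Real.log n ^ 2)) ≤
          jointLaw d κ b {ω | ∃ x ∈ box (0 : Site d) (Real.sqrt n),
            Equivalent (Λ (observations (n ^ 4) ω.1 ω.2))
              (fun z : box x (4 * (n : ℝ)) => ω.2 z)} := by
  have : NeZero d := ⟨by omega⟩
  have : NeZero κ := ⟨by omega⟩
  have hsep := negligible_separationError hd hκ
  have hcov := negligible_coveringError hd (show (0 : ℝ) < b from hb0) b.2.2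
  obtain ⟨C, hC, htotal⟩ :=
    (hsep.add hcov).add (hsep.comp_seedParam.add hcov.comp_seedParam)
  have hcovle := eventually_measure_not_covering_le hd b hb0
  have hev := htotal.and ((hcovle.and (tendsto_seedParam.eventually hcovle)).and
    ((eventually_largeParam.and (tendsto_seedParam.eventually eventually_largeParam)).and
      eventually_shortSize_le_seedParam))
  obtain ⟨N, hN⟩ := Filter.eventually_atTop.1 hev
  refine ⟨C, hC, N, fun n hn => ⟨exists_carriesOut d n, fun Λ hΛ => ?_⟩⟩
  obtain ⟨herr, ⟨hcov1, hcov2⟩, ⟨hlarge, hlarge'⟩, hshort⟩ := hN n hn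
  set m := seedParam n with hm
  set good := {ω : Evolution d × Scenery d κ | ∃ x ∈ box (0 : Site d) (Real.sqrt n),
    Equivalent (Λ (observations (n ^ 4) ω.1 ω.2)) (fun z : box x (4 * (n : ℝ)) => ω.2 z)} with hgood
  have hmn : m ≤ n := seedParam_le n
  -- Failure requires one of four bad events: an untypical scenery or an untypical walk, at level
  -- `n` or at level `m`.
  have hsub : goodᶜ ⊆ (Set.univ ×ˢ {ξ | ¬ Separated n ξ} ∪ {η | ¬ Covering n η} ×ˢ Set.univ) ∪
      (Set.univ ×ˢ {ξ | ¬ Separated m ξ} ∪ {η | ¬ Covering m η} ×ˢ Set.univ) := by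
    rintro ⟨η, ξ⟩ hω
    by_contra hcon
    simp only [Set.mem_union, Set.mem_prod, Set.mem_univ, Set.mem_ofPred_eq, true_and, and_true,
      not_or, not_not] at hcon
    obtain ⟨⟨hS, hE⟩, hS', hE'⟩ := hcon
    have hE := explored_of_covering ξ hlarge le_rfl hE
    have hE' := explored_of_covering ξ hlarge' (Nat.pow_le_pow_left hmn 4) hE'
    have hout := hΛ (observations (n ^ 4) η ξ)
      ⟨_, isOutcome_scenery ⟨0, by omega⟩ hS hE hlarge hS' hE' hlarge' hmn⟩
    obtain ⟨x, hx, hequiv⟩ :=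
      equivalent_of_isOutcome hS hE hlarge hS' hE' hlarge' hshort hmn hout
    refine hω ⟨x, fun i => ?_, hequiv⟩
    have h1 : |(((x i - (0 : Site d) i : ℤ)) : ℝ)| ≤ ((m ^ 2 : ℕ) : ℝ) := by
      rw [Pi.zero_apply, sub_zero, ← Int.cast_abs]
      exact_mod_cast hx i
    refine h1.trans (Real.le_sqrt_of_sq_le ?_)
    have h2 : (m ^ 2) ^ 2 ≤ n := by rw [← pow_mul]; exact seedParam_pow_le n
    exact_mod_cast h2
  have hbad : jointLaw d κ b goodᶜ ≤ ENNReal.ofReal (Real.exp (-C * Real.log n ^ 2)) := by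
    have hpos : ∀ k, 0 ≤ separationError d κ k := fun k => by
      unfold separationError coincidenceRate; positivity
    have hpos' : ∀ k, 0 ≤ coveringError d b k := fun k => by
      have hb2 : (0 : ℝ) ≤ 1 - b / 2 := by have := b.2.2; linarith
      unfold coveringError; positivity
    refine le_trans ?_ (ENNReal.ofReal_le_ofReal herr)
    rw [ENNReal.ofReal_add (add_nonneg (hpos _) (hpos' _)) (add_nonneg (hpos _) (hpos' _)),
      ENNReal.ofReal_add (hpos _) (hpos' _), ENNReal.ofReal_add (hpos _) (hpos' _)]
    refine (measure_mono hsub).trans ((measure_union_le _ _).trans (add_le_add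
      ((measure_union_le _ _).trans (add_le_add ?_ ?_))
      ((measure_union_le _ _).trans (add_le_add ?_ ?_))))
    · rw [jointLaw, Measure.prod_prod, measure_univ, one_mul]
      exact measure_not_separated_le hd hκ hlarge.six_le
    · rw [jointLaw, Measure.prod_prod, measure_univ, mul_one]
      exact hcov1
    · rw [jointLaw, Measure.prod_prod, measure_univ, one_mul]
      exact measure_not_separated_le hd hκ hlarge'.six_le
    · rw [jointLaw, Measure.prod_prod, measure_univ, mul_one]
      exact hcov2
  -- No measurability of `Λ` is assumed, so `good` need not be measurable; subadditivity replaces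
  -- the formula for complements.
  have huniv : (1 : ENNReal) ≤ jointLaw d κ b good + jointLaw d κ b goodᶜ := by
    have h1 : jointLaw d κ b Set.univ = 1 := by
      rw [jointLaw, ← Set.univ_prod_univ, Measure.prod_prod, measure_univ, measure_univ, one_mul]
    rw [← h1, ← Set.union_compl_self good]
    exact measure_union_le _ _
  rw [ENNReal.ofReal_sub _ (Real.exp_pos _).le, ENNReal.ofReal_one]
  exact tsub_le_iff_right.2 (huniv.trans (add_le_add le_rfl hbad))
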